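/- Let $k$ be an algebraically closed field of characteristic $0$ and $G$ a finite group. Write $k^G=(kG)^*$ with basis $e_g$, $\hat A=\mathrm{Hom}(A,k^\times)$, $G_{ab}=G/[G,G]$, $Z(G)$ for the center, and let $DG=k^G\otimes kG$ be the Drinfeld double, with basis $e_x\times y$ ($x,y\in G$) and $$(e_x\times y)(e_{x'}\times y')=e_x(yx'y^{-1})\,(e_x\times yy'),\qquad \Delta(e_x\times y)=\sum_{x_1x_2=x}(e_{x_1}\times y)\otimes(e_{x_2}\times y),\qquad \epsilon(e_x\times y)=\delta_{x,1}.$$ Let $\mathrm{Aut}_{Hopf}(DG)$ be its group of Hopf algebra automorphisms under composition. Let $\mathrm{Aut}_c(G)=\{v\in \mathrm{Aut}(G): v(g)g^{-1}\in Z(G)\ \forall g\}$. Consider the following subgroups of $\mathrm{Aut}_{Hopf}(DG)$: * $V$: the maps $e_g\times h\mapsto e_{v(g)}\times v(h)$, $v\in\mathrm{Aut}(G)$; * $V_c$: the maps $e_g\times h\mapsto e_{v(g)}\times h$, $v\in\mathrm{Aut}_c(G)$; * $B$: the maps $e_g\times h\mapsto b(h)(g)\,e_g\times h$, $b\in\mathrm{Hom}(G_{ab},\widehat{G}_{ab})$;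 * $E$: the maps $e_g\times h\mapsto\sum_{g_1g_2=g}e_{g_1}\times a(e_{g_2})h$, $a\in\mathrm{Hom}(\widehat{Z(G)},Z(G))$, where $a$ is extended linearly to $k^{Z(G)}=k\widehat{Z(G)}\to kZ(G)$ and precomposed with the restriction $k^G\to k^{Z(G)}$. The parametrizations give isomorphisms $V\cong\mathrm{Aut}(G)$, $V_c\cong\mathrm{Aut}_c(G)$, $B\cong\mathrm{Hom}(G_{ab},\widehat{G}_{ab})$, $E\cong\mathrm{Hom}(\widehat{Z(G)},Z(G))$, and one has internal semidirect products $V_c\rtimes V$, $(V_c\rtimes V)\ltimes B$ and $(V_c\rtimes V)\ltimes E$. A twisted reflection is given by $(H,C,\delta,\nu)$, where $H,C$ are subgroups of $G$ with $C$ abelian and $G=H\times C$ (internal direct product), $\delta:C\to\hat C$ is an isomorphism (equivalently a Hopf isomorphism $kC\to k^C=k\hat C$) and $\nu:C\to C$ is a nilpotent endomorphism (some iterate is trivial). It is the Hopf automorphism of $DG$ $$r_{(H,C,\delta,\nu)}:\ (f_H,f_C)\times(h,c)\mapsto(f_H,\delta(c))\times(h,\delta^{-1}(f_C)\,\nu(c)).$$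 It is called a reflection, written $r_{(H,C,\delta)}$, if $\nu$ is trivial. Let $R$ be the set of reflections. Then: 1. $\mathrm{Aut}_{Hopf}(DG)$ is generated by $V$, $V_c$, $B$, $E$ and $R$. 2. For every $\phi\in\mathrm{Aut}_{Hopf}(DG)$ there is a twisted reflection $r$ with $\phi\in[(V_c\rtimes V)\ltimes B]\cdot r\cdot[(V_c\rtimes V)\ltimes E]$. 3. For reflections $r=r_{(H,C,\delta)}$ and $r'=r_{(H',C',\delta')}$, the double cosets $[(V_c\rtimes V)\ltimes B]\,r\,[(V_c\rtimes V)\ltimes E]$ and $[(V_c\rtimes V)\ltimes B]\,r'\,[(V_c\rtimes V)\ltimes E]$ are equal if and only if $C\cong C'$. 4. For every $\phi\in\mathrm{Aut}_{Hopf}(DG)$ there is a reflection $r$ with $\phi\in r\cdot[B((V_c\rtimes V)\ltimes E)]$. 5. For every $\phi\in\mathrm{Aut}_{Hopf}(DG)$ there is a reflection $r$ with $\phi\in[((V_c\rtimes V)\ltimes B)E]\cdot r$. 6. If $p$ is prime and $G\cong\mathbb F_p^n$, there is an isomorphism $\mathrm{Aut}_{Hopf}(DG)\cong\mathrm{GL}_{2n}(\mathbb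 F_p)$ that, in $n\times n$ blocks, identifies $V_c\rtimes V$ with the block diagonal matrices, $B$ and $E$ with the block matrices $\begin{pmatrix}1&*\\0&1\end{pmatrix}$ and $\begin{pmatrix}1&0\\ *&1\end{pmatrix}$, and $(V_c\rtimes V)\ltimes B$ and $(V_c\rtimes V)\ltimes E$ with the invertible block upper and block lower triangular matrices $P^+$ and $P^-$. For each $0\le m\le n$, the permutation matrix $w_m$ exchanging the basis vectors $i$ and $n+i$ for $1\le i\le m$ and fixing the others is the image of a reflection with $|C|=p^m$, and $\mathrm{GL}_{2n}(\mathbb F_p)$ is the disjoint union of the $n+1$ double cosets $P^+w_mP^-$, $0\le m\le n$. -/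

import Mathlib

open TensorProduct

/-- The underlying space `k^G ⊗ kG` of the Drinfeld double `DG` of the group algebra of a finite
group `G`: the function `F : G × G → k` stands for `∑ F (x, y) (e_x × y)`. -/
def DrinfeldDouble (k G : Type*) : Type _ := G × G → k

set_option linter.unusedSectionVars false

namespace DrinfeldDouble

section Basic

variable {k G : Type*} [Field k] [Group G] [Fintype G] [DecidableEq G]

instance : AddCommGroup (DrinfeldDouble k G) := inferInstanceAs (AddCommGroup (G × G → k))
instance : Module k (DrinfeldDouble k G) := inferInstanceAs (Module k (G × G → k))

/-- The basis element `e_x × y` of `DG`. -/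
def e (x y : G) : DrinfeldDouble k G := (Pi.single (x, y) (1 : k) : G × G → k)

/-- The basis `(e_x × y)` of `DG`. -/
noncomputable def stdBasis (k G : Type*) [Field k] [Group G] [Fintype G] [DecidableEq G] :
    Module.Basis (G × G) k (DrinfeldDouble k G) := Pi.basisFun k (G × G)

@[simp] theorem stdBasis_apply (p : G × G) : stdBasis k G p = e p.1 p.2 :=
  Pi.basisFun_apply k (G × G) p

theorem e_apply (x y x' y' : G) :
    (e x y : DrinfeldDouble k G) (x', y') = if x' = x ∧ y' = y then 1 else 0 := by
  simp [e, Pi.single_apply]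

/-- The product of `DG`; on the basis it is
`(e_x × y)(e_x' × y') = e_x(y x' y⁻¹) (e_x × y y')`, see `e_mul_e`. -/
instance : Mul (DrinfeldDouble k G) where
  mul F F' := fun p => ∑ z : G, F (p.1, z) * F' (z⁻¹ * p.1 * z, z⁻¹ * p.2)

/-- The unit `∑ x, e_x × 1` of `DG`, see `one_eq_sum`. -/
instance : One (DrinfeldDouble k G) where
  one := fun p => if p.2 = 1 then 1 else 0

theorem mul_apply (F F' : DrinfeldDouble k G) (x y : G) :
    (F * F') (x, y) = ∑ z : G, F (x, z) * F' (z⁻¹ * x * z, z⁻¹ * y) := rfl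

theorem one_apply (x y : G) :
    (1 : DrinfeldDouble k G) (x, y) = if y = 1 then 1 else 0 := rfl

theorem add_apply (F F' : DrinfeldDouble k G) (p : G × G) : (F + F') p = F p + F' p := rfl
theorem smul_apply (c : k) (F : DrinfeldDouble k G) (p : G × G) : (c • F) p = c * F p := rfl
theorem zero_apply (p : G × G) : (0 : DrinfeldDouble k G) p = 0 := rfl

@[ext] theorem ext {F F' : DrinfeldDouble k G} (h : ∀ x y, F (x, y) = F' (x, y)) : F = F' :=
  funext fun p => h p.1 p.2

instance : Ring (DrinfeldDouble k G) :=
  { (inferInstance : AddCommGroup (DrinfeldDouble k G)),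
    (inferInstance : Mul (DrinfeldDouble k G)), (inferInstance : One (DrinfeldDouble k G)) with
    left_distrib := fun a b c => by
      ext x y; simp [mul_apply, add_apply, mul_add, Finset.sum_add_distrib]
    right_distrib := fun a b c => by
      ext x y; simp [mul_apply, add_apply, add_mul, Finset.sum_add_distrib]
    zero_mul := fun a => by ext x y; simp [mul_apply, zero_apply]
    mul_zero := fun a => by ext x y; simp [mul_apply, zero_apply]
    one_mul := fun a => by
      ext x y; simp [mul_apply, one_apply]
    mul_one := fun a => by
      ext x y; simp [mul_apply, one_apply, inv_mul_eq_one]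
    mul_assoc := fun a b c => by
      ext x y
      simp only [mul_apply, Finset.sum_mul, Finset.mul_sum]
      rw [Finset.sum_comm]
      refine Finset.sum_congr rfl fun w _ => ?_
      rw [← Equiv.sum_comp (Equiv.mulLeft w)]
      refine Finset.sum_congr rfl fun z _ => ?_
      simp [mul_assoc] }

instance : Algebra k (DrinfeldDouble k G) :=
  Algebra.ofModule
    (fun c a b => by ext x y; simp [mul_apply, smul_apply, Finset.mul_sum, mul_assoc])
    (fun c a b => by ext x y; simp [mul_apply, smul_apply, Finset.mul_sum, mul_left_comm])

theorem e_mul_e (x y x' y' : G) :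
    (e x y * e x' y' : DrinfeldDouble k G) = if x = y * x' * y⁻¹ then e x (y * y') else 0 := by
  ext a b
  rw [mul_apply]
  have : ∀ z : G, (e x y : DrinfeldDouble k G) (a, z) * e x' y' (z⁻¹ * a * z, z⁻¹ * b) =
      if z = y then (if a = x ∧ y⁻¹ * a * y = x' ∧ y⁻¹ * b = y' then (1 : k) else 0) else 0 := by
    intro z
    rw [e_apply, e_apply]
    by_cases hz : z = y
    · subst hz; simp only [← ite_and, mul_ite, mul_one, mul_zero, and_true]; congr 1; simp only [eq_iff_iff]; tauto
    · simp [hz]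
  simp only [this, Finset.sum_ite_eq', Finset.mem_univ, if_true]
  by_cases h : x = y * x' * y⁻¹
  · rw [if_pos h, e_apply]
    refine if_congr ?_ rfl rfl
    constructor
    · rintro ⟨rfl, h1, h2⟩; exact ⟨rfl, by rw [← h2]; group⟩
    · rintro ⟨rfl, rfl⟩; refine ⟨rfl, ?_, by group⟩; rw [h]; group
  · rw [if_neg h, zero_apply, if_neg]
    rintro ⟨rfl, h1, -⟩
    exact h (by rw [← h1]; group)

theorem one_eq_sum : (1 : DrinfeldDouble k G) = ∑ x : G, e x 1 := by
  ext a b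
  have : (∑ x : G, (e x 1 : DrinfeldDouble k G)) (a, b)
      = ∑ x : G, (e x 1 : DrinfeldDouble k G) (a, b) := Finset.sum_apply _ _ _
  rw [this, one_apply]
  simp only [e_apply]
  simp [ite_and]

/-- `Δ(e_x × y) = ∑_{x₁ x₂ = x} (e_x₁ × y) ⊗ (e_x₂ × y)` and `ε(e_x × y) = δ_{x,1}`. -/
noncomputable instance : CoalgebraStruct k (DrinfeldDouble k G) where
  comul := (stdBasis k G).constr k fun p => ∑ x : G, e x p.2 ⊗ₜ[k] e (x⁻¹ * p.1) p.2
  counit := (stdBasis k G).constr k fun p => if p.1 = 1 then 1 else 0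

theorem comul_e (x y : G) : Coalgebra.comul (R := k) (e x y : DrinfeldDouble k G) =
    ∑ z : G, e z y ⊗ₜ[k] e (z⁻¹ * x) y := by
  have := (stdBasis k G).constr_basis k
    (fun p => ∑ x : G, (e x p.2 : DrinfeldDouble k G) ⊗ₜ[k] (e (x⁻¹ * p.1) p.2 : DrinfeldDouble k G)) (x, y)
  rwa [stdBasis_apply] at this

theorem counit_e (x y : G) : Coalgebra.counit (R := k) (e x y : DrinfeldDouble k G) =
    if x = 1 then 1 else 0 := by
  have := (stdBasis k G).constr_basis k (fun p : G × G => if p.1 = 1 then (1 : k) else 0) (x, y)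
  rwa [stdBasis_apply] at this

noncomputable instance : Coalgebra k (DrinfeldDouble k G) where
  coassoc := by
    refine (stdBasis k G).ext fun p => ?_
    obtain ⟨x, y⟩ := p
    simp only [stdBasis_apply, LinearMap.coe_comp, Function.comp_apply, comul_e, map_sum,
      LinearMap.rTensor_tmul, LinearMap.lTensor_tmul, LinearEquiv.coe_coe, sum_tmul, tmul_sum,
      TensorProduct.assoc_tmul]
    rw [Finset.sum_comm]
    refine Finset.sum_congr rfl fun a _ => ?_
    rw [← Equiv.sum_comp (Equiv.mulLeft a)]
    refine Finset.sum_congr rfl fun z _ => ?_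
    simp [mul_assoc]
  rTensor_counit_comp_comul := by
    refine (stdBasis k G).ext fun p => ?_
    simp [comul_e, counit_e, ite_tmul]
  lTensor_counit_comp_comul := by
    refine (stdBasis k G).ext fun p => ?_
    simp [comul_e, counit_e, tmul_ite, inv_mul_eq_one]

noncomputable instance : Bialgebra k (DrinfeldDouble k G) where
  counit_one := by simp [one_eq_sum, counit_e]
  mul_compr₂_counit := by
    refine (stdBasis k G).ext fun p => (stdBasis k G).ext fun q => ?_
    obtain ⟨x, y⟩ := p
    obtain ⟨x', y'⟩ := q
    simp only [stdBasis_apply, LinearMap.compr₂_apply, LinearMap.mul_apply', e_mul_e,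
      LinearMap.compl₁₂_apply, counit_e, apply_ite (Coalgebra.counit (R := k)), map_zero]
    by_cases h : x = 1
    · subst h
      by_cases h' : x' = 1
      · simp [h']
      · have : ¬ (1 = y * x' * y⁻¹) := fun h => h' (by simpa using h.symm)
        simp [h', this]
    · simp [h]
  comul_one := by
    rw [one_eq_sum, map_sum]
    simp only [comul_e]
    rw [Finset.sum_comm, Algebra.TensorProduct.one_def, one_eq_sum, sum_tmul]
    refine Finset.sum_congr rfl fun x _ => ?_
    rw [tmul_sum, ← Equiv.sum_comp (Equiv.mulLeft x)]
    simp
  mul_compr₂_comul := by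
    refine (stdBasis k G).ext fun p => (stdBasis k G).ext fun q => ?_
    obtain ⟨x, y⟩ := p
    obtain ⟨x', y'⟩ := q
    simp only [stdBasis_apply, LinearMap.compr₂_apply, LinearMap.mul_apply', e_mul_e,
      LinearMap.compl₁₂_apply, comul_e, apply_ite (Coalgebra.comul (R := k)), map_zero,
      Finset.sum_mul, Finset.mul_sum, Algebra.TensorProduct.tmul_mul_tmul]
    rw [Finset.sum_comm]
    have key : ∀ a b : G, ((if b = y * a * y⁻¹ then (e b (y * y') : DrinfeldDouble k G) else 0) ⊗ₜ[k]
        (if b⁻¹ * x = y * (a⁻¹ * x') * y⁻¹ then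
          (e (b⁻¹ * x) (y * y') : DrinfeldDouble k G) else 0)) =
        if b = y * a * y⁻¹ then (if x = y * x' * y⁻¹ then
          (e b (y * y') : DrinfeldDouble k G) ⊗ₜ[k] (e (b⁻¹ * x) (y * y')) else 0) else 0 := by
      intro a b
      by_cases h : b = y * a * y⁻¹
      · have : b⁻¹ * x = y * (a⁻¹ * x') * y⁻¹ ↔ x = y * x' * y⁻¹ := by
          rw [inv_mul_eq_iff_eq_mul, h]
          constructor <;> intro h <;> rw [h] <;> group
        by_cases h' : x = y * x' * y⁻¹
        · simp only [if_pos h, if_pos h', if_pos (this.2 h')]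
        · simp only [if_pos h, if_neg h', if_neg (fun h => h' (this.1 h)), tmul_zero]
      · simp only [if_neg h, zero_tmul]
    simp only [key]
    by_cases h' : x = y * x' * y⁻¹
    · simp only [if_pos h']
      refine Finset.sum_congr rfl fun a _ => ?_
      rw [Finset.sum_eq_single (y⁻¹ * a * y)]
      · simp [mul_assoc]
      · intro b _ hb
        rw [if_neg]
        intro h; exact hb (by rw [h]; group)
      · simp
    · simp [h']

/-- The antipode is `S(e_x × y) = e_{y⁻¹ x⁻¹ y} × y⁻¹`. -/
noncomputable instance : HopfAlgebra k (DrinfeldDouble k G) where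
  antipode := (stdBasis k G).constr k fun p => e (p.2⁻¹ * p.1⁻¹ * p.2) p.2⁻¹
  mul_antipode_rTensor_comul := by
    refine (stdBasis k G).ext fun p => ?_
    obtain ⟨x, y⟩ := p
    have hS : ∀ a b : G, ((stdBasis k G).constr k fun p : G × G =>
        (e (p.2⁻¹ * p.1⁻¹ * p.2) p.2⁻¹ : DrinfeldDouble k G)) (e a b) =
          e (b⁻¹ * a⁻¹ * b) b⁻¹ := by
      intro a b
      have := (stdBasis k G).constr_basis k (fun p : G × G =>
        (e (p.2⁻¹ * p.1⁻¹ * p.2) p.2⁻¹ : DrinfeldDouble k G)) (a, b)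
      rwa [stdBasis_apply] at this
    simp only [stdBasis_apply, LinearMap.coe_comp, Function.comp_apply, comul_e, map_sum,
      LinearMap.rTensor_tmul, hS, LinearMap.mul'_apply, e_mul_e, counit_e,
      Algebra.linearMap_apply]
    by_cases h : x = 1
    · subst h
      simp only [if_true, map_one, one_eq_sum]
      rw [← Equiv.sum_comp ((Equiv.inv G).trans (MulAut.conj y).toEquiv)]
      refine Finset.sum_congr rfl fun a _ => ?_
      simp [mul_assoc]
    · simp only [if_neg h, map_zero]
      refine Finset.sum_eq_zero fun a _ => if_neg ?_
      intro h1
      apply h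
      have : a⁻¹ = a⁻¹ * x := by simpa [mul_assoc] using h1
      simpa using this
  mul_antipode_lTensor_comul := by
    refine (stdBasis k G).ext fun p => ?_
    obtain ⟨x, y⟩ := p
    have hS : ∀ a b : G, ((stdBasis k G).constr k fun p : G × G =>
        (e (p.2⁻¹ * p.1⁻¹ * p.2) p.2⁻¹ : DrinfeldDouble k G)) (e a b) =
          e (b⁻¹ * a⁻¹ * b) b⁻¹ := by
      intro a b
      have := (stdBasis k G).constr_basis k (fun p : G × G =>
        (e (p.2⁻¹ * p.1⁻¹ * p.2) p.2⁻¹ : DrinfeldDouble k G)) (a, b)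
      rwa [stdBasis_apply] at this
    simp only [stdBasis_apply, LinearMap.coe_comp, Function.comp_apply, comul_e, map_sum,
      LinearMap.lTensor_tmul, hS, LinearMap.mul'_apply, e_mul_e, counit_e,
      Algebra.linearMap_apply]
    by_cases h : x = 1
    · subst h
      simp [one_eq_sum, mul_assoc]
    · simp only [if_neg h, map_zero]
      refine Finset.sum_eq_zero fun a _ => if_neg ?_
      intro h1
      apply h
      have : a = x⁻¹ * a := by simpa [mul_assoc] using h1
      simpa using this

end Basic

section Aut

variable {k G : Type*} [Field k] [Group G] [Fintype G] [DecidableEq G]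

/-- `Aut_Hopf(DG)`: the bijective `k`-linear maps that are algebra and coalgebra maps (such maps
commute with the antipode automatically). -/
abbrev HopfAut (k G : Type*) [Field k] [Group G] [Fintype G] [DecidableEq G] : Type _ :=
  DrinfeldDouble k G ≃ₐc[k] DrinfeldDouble k G

/-- The group structure is composition. -/
noncomputable instance : Group (HopfAut k G) where
  mul φ ψ := ψ.trans φ
  one := BialgEquiv.refl k _
  inv φ := φ.symm
  mul_assoc _ _ _ := rfl
  one_mul _ := rfl
  mul_one _ := rfl
  inv_mul_cancel φ := BialgEquiv.ext fun F => φ.symm_apply_apply F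

theorem HopfAut.mul_apply (φ ψ : HopfAut k G) (F : DrinfeldDouble k G) :
    (φ * ψ) F = φ (ψ F) := rfl
theorem HopfAut.one_apply (F : DrinfeldDouble k G) : (1 : HopfAut k G) F = F := rfl

theorem HopfAut.ext_e {φ ψ : HopfAut k G}
    (h : ∀ x y, φ (e x y) = ψ (e x y)) : φ = ψ := by
  have : (φ : DrinfeldDouble k G →ₐc[k] DrinfeldDouble k G).toCoalgHom.toLinearMap =
      (ψ : DrinfeldDouble k G →ₐc[k] DrinfeldDouble k G).toCoalgHom.toLinearMap :=
    (stdBasis k G).ext fun p => by rw [stdBasis_apply]; exact h p.1 p.2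
  exact BialgEquiv.ext fun F => LinearMap.congr_fun this F

/-- Builds a Hopf automorphism from a linear map, its inverse, and the axioms on a spanning set. -/
noncomputable def mkAut (S : Set (DrinfeldDouble k G)) (hS : Submodule.span k S = ⊤)
    (f g : DrinfeldDouble k G →ₗ[k] DrinfeldDouble k G)
    (hfg : ∀ F ∈ S, f (g F) = F) (hgf : ∀ F ∈ S, g (f F) = F)
    (hmul : ∀ F ∈ S, ∀ F' ∈ S, f (F * F') = f F * f F')
    (hcounit : ∀ F ∈ S, Coalgebra.counit (R := k) (f F) = Coalgebra.counit (R := k) F)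
    (hcomul : ∀ F ∈ S, TensorProduct.map f f (Coalgebra.comul (R := k) F) =
      Coalgebra.comul (R := k) (f F)) : HopfAut k G :=
  have hm : ∀ F F', f (F * F') = f F * f F' := by
    have : (LinearMap.mul k (DrinfeldDouble k G)).compr₂ f =
        (LinearMap.mul k (DrinfeldDouble k G)).compl₁₂ f f :=
      LinearMap.ext_on hS fun F hF => LinearMap.ext_on hS fun F' hF' => hmul F hF F' hF'
    exact fun F F' => LinearMap.congr_fun (LinearMap.congr_fun this F) F'
  have h1 : f ∘ₗ g = LinearMap.id := LinearMap.ext_on hS hfg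
  have h2 : g ∘ₗ f = LinearMap.id := LinearMap.ext_on hS hgf
  { f with
    invFun := g
    left_inv := LinearMap.congr_fun h2
    right_inv := LinearMap.congr_fun h1
    counit_comp := LinearMap.ext_on hS hcounit
    map_comp_comul := LinearMap.ext_on hS hcomul
    map_mul' := hm }

theorem mkAut_apply (S : Set (DrinfeldDouble k G)) (hS f g hfg hgf hmul hcounit hcomul)
    (F : DrinfeldDouble k G) :
    (mkAut S hS f g hfg hgf hmul hcounit hcomul : HopfAut k G) F = f F := rfl

theorem span_e : Submodule.span k (Set.range fun p : G × G =>
    (e p.1 p.2 : DrinfeldDouble k G)) = ⊤ := by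
  have := (stdBasis k G).span_eq
  rwa [show ⇑(stdBasis k G) = fun p : G × G => (e p.1 p.2 : DrinfeldDouble k G) from
    funext stdBasis_apply] at this

/-- The linear endomorphism of `DG` with `e_x × y ↦ t x y`. -/
noncomputable def ofE (t : G → G → DrinfeldDouble k G) :
    DrinfeldDouble k G →ₗ[k] DrinfeldDouble k G :=
  (stdBasis k G).constr k fun p => t p.1 p.2

@[simp] theorem ofE_e (t : G → G → DrinfeldDouble k G) (x y : G) : ofE t (e x y) = t x y := by
  have := (stdBasis k G).constr_basis k (fun p => t p.1 p.2) (x, y)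
  rwa [stdBasis_apply] at this

/-- The Hopf automorphism `e_g × h ↦ e_{v(g)} × w(h)`, for automorphisms `v, w` of `G` that agree
modulo the centre. -/
noncomputable def diagAut (v w : MulAut G)
    (h : ∀ g, v g * (w g)⁻¹ ∈ Subgroup.center G) : HopfAut k G :=
  mkAut (Set.range fun p : G × G => (e p.1 p.2 : DrinfeldDouble k G)) span_e
    (ofE fun x y => e (v x) (w y)) (ofE fun x y => e (v⁻¹ x) (w⁻¹ y))
    (by rintro _ ⟨p, rfl⟩; simp) (by rintro _ ⟨p, rfl⟩; simp)
    (by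
      rintro _ ⟨p, rfl⟩ _ ⟨q, rfl⟩
      simp only [e_mul_e, ofE_e, apply_ite (ofE _), map_zero, map_mul]
      refine if_congr ?_ rfl rfl
      have hz := Subgroup.mem_center_iff.1 (h p.2)
      have : w p.2 * v q.1 * (w p.2)⁻¹ = v (p.2 * q.1 * p.2⁻¹) := by
        rw [map_mul, map_mul, map_inv]
        have h2 := hz (w p.2 * v q.1 * (w p.2)⁻¹)
        have h3 : v p.2 = v p.2 * (w p.2)⁻¹ * w p.2 := by group
        rw [h3]
        generalize hz' : v p.2 * (w p.2)⁻¹ = z at h2 ⊢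
        have : w p.2 * v q.1 * (w p.2)⁻¹ =
            (z * (w p.2 * v q.1 * (w p.2)⁻¹)) * z⁻¹ := by rw [← h2]; group
        rw [this]; group
      rw [this, v.injective.eq_iff])
    (by rintro _ ⟨p, rfl⟩; simp [counit_e])
    (by
      rintro _ ⟨p, rfl⟩
      simp only [comul_e, ofE_e, map_sum, TensorProduct.map_tmul, map_mul, map_inv]
      exact Equiv.sum_comp v.toEquiv fun x =>
        (e x (w p.2) : DrinfeldDouble k G) ⊗ₜ[k] (e (x⁻¹ * v p.1) (w p.2) : DrinfeldDouble k G))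

theorem diagAut_e (v w : MulAut G) (h) (x y : G) :
    (diagAut v w h : HopfAut k G) (e x y) = e (v x) (w y) := by
  rw [diagAut, mkAut_apply, ofE_e]

/-- The group `Aut_c(G)` of automorphisms `v` with `v(g) g⁻¹ ∈ Z(G)` for all `g`. -/
def AutC (G : Type*) [Group G] : Subgroup (MulAut G) where
  carrier := {v | ∀ g, v g * g⁻¹ ∈ Subgroup.center G}
  one_mem' := fun g => by simp
  mul_mem' := by
    intro v w hv hw g
    have : (v * w) g * g⁻¹ = (v (w g) * (w g)⁻¹) * (w g * g⁻¹) := by simp [mul_assoc]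
    rw [this]
    exact Subgroup.mul_mem _ (hv _) (hw _)
  inv_mem' := by
    intro v hv g
    have := Subgroup.inv_mem _ (hv (v⁻¹ g))
    simpa using this

theorem mem_AutC {v : MulAut G} : v ∈ AutC G ↔ ∀ g, v g * g⁻¹ ∈ Subgroup.center G := Iff.rfl

/-- `v ↦ (e_g × h ↦ e_{v(g)} × v(h))`. -/
noncomputable def homV (k G : Type*) [Field k] [Group G] [Fintype G] [DecidableEq G] :
    MulAut G →* HopfAut k G where
  toFun v := diagAut v v fun g => by simp
  map_one' := HopfAut.ext_e fun x y => by rw [diagAut_e]; rfl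
  map_mul' v w := HopfAut.ext_e fun x y => by
    simp only [HopfAut.mul_apply, diagAut_e]; rfl

/-- `v ↦ (e_g × h ↦ e_{v(g)} × h)`, for `v ∈ Aut_c(G)`. -/
noncomputable def homVc (k G : Type*) [Field k] [Group G] [Fintype G] [DecidableEq G] :
    AutC G →* HopfAut k G where
  toFun v := diagAut v 1 fun g => by simpa using mem_AutC.1 v.2 g
  map_one' := HopfAut.ext_e fun x y => by rw [diagAut_e]; rfl
  map_mul' v w := HopfAut.ext_e fun x y => by
    simp only [HopfAut.mul_apply, diagAut_e]; rfl

/-- The Hopf automorphism `e_g × h ↦ b(h)(g) e_g × h`, for `b` in `Hom(G_ab, Ĝ_ab)`. -/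
noncomputable def autB (b : Abelianization G →* (Abelianization G →* kˣ)) : HopfAut k G :=
  mkAut (Set.range fun p : G × G => (e p.1 p.2 : DrinfeldDouble k G)) span_e
    (ofE fun x y => (b (Abelianization.of y) (Abelianization.of x) : k) • e x y)
    (ofE fun x y => (((b (Abelianization.of y) (Abelianization.of x))⁻¹ : kˣ) : k) • e x y)
    (by rintro _ ⟨p, rfl⟩; simp [smul_smul]) (by rintro _ ⟨p, rfl⟩; simp [smul_smul])
    (by
      rintro _ ⟨p, rfl⟩ _ ⟨q, rfl⟩
      simp only [e_mul_e, ofE_e, apply_ite (ofE _), map_zero, map_mul, smul_mul_smul_comm,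
        smul_ite, smul_zero]
      by_cases h : p.1 = p.2 * q.1 * p.2⁻¹
      · have h' : Abelianization.of p.1 = Abelianization.of q.1 := by
          rw [h, map_mul, map_mul, map_inv, mul_comm (Abelianization.of p.2)]; simp
        simp only [if_pos h, h', MonoidHom.mul_apply, Units.val_mul]
      · simp only [if_neg h])
    (by
      rintro _ ⟨p, rfl⟩
      simp only [ofE_e, map_smul, counit_e]
      by_cases h : p.1 = 1 <;> simp [h])
    (by
      rintro _ ⟨p, rfl⟩
      simp only [comul_e, ofE_e, map_sum, TensorProduct.map_tmul, map_smul, Finset.smul_sum]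
      refine Finset.sum_congr rfl fun x _ => ?_
      rw [smul_tmul_smul, ← Units.val_mul, ← map_mul, ← map_mul]
      simp)

theorem autB_e (b : Abelianization G →* (Abelianization G →* kˣ)) (x y : G) :
    autB b (e x y) = (b (Abelianization.of y) (Abelianization.of x) : k) • e x y := by
  rw [autB, mkAut_apply, ofE_e]

/-- `b ↦ (e_g × h ↦ b(h)(g) e_g × h)`. -/
noncomputable def homB (k G : Type*) [Field k] [Group G] [Fintype G] [DecidableEq G] :
    (Abelianization G →* (Abelianization G →* kˣ)) →* HopfAut k G where
  toFun := autB
  map_one' := HopfAut.ext_e fun x y => by rw [autB_e]; simp [HopfAut.one_apply]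
  map_mul' v w := HopfAut.ext_e fun x y => by
    simp only [HopfAut.mul_apply, autB_e, map_smul, smul_smul]
    rw [mul_comm]; rfl

end Aut

section Characters

variable {k G : Type*} [Field k] [Group G] [Fintype G] [DecidableEq G]

/-- A finite group has finitely many characters. -/
noncomputable instance charFintype (A : Subgroup G) : Fintype (A →* kˣ) := Fintype.ofFinite _

open scoped Classical in
/-- For a subgroup `A` and a character `χ` of `A`, the vector
`|A|⁻¹ ∑_{a ∈ A} χ(a) (e_{x a} × y)`. The element `∑_a χ(a) e_a` of `k^A` is the character `χ`
itself, so if `G = H × A` is a direct product and `x ∈ H`, this is `|A|⁻¹ ((e_x, χ) × y)` with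
`(e_x, χ) ∈ k^H ⊗ k^A = k^G`. -/
noncomputable def charVec (A : Subgroup G) (x : G) (χ : A →* kˣ) (y : G) : DrinfeldDouble k G :=
  (Nat.card A : k)⁻¹ • ∑ a : A, (χ a : k) • e (x * a) y

variable {A : Subgroup G}

theorem charVec_mul_mem (x : G) (a : A) (χ : A →* kˣ) (y : G) :
    charVec A (x * a) χ y = ((χ a)⁻¹ : kˣ) • charVec A x χ y := by
  classical
  rw [charVec, charVec, Units.smul_def, smul_comm]
  congr 1
  rw [← Equiv.sum_comp (Equiv.mulLeft a⁻¹), Finset.smul_sum]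
  refine Finset.sum_congr rfl fun b _ => ?_
  simp [smul_smul, mul_assoc]

theorem map_charVec [CharZero k] (s : G → (A →* kˣ) → G → DrinfeldDouble k G)
    (hs : ∀ x (a : A) χ y, s (x * a) χ y = ((χ a)⁻¹ : kˣ) • s x χ y)
    (x : G) (χ : A →* kˣ) (y : G) :
    ofE (fun x y => ∑ ψ : A →* kˣ, s x ψ y) (charVec A x χ y) = s x χ y := by
  classical
  have h0 : (Nat.card A : k) ≠ 0 := Nat.cast_ne_zero.2 Nat.card_pos.ne'
  simp only [charVec, map_smul, map_sum, ofE_e, hs]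
  rw [inv_smul_eq_iff₀ h0]
  simp only [Finset.smul_sum]
  rw [Finset.sum_comm]
  have : ∀ ψ : A →* kˣ, ∑ a : A, (χ a : k) • (((ψ a)⁻¹ : kˣ) • s x ψ y) =
      if ψ = χ then (Nat.card A : k) • s x ψ y else 0 := by
    intro ψ
    have h1 : ∀ a : A, (χ a : k) • (((ψ a)⁻¹ : kˣ) • s x ψ y) =
        ((Units.coeHom k).comp (χ / ψ)) a • s x ψ y := by
      intro a
      rw [Units.smul_def, smul_smul, ← Units.val_mul, ← div_eq_mul_inv]; rfl
    simp only [h1]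
    rw [← Finset.sum_smul, sum_hom_units]
    have h2 : (Units.coeHom k).comp (χ / ψ) = 1 ↔ ψ = χ := by
      constructor
      · intro h
        have : χ / ψ = 1 := MonoidHom.ext fun a => Units.ext (DFunLike.congr_fun h a)
        exact (div_eq_one.1 this).symm
      · rintro rfl
        ext a; simp
    by_cases h : ψ = χ
    · rw [if_pos h, if_pos (h2.2 h), Nat.card_eq_fintype_card]
    · rw [if_neg h, if_neg (fun h' => h (h2.1 h'))]; simp
  simp only [this]
  simp

theorem sum_charVec [IsAlgClosed k] [CharZero k] (hA : A ≤ Subgroup.center G) (x y : G) :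
    ∑ χ : A →* kˣ, charVec A x χ y = (e x y : DrinfeldDouble k G) := by
  classical
  let _ : CommGroup A := { (inferInstance : Group A) with
    mul_comm := fun a b => Subtype.ext (Subgroup.mem_center_iff.1 (hA b.2) a) }
  have h0 : (Nat.card A : k) ≠ 0 := Nat.cast_ne_zero.2 Nat.card_pos.ne'
  have : NeZero (Monoid.exponent A : k) :=
    ⟨Nat.cast_ne_zero.2 Monoid.exponent_ne_zero_of_finite⟩
  have : NeZero ((Monoid.exponent A : ℕ)) := ⟨Monoid.exponent_ne_zero_of_finite⟩
  simp only [charVec]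
  rw [← Finset.smul_sum, inv_smul_eq_iff₀ h0, Finset.sum_comm]
  have : ∀ a : A, ∑ χ : A →* kˣ, (χ a : k) • (e (x * a) y : DrinfeldDouble k G) =
      if a = 1 then (Nat.card A : k) • e (x * a) y else 0 := by
    intro a
    rw [← Finset.sum_smul]
    have h1 := sum_hom_units ((Units.coeHom k).comp (MonoidHom.eval (N := kˣ) a))
    have h2 : (Units.coeHom k).comp (MonoidHom.eval (N := kˣ) a) = 1 ↔ a = 1 := by
      constructor
      · intro h
        exact (CommGroup.forall_apply_eq_apply_iff A (M := k)).1 fun φ =>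
          Units.ext (by simpa using DFunLike.congr_fun h φ)
      · rintro rfl; ext; simp
    have h3 : (∑ χ : A →* kˣ, (χ a : k)) = if a = 1 then (Nat.card A : k) else 0 := by
      refine h1.trans ?_
      rw [← Nat.card_eq_fintype_card, CommGroup.card_monoidHom_of_hasEnoughRootsOfUnity A k]
      simp only [h2]
      split_ifs <;> simp
    rw [h3]; split_ifs <;> simp
  simp only [this]
  simp

theorem span_charVec [IsAlgClosed k] [CharZero k] (hA : A ≤ Subgroup.center G) :
    Submodule.span k {F : DrinfeldDouble k G | ∃ x χ y, F = charVec A x χ y} = ⊤ := by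
  rw [eq_top_iff, ← span_e, Submodule.span_le]
  rintro _ ⟨p, rfl⟩
  dsimp only
  rw [← sum_charVec hA]
  exact Submodule.sum_mem _ fun χ _ => Submodule.subset_span ⟨_, _, _, rfl⟩

open scoped Classical in
theorem charVec_mul (hA : A ≤ Subgroup.center G) (x : G) (χ : A →* kˣ) (y : G)
    (x' : G) (χ' : A →* kˣ) (y' : G) :
    charVec A x χ y * charVec A x' χ' y' =
      ∑ a : A, if x = y * x' * y⁻¹ * a then
        ((Nat.card A : k)⁻¹ * (χ' a : k)) • charVec A x (χ * χ') (y * y') else 0 := by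
  have hc : ∀ (a : A) (g : G), g * a = a * g := fun a => Subgroup.mem_center_iff.1 (hA a.2)
  have h1 : ∀ a : A, (if x = y * x' * y⁻¹ * a then
        ((Nat.card A : k)⁻¹ * (χ' a : k)) • charVec A x (χ * χ') (y * y') else 0) =
      ((Nat.card A : k)⁻¹ * (Nat.card A : k)⁻¹) • ∑ b : A, (if x = y * x' * y⁻¹ * a then
        ((χ b : k) * (χ' (a * b) : k)) • (e (x * b) (y * y') : DrinfeldDouble k G) else 0) := by
    intro a
    split_ifs
    · rw [charVec, smul_smul, Finset.smul_sum, Finset.smul_sum]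
      refine Finset.sum_congr rfl fun b _ => ?_
      rw [smul_smul, smul_smul]
      congr 1
      simp only [MonoidHom.mul_apply, map_mul, Units.val_mul]
      ring
    · simp
  simp only [h1]
  rw [← Finset.smul_sum, charVec, charVec, smul_mul_smul_comm]
  congr 1
  rw [Finset.sum_comm, Finset.sum_mul]
  refine Finset.sum_congr rfl fun b _ => ?_
  rw [Finset.mul_sum, ← Equiv.sum_comp (Equiv.mulRight b)]
  refine Finset.sum_congr rfl fun a _ => ?_
  rw [smul_mul_smul_comm, e_mul_e]
  have : x * b = y * (x' * ((Equiv.mulRight b) a : A)) * y⁻¹ ↔ x = y * x' * y⁻¹ * a := by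
    have : y * (x' * ((Equiv.mulRight b) a : A)) * y⁻¹ = y * x' * y⁻¹ * a * b := by
      simp only [Equiv.coe_mulRight, Subgroup.coe_mul]
      have := hc (a * b) y⁻¹
      simp only [Subgroup.coe_mul] at this
      calc y * (x' * (a * b)) * y⁻¹ = y * x' * ((a * b) * y⁻¹) := by group
        _ = _ := by rw [← this]; group
    rw [this, mul_left_inj]
  simp only [this, smul_ite, smul_zero]
  rfl

theorem comul_charVec (hA : A ≤ Subgroup.center G) [CharZero k]
    (x : G) (χ : A →* kˣ) (y : G) :
    Coalgebra.comul (R := k) (charVec A x χ y) =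
      ∑ w : G, charVec A w χ y ⊗ₜ[k] charVec A (w⁻¹ * x) χ y := by
  classical
  have hc : ∀ (a : A) (g : G), g * a = a * g := fun a => Subgroup.mem_center_iff.1 (hA a.2)
  have h0 : (Nat.card A : k) ≠ 0 := Nat.cast_ne_zero.2 Nat.card_pos.ne'
  have h1 : Coalgebra.comul (R := k) (charVec A x χ y) =
      ∑ w : G, e w y ⊗ₜ[k] charVec A (w⁻¹ * x) χ y := by
    simp only [charVec, map_smul, map_sum, comul_e, Finset.smul_sum, tmul_sum, tmul_smul]
    rw [Finset.sum_comm]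
    simp only [mul_assoc]
  have h2 : ∀ w : G, charVec A w χ y ⊗ₜ[k] charVec A (w⁻¹ * x) χ y =
      (Nat.card A : k)⁻¹ • ∑ a : A, e (w * a) y ⊗ₜ[k] charVec A ((w * a)⁻¹ * x) χ y := by
    intro w
    conv_lhs => arg 2; rw [charVec]
    rw [← smul_tmul', sum_tmul]
    congr 1
    refine Finset.sum_congr rfl fun a _ => ?_
    have : (w * a)⁻¹ * x = (w⁻¹ * x) * (a⁻¹ : A) := by
      rw [hc a⁻¹, mul_inv_rev, mul_assoc]; rfl
    rw [this, charVec_mul_mem, map_inv, inv_inv, Units.smul_def, tmul_smul, smul_tmul']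
  simp only [h2]
  rw [h1, ← Finset.smul_sum, eq_inv_smul_iff₀ h0, Finset.sum_comm]
  have h3 : ∀ a : A, ∑ w : G, (e (w * a) y : DrinfeldDouble k G) ⊗ₜ[k]
      charVec A ((w * a)⁻¹ * x) χ y = ∑ w : G, e w y ⊗ₜ[k] charVec A (w⁻¹ * x) χ y := fun a =>
    Equiv.sum_comp (Equiv.mulRight (a : G)) fun w =>
      (e w y : DrinfeldDouble k G) ⊗ₜ[k] charVec A (w⁻¹ * x) χ y
  simp only [h3]
  rw [Finset.sum_const, Finset.card_univ, ← Nat.card_eq_fintype_card, Nat.cast_smul_eq_nsmul]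

theorem counit_charVec_congr (x : G) (χ : A →* kˣ) (y y' : G) :
    Coalgebra.counit (R := k) (charVec A x χ y) =
      Coalgebra.counit (R := k) (charVec A x χ y') := by
  simp [charVec, counit_e]

end Characters

section E

open scoped IsMulCommutative

variable {k G : Type*} [Field k] [Group G] [Fintype G] [DecidableEq G]

/-- The map `e_g × h ↦ ∑_{g₁ g₂ = g} e_{g₁} × a(e_{g₂}) h`, for a homomorphism `a` from the character
group of `Z = Z(G)` to `Z`. Here `a` is extended linearly to `a : k^Z → kZ` (characters of `Z` are
a basis of `k^Z`) and composed with the restriction `k^G → k^Z`, so that `a(e_z)` is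
`|Z|⁻¹ ∑_χ χ(z)⁻¹ a(χ)` for `z ∈ Z` and `a(e_g) = 0` for `g ∉ Z`; the double sum over `χ` and
`z = g₂` is the one written here, as `charVec Z g χ y = |Z|⁻¹ ∑_z χ(z)⁻¹ (e_{g z⁻¹} × y)`. -/
noncomputable def mapE (a : (Subgroup.center G →* kˣ) →* Subgroup.center G) :
    DrinfeldDouble k G →ₗ[k] DrinfeldDouble k G :=
  ofE fun x y => ∑ χ : Subgroup.center G →* kˣ, charVec (Subgroup.center G) x χ (a χ * y)

theorem mapE_charVec [CharZero k] (a : (Subgroup.center G →* kˣ) →* Subgroup.center G)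
    (x : G) (χ : Subgroup.center G →* kˣ) (y : G) :
    mapE a (charVec _ x χ y) = charVec _ x χ (a χ * y) :=
  map_charVec (fun x χ y => charVec (Subgroup.center G) x χ (a χ * y))
    (fun x b χ _ => charVec_mul_mem x b χ _) x χ y

/-- `mapE a` is a Hopf automorphism. -/
noncomputable def autE [IsAlgClosed k] [CharZero k]
    (a : (Subgroup.center G →* kˣ) →* Subgroup.center G) : HopfAut k G :=
  mkAut _ (span_charVec (le_refl (Subgroup.center G))) (mapE a) (mapE a⁻¹)
    (by rintro _ ⟨x, χ, y, rfl⟩; simp [mapE_charVec])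
    (by rintro _ ⟨x, χ, y, rfl⟩; simp [mapE_charVec])
    (by
      classical
      rintro _ ⟨x, χ, y, rfl⟩ _ ⟨x', χ', y', rfl⟩
      have hc : ∀ (a : Subgroup.center G) (g : G), g * a = a * g :=
        fun a => Subgroup.mem_center_iff.1 a.2
      simp only [charVec_mul le_rfl, mapE_charVec, map_sum, apply_ite (mapE a), map_smul, map_zero]
      refine Finset.sum_congr rfl fun b _ => ?_
      have h1 : a χ * y * x' * (a χ * y)⁻¹ * b = y * x' * y⁻¹ * b := by
        have : (a χ * y * x' * (a χ * y)⁻¹ : G) = a χ * (y * x' * y⁻¹) * (a χ : G)⁻¹ := by group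
        rw [this, ← hc (a χ)]; group
      have h2 : ((a (χ * χ') : Subgroup.center G) : G) * (y * y') = a χ * y * (a χ' * y') := by
        rw [map_mul, Subgroup.coe_mul, mul_assoc, mul_assoc, ← mul_assoc y, hc (a χ') y, mul_assoc]
      rw [h1, h2])
    (by
      rintro _ ⟨x, χ, y, rfl⟩
      rw [mapE_charVec]
      exact counit_charVec_congr _ _ _ _)
    (by
      rintro _ ⟨x, χ, y, rfl⟩
      simp only [mapE_charVec, comul_charVec le_rfl, map_sum, TensorProduct.map_tmul])

theorem autE_apply [IsAlgClosed k] [CharZero k]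
    (a : (Subgroup.center G →* kˣ) →* Subgroup.center G) (F : DrinfeldDouble k G) :
    autE a F = mapE a F := rfl

/-- `a ↦ (e_g × h ↦ ∑_{g₁ g₂ = g} e_{g₁} × a(e_{g₂}) h)`. -/
noncomputable def homE (k G : Type*) [Field k] [IsAlgClosed k] [CharZero k] [Group G] [Fintype G]
    [DecidableEq G] : ((Subgroup.center G →* kˣ) →* Subgroup.center G) →* HopfAut k G where
  toFun := autE
  map_one' := HopfAut.ext_e fun x y => by
    simp only [autE_apply, mapE, ofE_e, HopfAut.one_apply]
    simpa using sum_charVec le_rfl x y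
  map_mul' a b := HopfAut.ext_e fun x y => by
    rw [← sum_charVec (le_refl (Subgroup.center G)), map_sum, map_sum]
    refine Finset.sum_congr rfl fun χ _ => ?_
    simp only [HopfAut.mul_apply, autE_apply, mapE_charVec]
    simp [mul_assoc]

end E

/-- The tuples `(H, C, δ, ν)` indexing twisted reflections: subgroups `H` and `C` of `G` with `C`
abelian and `G = H × C` (internal direct product), an isomorphism `δ` from `C` to its character
group (equivalently, a Hopf isomorphism `kC → k^C`), and a nilpotent endomorphism `ν` of `C`. -/
structure TwistedReflection (k G : Type*) [Field k] [Group G] where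
  /-- the complement of the reflected factor -/
  H : Subgroup G
  /-- the abelian direct factor that is exchanged with its dual -/
  C : Subgroup G
  /-- `C` is abelian -/
  comm : ∀ a ∈ C, ∀ b ∈ C, a * b = b * a
  /-- `H` and `C` commute elementwise -/
  commute : ∀ h ∈ H, ∀ c ∈ C, h * c = c * h
  /-- every element of `G` is uniquely `h * c` with `h ∈ H` and `c ∈ C` -/
  complement : Subgroup.IsComplement' H C
  /-- the identification of `C` with its character group -/
  δ : C ≃* (C →* kˣ)
  /-- the twist -/
  ν : C →* C
  /-- the twist is nilpotent -/
  nilpotent : ∃ n : ℕ, ∀ c : C, ν^[n] c = 1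

namespace TwistedReflection

variable {k G : Type*} [Field k] [Group G]

/-- `H × C ≃ G`. -/
noncomputable def prodEquiv (d : TwistedReflection k G) : d.H × d.C ≃* G :=
  MulEquiv.ofBijective
    (MonoidHom.mk' (fun x : d.H × d.C => (x.1 : G) * (x.2 : G)) (by
      rintro ⟨h, c⟩ ⟨h', c'⟩
      simp only [Prod.mk_mul_mk, Subgroup.coe_mul]
      rw [mul_assoc, ← mul_assoc (h' : G), d.commute h' h'.2 c c.2]
      group))
    d.complement

/-- The projection `p_H`. -/
noncomputable def projH (d : TwistedReflection k G) : G →* d.H :=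
  (MonoidHom.fst _ _).comp d.prodEquiv.symm.toMonoidHom

/-- The projection `p_C`. -/
noncomputable def projC (d : TwistedReflection k G) : G →* d.C :=
  (MonoidHom.snd _ _).comp d.prodEquiv.symm.toMonoidHom

theorem projH_mul_projC (d : TwistedReflection k G) (g : G) :
    (d.projH g : G) * (d.projC g : G) = g := d.prodEquiv.apply_symm_apply g

theorem proj_mul (d : TwistedReflection k G) (h : d.H) (c : d.C) :
    d.projH (h * c) = h ∧ d.projC (h * c) = c := by
  have : d.prodEquiv.symm (h * c) = (h, c) := d.prodEquiv.symm_apply_apply (h, c)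
  constructor
  · exact congrArg Prod.fst this
  · exact congrArg Prod.snd this

@[simp] theorem projH_coe_H (d : TwistedReflection k G) (h : d.H) : d.projH h = h := by
  simpa using (d.proj_mul h 1).1
@[simp] theorem projC_coe_H (d : TwistedReflection k G) (h : d.H) : d.projC h = 1 := by
  simpa using (d.proj_mul h 1).2
@[simp] theorem projH_coe_C (d : TwistedReflection k G) (c : d.C) : d.projH c = 1 := by
  simpa using (d.proj_mul 1 c).1
@[simp] theorem projC_coe_C (d : TwistedReflection k G) (c : d.C) : d.projC c = c := by
  simpa using (d.proj_mul 1 c).2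

theorem C_le_center (d : TwistedReflection k G) : d.C ≤ Subgroup.center G := by
  intro c hc
  rw [Subgroup.mem_center_iff]
  intro g
  rw [← d.projH_mul_projC g, mul_assoc, d.comm _ (d.projC g).2 c hc, ← mul_assoc,
    d.commute _ (d.projH g).2 c hc, mul_assoc]

variable [Fintype G] [DecidableEq G]

/-- The linear map `(f_H, f_C) × (h, c) ↦ (f_H, δ(c)) × (h, δ⁻¹(f_C) ν(c))`. For a character
`f_C = χ` of `C` the element `δ⁻¹(χ)` lies in `C`, see `toLinearMap_charVec`; the definition extends
this linearly through `e_d = |C|⁻¹ ∑_χ χ(d)⁻¹ χ` for `d ∈ C`. -/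
noncomputable def toLinearMap (d : TwistedReflection k G) :
    DrinfeldDouble k G →ₗ[k] DrinfeldDouble k G :=
  ofE fun x y => ∑ χ : d.C →* kˣ, ((χ (d.projC x))⁻¹ : kˣ) •
    charVec d.C (d.projH x : G) (d.δ (d.projC y))
      ((d.projH y : G) * (d.δ.symm χ * d.ν (d.projC y) : d.C))

/-- The inverse of `toLinearMap`. -/
noncomputable def invLinearMap (d : TwistedReflection k G) :
    DrinfeldDouble k G →ₗ[k] DrinfeldDouble k G :=
  ofE fun x y => ∑ χ : d.C →* kˣ, ((χ (d.projC x))⁻¹ : kˣ) •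
    charVec d.C (d.projH x : G) (d.δ (d.projC y * (d.ν (d.δ.symm χ))⁻¹))
      ((d.projH y : G) * d.δ.symm χ)

theorem toLinearMap_charVec [CharZero k] (d : TwistedReflection k G) (x : d.H) (χ : d.C →* kˣ)
    (h : d.H) (c : d.C) :
    d.toLinearMap (charVec d.C x χ (h * c)) =
      charVec d.C x (d.δ c) (h * (d.δ.symm χ * d.ν c : d.C)) := by
  rw [toLinearMap, map_charVec (fun x χ y => ((χ (d.projC x))⁻¹ : kˣ) •
    charVec d.C (d.projH x : G) (d.δ (d.projC y))
      ((d.projH y : G) * (d.δ.symm χ * d.ν (d.projC y) : d.C)))]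
  · simp
  · intro x a χ y
    simp only [map_mul, projC_coe_C, projH_coe_C, mul_one, mul_inv_rev, smul_smul]

theorem invLinearMap_charVec [CharZero k] (d : TwistedReflection k G) (x : d.H) (χ : d.C →* kˣ)
    (h : d.H) (c : d.C) :
    d.invLinearMap (charVec d.C x χ (h * c)) =
      charVec d.C x (d.δ (c * (d.ν (d.δ.symm χ))⁻¹)) (h * d.δ.symm χ) := by
  rw [invLinearMap, map_charVec (fun x χ y => ((χ (d.projC x))⁻¹ : kˣ) •
    charVec d.C (d.projH x : G) (d.δ (d.projC y * (d.ν (d.δ.symm χ))⁻¹))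
      ((d.projH y : G) * d.δ.symm χ))]
  · simp
  · intro x a χ y
    simp only [map_mul, projC_coe_C, projH_coe_C, mul_one, mul_inv_rev, smul_smul]

variable [IsAlgClosed k] [CharZero k]

theorem span_charVec_H (d : TwistedReflection k G) :
    Submodule.span k {F : DrinfeldDouble k G | ∃ (x : d.H) (χ : d.C →* kˣ) (h : d.H) (c : d.C),
      F = charVec d.C x χ (h * c)} = ⊤ := by
  rw [eq_top_iff, ← span_charVec d.C_le_center, Submodule.span_le]
  rintro _ ⟨x, χ, y, rfl⟩
  rw [← d.projH_mul_projC x, charVec_mul_mem, Units.smul_def]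
  refine Submodule.smul_mem _ _ (Submodule.subset_span ⟨d.projH x, χ, d.projH y, d.projC y, ?_⟩)
  rw [d.projH_mul_projC y]

open scoped Classical in
theorem charVec_mul_H (d : TwistedReflection k G) (x h x' h' : d.H) (c c' : d.C)
    (χ χ' : d.C →* kˣ) :
    charVec d.C (x : G) χ (h * c) * charVec d.C (x' : G) χ' (h' * c') =
      if x = h * x' * h⁻¹ then (Nat.card d.C : k)⁻¹ •
        charVec d.C (x : G) (χ * χ') ((h * h' : d.H) * (c * c' : d.C)) else 0 := by
  rw [charVec_mul d.C_le_center]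
  have h1 : ∀ a : d.C, (x : G) = h * c * x' * (h * c : G)⁻¹ * a ↔ a = 1 ∧ x = h * x' * h⁻¹ := by
    intro a
    have : (h * c * x' * (h * c : G)⁻¹ * a : G) = (h * x' * h⁻¹ : d.H) * (a : d.C) := by
      have := d.commute x' x'.2 c c.2
      simp only [Subgroup.coe_mul, Subgroup.coe_inv]
      rw [mul_assoc (h : G) c x', ← this]; group
    rw [this]
    constructor
    · intro h2
      have h3 := congrArg d.projC h2
      have h4 := congrArg d.projH h2
      rw [(d.proj_mul _ _).2, projC_coe_H] at h3
      rw [(d.proj_mul _ _).1, projH_coe_H] at h4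
      exact ⟨h3.symm, h4⟩
    · rintro ⟨rfl, h2⟩
      rw [← h2]; simp
  have h2 : ((h * h' : d.H) * (c * c' : d.C) : G) = h * c * (h' * c') := by
    have := d.commute h' h'.2 c c.2
    simp only [Subgroup.coe_mul]
    rw [mul_assoc, ← mul_assoc (h' : G), this]; group
  simp only [h1, h2]
  rw [Finset.sum_eq_single 1]
  · simp
  · intro b _ hb; simp [hb]
  · simp

theorem comul_charVec_H (d : TwistedReflection k G) (x : d.H) (χ : d.C →* kˣ) (y : G) :
    Coalgebra.comul (R := k) (charVec d.C (x : G) χ y) = (Nat.card d.C : k) •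
      ∑ w : G, if d.projC w = 1 then
        charVec d.C (d.projH w : G) χ y ⊗ₜ[k]
          charVec d.C ((d.projH w)⁻¹ * x : d.H) χ y else 0 := by
  classical
  rw [comul_charVec d.C_le_center, ← Equiv.sum_comp d.prodEquiv.toEquiv,
    ← Equiv.sum_comp d.prodEquiv.toEquiv, Fintype.sum_prod_type, Fintype.sum_prod_type,
    Finset.smul_sum]
  refine Finset.sum_congr rfl fun h _ => ?_
  have hp : ∀ c : d.C, d.prodEquiv.toEquiv (h, c) = (h : G) * c := fun _ => rfl
  simp only [hp, (d.proj_mul _ _).1, (d.proj_mul _ _).2]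
  rw [Finset.sum_ite_eq' Finset.univ (1 : d.C), if_pos (Finset.mem_univ _)]
  have h1 : ∀ c : d.C, charVec d.C (h * c : G) χ y ⊗ₜ[k] charVec d.C ((h * c : G)⁻¹ * x) χ y =
      charVec d.C (h : G) χ y ⊗ₜ[k] charVec d.C (h⁻¹ * x : d.H) χ y := by
    intro c
    have : ((h * c : G)⁻¹ * x : G) = (h⁻¹ * x : d.H) * (c⁻¹ : d.C) := by
      rw [d.commute _ (h⁻¹ * x : d.H).2 _ (c⁻¹).2]
      simp [mul_assoc]
    rw [this, charVec_mul_mem, charVec_mul_mem, Units.smul_def, Units.smul_def, smul_tmul_smul,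
      ← Units.val_mul]
    simp
  simp only [h1]
  rw [Finset.sum_const, Finset.card_univ, ← Nat.card_eq_fintype_card, Nat.cast_smul_eq_nsmul]

theorem counit_charVec_H (d : TwistedReflection k G) (x : d.H) (χ : d.C →* kˣ) (y : G) :
    Coalgebra.counit (R := k) (charVec d.C (x : G) χ y) =
      if x = 1 then (Nat.card d.C : k)⁻¹ else 0 := by
  classical
  have h1 : ∀ a : d.C, (x : G) * a = 1 ↔ a = 1 ∧ x = 1 := by
    intro a
    constructor
    · intro h
      have h3 := congrArg d.projC h
      have h4 := congrArg d.projH h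
      rw [(d.proj_mul _ _).2, map_one] at h3
      rw [(d.proj_mul _ _).1, map_one] at h4
      exact ⟨h3, h4⟩
    · rintro ⟨rfl, rfl⟩; simp
  simp only [charVec, map_smul, map_sum, counit_e, h1]
  rw [Finset.sum_eq_single 1]
  · simp
  · intro b _ hb; simp [hb]
  · simp

/-- The twisted reflection of `C` as a Hopf automorphism of `DG`. -/
noncomputable def toAut (d : TwistedReflection k G) : HopfAut k G :=
  mkAut _ d.span_charVec_H d.toLinearMap d.invLinearMap
    (by
      rintro _ ⟨x, χ, h, c, rfl⟩
      rw [invLinearMap_charVec, toLinearMap_charVec]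
      simp)
    (by
      rintro _ ⟨x, χ, h, c, rfl⟩
      rw [toLinearMap_charVec, invLinearMap_charVec]
      simp)
    (by
      rintro _ ⟨x, χ, h, c, rfl⟩ _ ⟨x', χ', h', c', rfl⟩
      have hcomm : ∀ a b : d.C, a * b = b * a := fun a b => Subtype.ext (d.comm a a.2 b b.2)
      rw [charVec_mul_H, toLinearMap_charVec, toLinearMap_charVec, charVec_mul_H,
        apply_ite d.toLinearMap, map_zero, map_smul, toLinearMap_charVec]
      congr 4
      · rw [map_mul]
      · rw [map_mul, map_mul, mul_assoc, mul_assoc, ← mul_assoc (d.δ.symm χ'),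
          hcomm (d.δ.symm χ'), mul_assoc])
    (by
      rintro _ ⟨x, χ, h, c, rfl⟩
      rw [toLinearMap_charVec, counit_charVec_H, counit_charVec_H])
    (by
      rintro _ ⟨x, χ, h, c, rfl⟩
      simp only [toLinearMap_charVec, comul_charVec_H, map_sum, map_smul,
        apply_ite (TensorProduct.map d.toLinearMap d.toLinearMap), map_zero,
        TensorProduct.map_tmul])

theorem toAut_apply (d : TwistedReflection k G) (F : DrinfeldDouble k G) :
    d.toAut F = d.toLinearMap F := rfl

end TwistedReflection

section Subgroups

variable (k G : Type*) [Field k] [IsAlgClosed k] [CharZero k] [Group G] [Fintype G] [DecidableEq G]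

/-- The subgroup `V ≅ Aut(G)`. -/
noncomputable def V : Subgroup (HopfAut k G) := (homV k G).range

/-- The subgroup `V_c ≅ Aut_c(G)`. -/
noncomputable def Vc : Subgroup (HopfAut k G) := (homVc k G).range

/-- The subgroup `B` of strictly upper triangular matrices. -/
noncomputable def B : Subgroup (HopfAut k G) := (homB k G).range

open scoped IsMulCommutative in
/-- The subgroup `E` of strictly lower triangular matrices. -/
noncomputable def E : Subgroup (HopfAut k G) := (homE k G).range

/-- The subgroup `V_c ⋊ V`. -/
noncomputable def VcV : Subgroup (HopfAut k G) := Vc k G ⊔ V k G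

/-- The subgroup `(V_c ⋊ V) ⋉ B`. -/
noncomputable def VcVB : Subgroup (HopfAut k G) := VcV k G ⊔ B k G

/-- The subgroup `(V_c ⋊ V) ⋉ E`. -/
noncomputable def VcVE : Subgroup (HopfAut k G) := VcV k G ⊔ E k G

/-- The set `R` of (untwisted) reflections, those with trivial `ν`. -/
def reflections : Set (HopfAut k G) :=
  {r | ∃ d : TwistedReflection k G, d.ν = 1 ∧ r = d.toAut}

variable {k G}

/-- The double coset `[(V_c ⋊ V) ⋉ B] · r · [(V_c ⋊ V) ⋉ E]`. -/
def TwistedReflection.cell (d : TwistedReflection k G) : Set (HopfAut k G) :=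
  DoubleCoset.doubleCoset d.toAut (VcVB k G : Set (HopfAut k G)) (VcVE k G : Set (HopfAut k G))

end Subgroups

/-- The permutation matrix of size `2n` that exchanges the basis vectors `i` and `i + n` for
`i < m` and fixes the other basis vectors. -/
def swapMatrix (R : Type*) [Zero R] [One R] (n m : ℕ) : Matrix (Fin n ⊕ Fin n) (Fin n ⊕ Fin n) R :=
  Matrix.fromBlocks
    (Matrix.diagonal fun i => if (i : ℕ) < m then 0 else 1)
    (Matrix.diagonal fun i => if (i : ℕ) < m then 1 else 0)
    (Matrix.diagonal fun i => if (i : ℕ) < m then 1 else 0)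
    (Matrix.diagonal fun i => if (i : ℕ) < m then 0 else 1)

end DrinfeldDouble

/-!
A Hopf automorphism `φ` of `DG` permutes the group-like elements `χ × y`, which form the group
`Ĝ × G`. Together with the restriction of `φ` to `k^G` this gives a matrix with entries
`u : G → G`, `b : G → Ĝ`, `a : Ẑ(G) → Z(G)` and `v : G → G`: one has `φ(1 × y) = b(y) × v(y)`, `u`
and `a` are the components of `φ` on `k^G ⊗ 1`, and the formula `apply_charVec` recovers `φ`. That
`a` is defined on the dual of the centre and has central values is the structural input
(`mem_center_of_apply_e_one_ne_zero`, `mem_center_of_apply_ne_zero`). The group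
`(V_c ⋊ V) ⋉ B` is given by `a = 1` and `(V_c ⋊ V) ⋉ E` by `b = 1` (`mem_VcVB_iff`,
`mem_VcVE_iff`). If `v` is invertible then `a` and `b` can be cleared by elements of `E` and `B`, as
in Gauss elimination (`exists_mem_VcVB_mul_mem_E`, `exists_mem_B_mul_mem_VcVE`).

In general `v` is inverted modulo the centre by the entry `v` of `φ⁻¹`. A Fitting-type
argument then gives, after an automorphism of the target, a decomposition `G = H × C` for which `v`
is the identity on `H` and an endomorphism `ν` of the central factor `C` that lies in the Jacobson
radical of `End C` (`exists_radical_decomposition`). It needs that finite direct factors cancel, for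
which Lovász' argument of counting homomorphisms is used (`nonempty_mulEquiv_of_prod`). Since `ν` is
radical, the relations `φ φ⁻¹ = 1 = φ⁻¹ φ` make the entries `a` and `b` split on `C`
(`exists_split_aPart`, `exists_split_bPart`). The splittings need not be compatible with the given
decomposition, but `End C` has stable range one (`exists_bijective_of_left`,
`exists_bijective_of_right`), so that one of the factors `H`, `C` can be exchanged for another
subgroup. With the new decomposition a reflection on either side makes `v` invertible
(`exists_reflection_mul`, `exists_mul_reflection`), and Gauss elimination gives the two
factorizations that contain a reflection; they show that the stated subgroups and the reflections
generate.

For the double cosets, the entries `a` and `v` determine the coset of `(V_c ⋊ V) ⋉ B` that contains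
`φ`. Multiplying by `V`, `E` and `V_c` brings `a` to the normal form `δ⁻¹ ∘ res_C`, so that `φ` lies
in the double coset of the twisted reflection with twist `ν` (`exists_mem_cell`). For a reflection
the entry `v` is the projection to `H`, with kernel `C`, and multiplication on the two sides
composes it with automorphisms of `G`; hence the double coset determines `C` up to isomorphism.
Conversely `C ≅ C'` forces `H ≅ H'` by cancellation, and automorphisms of `G` match the two
reflections (`cell_eq_iff`).

If `G = F_p^n`, the group-like elements form a basis of `DG`, so that `Aut_Hopf(DG)` is the
automorphism group `GL_{2n}(F_p)` of `Ĝ × G` (`Coordinates.toGL`). A radical endomorphism of an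
elementary abelian group is trivial and subgroups of `G` are classified up to isomorphism by their
orders, so that the double cosets are those of the `n + 1` reflections on coordinate subspaces
(`Coordinates.exists_bruhat`).
-/

namespace DrinfeldDouble

/-! ### Coordinates and group-like elements of the double -/

section Coordinates

variable {k G : Type*} [Field k] [Group G] [Fintype G] [DecidableEq G]

/-- The coordinate functional `F ↦ F p`. -/
def coord (p : G × G) : DrinfeldDouble k G →ₗ[k] k where
  toFun F := F p
  map_add' _ _ := rfl
  map_smul' _ _ := rfl

theorem coord_apply (p : G × G) (F : DrinfeldDouble k G) : coord p F = F p := rfl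

theorem sum_apply {ι : Type*} (s : Finset ι) (f : ι → DrinfeldDouble k G) (p : G × G) :
    (∑ i ∈ s, f i) p = ∑ i ∈ s, f i p := map_sum (coord p) f s

theorem eq_sum_e (F : DrinfeldDouble k G) : F = ∑ p : G × G, F p • e p.1 p.2 := by
  ext x y
  rw [sum_apply]
  simp only [smul_apply, e_apply]
  rw [Finset.sum_eq_single (x, y)]
  · simp
  · rintro ⟨a, b⟩ - h
    rw [if_neg, mul_zero]
    rintro ⟨rfl, rfl⟩
    exact h rfl
  · simp

theorem counit_eq (F : DrinfeldDouble k G) :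
    Coalgebra.counit (R := k) F = ∑ t : G, F (1, t) := by
  conv_lhs => rw [eq_sum_e F]
  simp only [map_sum, map_smul, counit_e, Fintype.sum_prod_type]
  rw [Finset.sum_eq_single 1]
  · simp
  · intro b _ hb; simp [hb]
  · simp

/-- The coordinate functional on `DG ⊗ DG` at `(p, q)`. -/
noncomputable def coord₂ (p q : G × G) :
    DrinfeldDouble k G ⊗[k] DrinfeldDouble k G →ₗ[k] k :=
  LinearMap.mul' k k ∘ₗ TensorProduct.map (coord p) (coord q)

theorem coord₂_tmul (p q : G × G) (F F' : DrinfeldDouble k G) :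
    coord₂ p q (F ⊗ₜ[k] F') = F p * F' q := by
  simp [coord₂, coord_apply]

theorem coord₂_comul (s t s' t' : G) (F : DrinfeldDouble k G) :
    coord₂ (s, t) (s', t') (Coalgebra.comul (R := k) F) = if t = t' then F (s * s', t) else 0 := by
  have : ∀ x y : G, coord₂ (s, t) (s', t') (Coalgebra.comul (R := k) (e x y : DrinfeldDouble k G)) =
      if t = t' then (e x y : DrinfeldDouble k G) (s * s', t) else 0 := by
    intro x y
    rw [comul_e, map_sum]
    simp only [coord₂_tmul, e_apply]
    rw [Finset.sum_eq_single s]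
    · have h : s' = s⁻¹ * x ↔ s * s' = x := by rw [eq_inv_mul_iff_mul_eq]
      simp only [h]
      split_ifs <;> simp_all
    · intro b _ hb
      rw [if_neg (fun h => hb h.1.symm), zero_mul]
    · simp
  conv_lhs => rw [eq_sum_e F]
  simp only [map_sum, map_smul, this]
  conv_rhs => rw [eq_sum_e F]
  split_ifs
  · rw [sum_apply]; rfl
  · simp

/-- Compatibility of `φ` with the comultiplication, in coordinates. -/
theorem HopfAut.coord₂_comul_apply (φ : HopfAut k G) (s t s' t' x y : G) :
    ∑ z : G, φ (e z y) (s, t) * φ (e (z⁻¹ * x) y) (s', t') =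
      if t = t' then φ (e x y) (s * s', t) else 0 := by
  have h := CoalgHomClass.map_comp_comul_apply φ (e x y : DrinfeldDouble k G)
  rw [comul_e, map_sum] at h
  have h' := congrArg (coord₂ (s, t) (s', t')) h
  rw [coord₂_comul, map_sum] at h'
  rw [← h']
  refine Finset.sum_congr rfl fun z _ => ?_
  exact (coord₂_tmul _ _ _ _).symm

/-- Compatibility of `φ` with the counit, in coordinates. -/
theorem HopfAut.sum_apply_one (φ : HopfAut k G) (x y : G) :
    ∑ t : G, φ (e x y) (1, t) = if x = 1 then 1 else 0 := by
  rw [← counit_eq, ← counit_e x y]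
  exact CoalgHomClass.counit_comp_apply φ _

/-- The element `∑ χ(x) (e_x × y) = χ × y` for a character `χ` of `G`; these are the group-like
elements of `DG`, see `isGroupLikeElem_iff`. -/
def grp (χ : G →* kˣ) (y : G) : DrinfeldDouble k G := fun p => if p.2 = y then (χ p.1 : k) else 0

theorem grp_apply (χ : G →* kˣ) (y s t : G) :
    (grp χ y : DrinfeldDouble k G) (s, t) = if t = y then (χ s : k) else 0 := rfl

theorem grp_eq_sum (χ : G →* kˣ) (y : G) :
    (grp χ y : DrinfeldDouble k G) = ∑ x : G, (χ x : k) • e x y := by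
  ext s t
  simp only [sum_apply, smul_apply, e_apply, grp_apply]
  rw [Finset.sum_eq_single s]
  · simp
  · intro b _ hb; simp [hb.symm]
  · simp

theorem grp_one_one : (grp 1 1 : DrinfeldDouble k G) = 1 := by
  ext s t; simp [grp_apply, one_apply]

theorem grp_mul_grp (χ χ' : G →* kˣ) (y y' : G) :
    (grp χ y * grp χ' y' : DrinfeldDouble k G) = grp (χ * χ') (y * y') := by
  ext s t
  rw [mul_apply]
  simp only [grp_apply]
  rw [Finset.sum_eq_single y]
  · simp only [if_true, inv_mul_eq_iff_eq_mul, map_mul, map_inv, MonoidHom.mul_apply]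
    split_ifs
    · push_cast
      field_simp
    · simp
  · intro b _ hb; simp [hb]
  · simp

theorem e_mul_grp (x y : G) (χ : G →* kˣ) (y' : G) :
    (e x y * grp χ y' : DrinfeldDouble k G) = (χ x : k) • e x (y * y') := by
  rw [grp_eq_sum, Finset.mul_sum, Finset.sum_eq_single (y⁻¹ * x * y)]
  · rw [mul_smul_comm, e_mul_e, if_pos (by group)]
    congr 2
    rw [map_mul, map_mul, map_inv, mul_comm, mul_inv_cancel_left]
  · intro b _ hb
    rw [mul_smul_comm, e_mul_e, if_neg, smul_zero]
    rintro rfl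
    exact hb (by group)
  · simp

theorem grp_one_mul_e (y x y' : G) :
    (grp 1 y * e x y' : DrinfeldDouble k G) = e (y * x * y⁻¹) (y * y') := by
  rw [grp_eq_sum, Finset.sum_mul, Finset.sum_eq_single (y * x * y⁻¹)]
  · simp [e_mul_e]
  · intro b _ hb
    rw [smul_mul_assoc, e_mul_e, if_neg hb, smul_zero]
  · simp

theorem isGroupLikeElem_grp (χ : G →* kˣ) (y : G) :
    IsGroupLikeElem k (grp χ y : DrinfeldDouble k G) where
  counit_eq_one := by
    rw [counit_eq]; simp [grp_apply]
  comul_eq_tmul_self := by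
    simp only [grp_eq_sum, map_sum, map_smul, comul_e, Finset.smul_sum, sum_tmul, tmul_sum]
    rw [Finset.sum_comm]
    conv_rhs => rw [Finset.sum_comm]
    refine Finset.sum_congr rfl fun z _ => ?_
    rw [← Equiv.sum_comp (Equiv.mulLeft z)]
    refine Finset.sum_congr rfl fun w _ => ?_
    simp only [Equiv.coe_mulLeft, map_mul, Units.val_mul, inv_mul_cancel_left, smul_tmul_smul]

theorem grp_injective {χ χ' : G →* kˣ} {y y' : G}
    (h : (grp χ y : DrinfeldDouble k G) = grp χ' y') : χ = χ' ∧ y = y' := by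
  have hy : y = y' := by
    have := congrFun h (1, y)
    by_contra hne
    simp [grp, hne] at this
  refine ⟨MonoidHom.ext fun s => Units.ext ?_, hy⟩
  have := congrFun h (s, y)
  simpa [grp, hy] using this

/-- A complete family of orthogonal idempotents of a field has exactly one nonzero member. -/
theorem exists_eq_indicator {T : Type*} [Fintype T] [DecidableEq T] (f : T → k)
    (h : ∀ t t', f t * f t' = if t = t' then f t else 0) (hs : ∑ t, f t = 1) :
    ∃ t₀, ∀ t, f t = if t = t₀ then 1 else 0 := by
  obtain ⟨t₀, -, h0⟩ : ∃ t ∈ Finset.univ, f t ≠ 0 := by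
    refine Finset.exists_ne_zero_of_sum_ne_zero (f := f) ?_
    rw [hs]; exact one_ne_zero
  refine ⟨t₀, fun t => ?_⟩
  split_ifs with ht
  · subst ht
    have := h t t
    rw [if_pos rfl] at this
    exact mul_left_cancel₀ h0 (by rw [this, mul_one])
  · have := h t t₀
    rw [if_neg ht] at this
    exact (mul_eq_zero.1 this).resolve_right h0

theorem isGroupLikeElem_iff (F : DrinfeldDouble k G) :
    IsGroupLikeElem k F ↔ ∃ (χ : G →* kˣ) (y : G), F = grp χ y := by
  refine ⟨fun hF => ?_, ?_⟩
  swap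
  · rintro ⟨χ, y, rfl⟩; exact isGroupLikeElem_grp χ y
  have hm : ∀ s t s' t', F (s, t) * F (s', t') = if t = t' then F (s * s', t) else 0 := by
    intro s t s' t'
    rw [← coord₂_comul, hF.comul_eq_tmul_self, coord₂_tmul]
  have hc := hF.counit_eq_one
  rw [counit_eq] at hc
  obtain ⟨y, hy⟩ := exists_eq_indicator (fun t => F (1, t))
    (fun t t' => by simpa using hm 1 t 1 t') hc
  have hy1 : F (1, y) = 1 := by simpa using hy y
  let χ : G →* k :=
    { toFun := fun s => F (s, y)
      map_one' := hy1
      map_mul' := fun s s' => by simpa using (hm s y s' y).symm }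
  refine ⟨χ.toHomUnits, y, ?_⟩
  ext s t
  rw [grp_apply]
  split_ifs with ht
  · subst ht; rfl
  · have := hm s t 1 y
    rwa [if_neg ht, hy1, mul_one] at this

theorem charVec_apply_mul (A : Subgroup G) (x : G) (χ : A →* kˣ) (y : G) (a : A) :
    charVec A x χ y (x * a, y) = (Nat.card A : k)⁻¹ * χ a := by
  classical
  rw [charVec, smul_apply, sum_apply, Finset.sum_eq_single a]
  · simp [smul_apply, e_apply]
  · intro b _ hb
    rw [smul_apply, e_apply, if_neg, mul_zero]
    rintro ⟨h, -⟩
    exact hb (Subtype.ext (mul_left_cancel h).symm)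
  · simp

theorem charVec_apply_of_notMem {A : Subgroup G} {x s : G} (h : x⁻¹ * s ∉ A) (χ : A →* kˣ)
    (y t : G) : charVec A x χ y (s, t) = 0 := by
  classical
  rw [charVec, smul_apply, sum_apply, Finset.sum_eq_zero, mul_zero]
  intro a _
  rw [smul_apply, e_apply, if_neg, mul_zero]
  rintro ⟨rfl, -⟩
  exact h (by simp)

theorem charVec_apply_of_ne {A : Subgroup G} {y t : G} (h : t ≠ y) (x s : G) (χ : A →* kˣ) :
    charVec A x χ y (s, t) = 0 := by
  classical
  rw [charVec, smul_apply, sum_apply, Finset.sum_eq_zero, mul_zero]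
  intro a _
  rw [smul_apply, e_apply, if_neg, mul_zero]
  rintro ⟨-, rfl⟩
  exact h rfl

theorem charVec_apply_congr (A : Subgroup G) (x : G) (χ : A →* kˣ) (y y' s : G) :
    charVec A x χ y (s, y) = charVec A x χ y' (s, y') := by
  by_cases h : x⁻¹ * s ∈ A
  · have : s = x * (⟨_, h⟩ : A) := by simp
    rw [this, charVec_apply_mul, charVec_apply_mul]
  · rw [charVec_apply_of_notMem h, charVec_apply_of_notMem h]

theorem charVec_mul_grp (A : Subgroup G) (x : G) (χ : A →* kˣ) (y y' : G) :
    charVec A x χ y * grp 1 y' = charVec A x χ (y * y') := by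
  classical
  simp only [charVec, smul_mul_assoc, Finset.sum_mul, e_mul_grp]
  simp

/-- `χ × y` in terms of the vectors attached to the restriction of `χ` to `A`. -/
theorem grp_eq_sum_charVec [CharZero k] (A : Subgroup G) (χ : G →* kˣ) (y : G) :
    (grp χ y : DrinfeldDouble k G) =
      ∑ x : G, (χ x : k) • charVec A x (χ.comp A.subtype) y := by
  classical
  have h0 : (Nat.card A : k) ≠ 0 := Nat.cast_ne_zero.2 Nat.card_pos.ne'
  have : ∀ a : A, ∑ x : G, (χ x : k) • (χ a : k) • (e (x * a) y : DrinfeldDouble k G) =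
      grp χ y := by
    intro a
    rw [grp_eq_sum, ← Equiv.sum_comp (Equiv.mulRight (a : G)) fun x => (χ x : k) • e x y]
    refine Finset.sum_congr rfl fun x _ => ?_
    simp [smul_smul]
  simp only [charVec, Finset.smul_sum]
  rw [Finset.sum_comm]
  simp only [smul_comm _ (Nat.card A : k)⁻¹]
  simp only [← Finset.smul_sum, MonoidHom.comp_apply, Subgroup.coe_subtype, this]
  rw [Finset.sum_const, Finset.card_univ, ← Nat.card_eq_fintype_card, ← Nat.cast_smul_eq_nsmul k,
    inv_smul_smul₀ h0]

end Coordinates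

/-! ### The matrix of a Hopf automorphism -/

section Matrix

variable {k G : Type*} [Field k] [Group G] [Fintype G] [DecidableEq G]

theorem grp_mul_apply (χ : G →* kˣ) (y : G) (F : DrinfeldDouble k G) (s t : G) :
    (grp χ y * F) (s, t) = χ s * F (y⁻¹ * s * y, y⁻¹ * t) := by
  rw [mul_apply, Finset.sum_eq_single y]
  · simp [grp_apply]
  · intro b _ hb; simp [grp_apply, hb]
  · simp

theorem mul_grp_apply (χ : G →* kˣ) (y : G) (F : DrinfeldDouble k G) (s t : G) :
    (F * grp χ y) (s, t) = F (s, t * y⁻¹) * χ s := by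
  rw [mul_apply, Finset.sum_eq_single (t * y⁻¹)]
  · have : (t * y⁻¹)⁻¹ * t = y := by group
    simp only [grp_apply, this, if_true, map_mul, map_inv]
    rw [mul_comm (χ t * (χ y)⁻¹)⁻¹, inv_mul_cancel_right]
  · intro b _ hb
    rw [grp_apply, if_neg, mul_zero]
    rintro rfl
    exact hb (by group)
  · simp

theorem exists_map_grp (φ : HopfAut k G) (p : (G →* kˣ) × G) :
    ∃ q : (G →* kˣ) × G, φ (grp p.1 p.2) = grp q.1 q.2 := by
  obtain ⟨χ, y, h⟩ := (isGroupLikeElem_iff _).1 ((isGroupLikeElem_grp p.1 p.2).map φ)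
  exact ⟨(χ, y), h⟩

/-- The action of a Hopf automorphism on the group `Ĝ × G` of group-like elements of `DG`. -/
noncomputable def glMap (φ : HopfAut k G) : (G →* kˣ) × G →* (G →* kˣ) × G where
  toFun p := (exists_map_grp φ p).choose
  map_one' := by
    have h := (exists_map_grp φ 1).choose_spec
    generalize (exists_map_grp φ 1).choose = q at h ⊢
    rw [Prod.fst_one, Prod.snd_one, grp_one_one, map_one, ← grp_one_one] at h
    have := grp_injective h
    exact Prod.ext this.1.symm this.2.symm
  map_mul' p q := by
    have h := (exists_map_grp φ (p * q)).choose_spec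
    generalize (exists_map_grp φ (p * q)).choose = r at h ⊢
    rw [Prod.fst_mul, Prod.snd_mul, ← grp_mul_grp, map_mul, (exists_map_grp φ p).choose_spec,
      (exists_map_grp φ q).choose_spec, grp_mul_grp] at h
    have := grp_injective h
    exact Prod.ext this.1.symm this.2.symm

theorem apply_grp (φ : HopfAut k G) (χ : G →* kˣ) (y : G) :
    φ (grp χ y) = grp (glMap φ (χ, y)).1 (glMap φ (χ, y)).2 :=
  (exists_map_grp φ (χ, y)).choose_spec

theorem glMap_eq {φ : HopfAut k G} {χ χ' : G →* kˣ} {y y' : G}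
    (h : φ (grp χ y) = grp χ' y') : glMap φ (χ, y) = (χ', y') := by
  rw [apply_grp] at h
  exact Prod.ext (grp_injective h).1 (grp_injective h).2

theorem glMap_mul (φ ψ : HopfAut k G) (p : (G →* kˣ) × G) :
    glMap (φ * ψ) p = glMap φ (glMap ψ p) :=
  glMap_eq (by rw [HopfAut.mul_apply, apply_grp ψ]; exact apply_grp φ _ _)

theorem glMap_one (p : (G →* kˣ) × G) : glMap (1 : HopfAut k G) p = p :=
  glMap_eq (HopfAut.one_apply _)

/-- `Ĝ` is central in the group `Ĝ × G` of group-like elements, hence so is its image under `φ`. -/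
theorem glMap_fst_mem_center (φ : HopfAut k G) (χ : G →* kˣ) :
    (glMap φ (χ, 1)).2 ∈ Subgroup.center G := by
  rw [Subgroup.mem_center_iff]
  intro g
  have h : glMap φ (glMap φ⁻¹ (1, g)) = (1, g) := by
    rw [← glMap_mul, mul_inv_cancel, glMap_one]
  have h2 := congrArg Prod.snd (map_mul (glMap φ) (χ, 1) (glMap φ⁻¹ (1, g)))
  have h3 := congrArg Prod.snd (map_mul (glMap φ) (glMap φ⁻¹ (1, g)) (χ, 1))
  rw [h, Prod.snd_mul] at h2 h3
  rw [← h2, ← h3]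
  congr 2
  ext <;> simp [mul_comm]

/-- The entry `v` of the matrix of a Hopf automorphism: `φ(1 × g) = b(g) × v(g)`. -/
noncomputable def vPart (φ : HopfAut k G) : G →* G :=
  (MonoidHom.snd _ _).comp ((glMap φ).comp (MonoidHom.inr _ _))

/-- The entry `b` of the matrix of a Hopf automorphism: `φ(1 × g) = b(g) × v(g)`. -/
noncomputable def bPart (φ : HopfAut k G) : G →* (G →* kˣ) :=
  (MonoidHom.fst _ _).comp ((glMap φ).comp (MonoidHom.inr _ _))

theorem apply_grp_one (φ : HopfAut k G) (y : G) :
    φ (grp 1 y) = grp (bPart φ y) (vPart φ y) := apply_grp φ 1 y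

theorem exists_center_mul_vPart (φ : HopfAut k G) (g : G) :
    ∃ z ∈ Subgroup.center G, ∃ y, g = z * vPart φ y := by
  have h : glMap φ (glMap φ⁻¹ (1, g)) = (1, g) := by
    rw [← glMap_mul, mul_inv_cancel, glMap_one]
  set p := glMap φ⁻¹ (1, g)
  have hp : p = (p.1, 1) * (1, p.2) := by ext <;> simp
  rw [hp, map_mul] at h
  exact ⟨_, glMap_fst_mem_center φ p.1, p.2, (congrArg Prod.snd h).symm⟩

section Entries

variable (φ : HopfAut k G)

/-- `φ` intertwines conjugation by `g` on the source index and by `v(g)` on the target indices. -/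
theorem apply_e_conj (g x s t : G) :
    φ (e (g * x * g⁻¹) 1) (s, t) =
      φ (e x 1) ((vPart φ g)⁻¹ * s * vPart φ g, (vPart φ g)⁻¹ * t * vPart φ g) := by
  have h : (grp 1 g * e x 1 : DrinfeldDouble k G) = e (g * x * g⁻¹) 1 * grp 1 g := by
    rw [grp_one_mul_e, e_mul_grp]; simp
  have h' := congrFun (congrArg φ h) (s, t * vPart φ g)
  rw [map_mul, map_mul, apply_grp_one, grp_mul_apply, mul_grp_apply, mul_inv_cancel_right,
    mul_comm] at h'
  rw [← mul_right_cancel₀ (Units.ne_zero _) h', mul_assoc (vPart φ g)⁻¹ t]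

theorem sum_apply_e (s t : G) : ∑ x : G, φ (e x 1) (s, t) = if t = 1 then 1 else 0 := by
  rw [← sum_apply, ← map_sum, ← one_eq_sum, map_one, one_apply]

/-- Compatibility of `φ` with `(e_x × 1)(e_{x'} × 1) = δ e_x × 1`, in coordinates. -/
theorem apply_e_mul (x x' s t : G) :
    ∑ z : G, φ (e x 1) (s, z) * φ (e x' 1) (z⁻¹ * s * z, z⁻¹ * t) =
      if x = x' then φ (e x 1) (s, t) else 0 := by
  rw [← mul_apply, ← map_mul, e_mul_e]
  simp only [one_mul, inv_one, mul_one]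
  split_ifs
  · rfl
  · rw [map_zero]; rfl

/-- Injectivity of `φ`: the vectors `φ(e_x × 1)` admit dual functionals. -/
theorem sum_apply_e_mul_inv (x g : G) :
    ∑ p : G × G, φ (e x 1) p * φ⁻¹ (e p.1 p.2) (g, 1) = if x = g then 1 else 0 := by
  have h : φ⁻¹ (φ (e x 1)) = e x 1 := by rw [← HopfAut.mul_apply, inv_mul_cancel]; rfl
  rw [eq_sum_e (φ (e x 1)), map_sum] at h
  have h' := congrFun h (g, 1)
  rw [sum_apply] at h'
  simp only [map_smul, smul_apply] at h'
  rw [h', e_apply]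
  simp [eq_comm]

/-- The elements `∑ x, φ(e_x × 1)(1, t) x` of the group algebra commute with the elements
`∑ x, φ(e_x × 1)(s, t') x`, which span by injectivity of `φ`; so they are central. -/
theorem apply_e_one_comm (x g t : G) :
    φ (e (x * g) 1) (1, t) = φ (e (g * x) 1) (1, t) := by
  have h1 : ∀ s t', ∑ z : G, φ (e z 1) (1, t) * φ (e (z⁻¹ * (g * x * g)) 1) (s, t') =
      ∑ z : G, φ (e z 1) (s, t') * φ (e (z⁻¹ * (g * x * g)) 1) (1, t) := by
    intro s t'
    rw [φ.coord₂_comul_apply, φ.coord₂_comul_apply]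
    by_cases h : t = t'
    · subst h; simp
    · rw [if_neg h, if_neg (Ne.symm h)]
  have h2 : ∑ p : G × G, (∑ z : G, φ (e z 1) (1, t) * φ (e (z⁻¹ * (g * x * g)) 1) p) *
      φ⁻¹ (e p.1 p.2) (g, 1) = φ (e (g * x) 1) (1, t) := by
    simp only [Finset.sum_mul]
    rw [Finset.sum_comm]
    simp only [mul_assoc (φ (e _ 1) (1, t)), ← Finset.mul_sum, sum_apply_e_mul_inv]
    rw [Finset.sum_eq_single (g * x)]
    · rw [if_pos (by group), mul_one]
    · intro b _ hb
      rw [if_neg, mul_zero]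
      intro h
      apply hb
      rw [inv_mul_eq_iff_eq_mul] at h
      exact (mul_right_cancel h).symm
    · simp
  have h3 : ∑ p : G × G, (∑ z : G, φ (e z 1) p * φ (e (z⁻¹ * (g * x * g)) 1) (1, t)) *
      φ⁻¹ (e p.1 p.2) (g, 1) = φ (e (x * g) 1) (1, t) := by
    simp only [Finset.sum_mul]
    rw [Finset.sum_comm]
    simp only [mul_right_comm _ (φ (e (_⁻¹ * _) 1) (1, t))]
    simp only [← Finset.sum_mul, sum_apply_e_mul_inv]
    rw [Finset.sum_eq_single g]
    · rw [if_pos rfl, one_mul, mul_assoc g, inv_mul_cancel_left]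
    · intro b _ hb
      rw [if_neg hb, zero_mul]
    · simp
  rw [← h2, ← h3]
  refine Finset.sum_congr rfl fun p _ => ?_
  rw [h1]

theorem apply_e_one_conj (x g t : G) :
    φ (e (g * x * g⁻¹) 1) (1, t) = φ (e x 1) (1, t) := by
  rw [apply_e_one_comm]; simp

/-- The composite of `φ` with `f × y ↦ f(1) y` kills `e_x × 1` unless `x` is central: the values at
`e_x × 1` and `e_{gxg⁻¹} × 1` agree, but they are orthogonal idempotents unless `x = gxg⁻¹`. -/
theorem mem_center_of_apply_e_one_ne_zero {x t : G} (h : φ (e x 1) (1, t) ≠ 0) :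
    x ∈ Subgroup.center G := by
  rw [Subgroup.mem_center_iff]
  intro g
  have h1 := apply_e_mul φ x x 1 t
  have h2 := apply_e_mul φ x (g * x * g⁻¹) 1 t
  simp only [mul_one, inv_mul_cancel, apply_e_one_conj, if_true] at h1 h2
  rw [h1] at h2
  by_contra hne
  rw [if_neg (fun h' => hne (by rw [eq_mul_inv_iff_mul_eq] at h'; exact h'.symm))] at h2
  exact h h2

/-- The element `t` is fixed by conjugation with `v(y)` because the group-like components of
`φ(e_x × 1)` for different `t` are orthogonal for the comultiplication; the image of `v` and the
centre generate `G`. -/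
theorem mem_center_of_apply_one_ne_zero {x t : G} (h : φ (e x 1) (1, t) ≠ 0) :
    t ∈ Subgroup.center G := by
  have hv : ∀ y, vPart φ y * t = t * vPart φ y := by
    intro y
    by_contra hne
    have hne' : t ≠ (vPart φ y)⁻¹ * t * vPart φ y := by
      intro h'
      apply hne
      rw [mul_assoc, eq_inv_mul_iff_mul_eq] at h'
      exact h'
    have h1 := φ.coord₂_comul_apply 1 t 1 t x 1
    have h2 := φ.coord₂_comul_apply 1 t 1 ((vPart φ y)⁻¹ * t * vPart φ y) x 1
    have h3 : ∀ w, φ (e w 1) (1, (vPart φ y)⁻¹ * t * vPart φ y) = φ (e w 1) (1, t) := by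
      intro w
      have := apply_e_conj φ y w 1 t
      simp only [mul_one, inv_mul_cancel, apply_e_one_conj] at this
      exact this.symm
    simp only [h3] at h2
    rw [if_neg hne'] at h2
    rw [h2, if_pos rfl, mul_one] at h1
    exact h h1.symm
  rw [Subgroup.mem_center_iff]
  intro g
  obtain ⟨z, hz, y, rfl⟩ := exists_center_mul_vPart φ g
  rw [mul_assoc, hv, ← mul_assoc, ← Subgroup.mem_center_iff.1 hz t, mul_assoc]

theorem mem_center_of_apply_ne_zero {x s t : G} (h : φ (e x 1) (s, t) ≠ 0) :
    t ∈ Subgroup.center G := by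
  have h1 := φ.coord₂_comul_apply 1 t s t x 1
  rw [if_pos rfl, one_mul] at h1
  rw [← h1] at h
  obtain ⟨z, -, hz⟩ := Finset.exists_ne_zero_of_sum_ne_zero h
  exact mem_center_of_apply_one_ne_zero φ (left_ne_zero_of_mul hz)

/-- For fixed `s` the values of `(id ⊗ ε) φ(e_x × 1)` at `s` form a complete family of orthogonal
idempotents of `k`. -/
theorem exists_uFun (s : G) :
    ∃ u : G, ∀ x, ∑ t : G, φ (e x 1) (s, t) = if x = u then 1 else 0 := by
  refine exists_eq_indicator (fun x => ∑ t : G, φ (e x 1) (s, t)) ?_ ?_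
  · intro x x'
    have h1 : ∀ t, ∑ z : G, φ (e x 1) (s, z) * φ (e x' 1) (s, z⁻¹ * t) =
        if x = x' then φ (e x 1) (s, t) else 0 := by
      intro t
      rw [← apply_e_mul]
      refine Finset.sum_congr rfl fun z _ => ?_
      by_cases hz : φ (e x 1) (s, z) = 0
      · simp [hz]
      · have := Subgroup.mem_center_iff.1 (mem_center_of_apply_ne_zero φ hz) s
        rw [mul_assoc z⁻¹ s z, this, inv_mul_cancel_left]
    have h2 : ∑ t : G, (if x = x' then φ (e x 1) (s, t) else 0) =
        if x = x' then ∑ t : G, φ (e x 1) (s, t) else 0 := by split_ifs <;> simp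
    rw [← h2]
    simp only [← h1]
    rw [Finset.sum_comm, Finset.sum_mul]
    refine Finset.sum_congr rfl fun z _ => ?_
    rw [← Finset.mul_sum]
    congr 1
    exact (Equiv.sum_comp (Equiv.mulLeft z⁻¹) fun t => φ (e x' 1) (s, t)).symm
  · rw [Finset.sum_comm]
    simp only [sum_apply_e]
    simp

/-- The entry `u` of the matrix of a Hopf automorphism, as the endomorphism of `G` whose pullback
is the Hopf endomorphism `f ↦ (id ⊗ ε) φ(f × 1)` of `k^G`. -/
noncomputable def uPart : G →* G where
  toFun s := (exists_uFun φ s).choose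
  map_one' := by
    have h := (exists_uFun φ 1).choose_spec 1
    rw [φ.sum_apply_one, if_pos rfl] at h
    by_contra hne
    rw [if_neg (Ne.symm hne)] at h
    exact one_ne_zero h
  map_mul' s s' := by
    have h1 := (exists_uFun φ s).choose_spec
    have h2 := (exists_uFun φ s').choose_spec
    have h3 := (exists_uFun φ (s * s')).choose_spec
    generalize (exists_uFun φ s).choose = u at h1 ⊢
    generalize (exists_uFun φ s').choose = u' at h2 ⊢
    generalize (exists_uFun φ (s * s')).choose = u'' at h3 ⊢
    set w := u * u' with hw
    have h4 : ∑ t : G, ∑ t' : G, (∑ z : G, φ (e z 1) (s, t) * φ (e (z⁻¹ * w) 1) (s', t')) =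
        ∑ t : G, φ (e w 1) (s * s', t) := by
      simp [φ.coord₂_comul_apply]
    have h5 : ∑ t : G, ∑ t' : G, (∑ z : G, φ (e z 1) (s, t) * φ (e (z⁻¹ * w) 1) (s', t')) =
        ∑ z : G, (∑ t : G, φ (e z 1) (s, t)) * (∑ t : G, φ (e (z⁻¹ * w) 1) (s', t)) := by
      simp only [Finset.sum_mul_sum]
      conv_lhs => enter [2, t]; rw [Finset.sum_comm]
      rw [Finset.sum_comm]
    rw [h5] at h4
    simp only [h1, h2, h3, ite_mul, one_mul, zero_mul, Finset.sum_ite_eq', Finset.mem_univ,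
      if_true] at h4
    rw [if_pos (by rw [hw]; group)] at h4
    by_contra hne
    rw [if_neg (Ne.symm hne)] at h4
    exact one_ne_zero h4

theorem sum_apply_e_right (s x : G) :
    ∑ t : G, φ (e x 1) (s, t) = if x = uPart φ s then 1 else 0 :=
  (exists_uFun φ s).choose_spec x

theorem apply_e_eq (x s t : G) : φ (e x 1) (s, t) = φ (e ((uPart φ s)⁻¹ * x) 1) (1, t) := by
  have h : ∑ t' : G, ∑ z : G, φ (e z 1) (s, t') * φ (e (z⁻¹ * x) 1) (1, t) =
      φ (e x 1) (s, t) := by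
    simp [φ.coord₂_comul_apply]
  rw [← h, Finset.sum_comm]
  simp [← Finset.sum_mul, sum_apply_e_right]

theorem conj_uPart (g s : G) :
    g * uPart φ s * g⁻¹ = uPart φ (vPart φ g * s * (vPart φ g)⁻¹) := by
  have h : ∑ t : G, φ (e (g * uPart φ s * g⁻¹) 1) (vPart φ g * s * (vPart φ g)⁻¹, t) =
      ∑ t : G, φ (e (uPart φ s) 1) (s, t) := by
    simp only [apply_e_conj]
    rw [← Equiv.sum_comp (MulAut.conj (vPart φ g)⁻¹).toEquiv
      fun t => φ (e (uPart φ s) 1) (s, t)]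
    refine Finset.sum_congr rfl fun t _ => ?_
    simp [mul_assoc]
  rw [sum_apply_e_right, sum_apply_e_right, if_pos rfl] at h
  by_contra hne
  rw [if_neg hne] at h
  exact zero_ne_one h

theorem sum_center {f : G → k} (h : ∀ g, f g ≠ 0 → g ∈ Subgroup.center G) :
    ∑ z : Subgroup.center G, f z = ∑ g : G, f g := by
  classical
  rw [← Finset.sum_filter_of_ne (p := (· ∈ Subgroup.center G)) fun x _ hx => h x hx]
  exact (Finset.sum_subtype _ (by simp) f).symm

/-- The image of the character `χ` of the centre under `(ε ⊗ id) φ` is group-like in `kG`. -/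
theorem exists_aFun (χ : Subgroup.center G →* kˣ) : ∃ a : Subgroup.center G, ∀ t : G,
    ∑ z : Subgroup.center G, (χ z : k) * φ (e (z : G) 1) (1, t) = if t = a then 1 else 0 := by
  classical
  obtain ⟨a, ha⟩ := exists_eq_indicator
    (fun t => ∑ z : Subgroup.center G, (χ z : k) * φ (e (z : G) 1) (1, t)) (by
      intro t t'
      have h1 : ∀ w : Subgroup.center G, ∑ z : Subgroup.center G,
          φ (e (z : G) 1) (1, t) * φ (e ((z⁻¹ * w : Subgroup.center G) : G) 1) (1, t') =
          if t = t' then φ (e (w : G) 1) (1, t) else 0 := by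
        intro w
        have := φ.coord₂_comul_apply 1 t 1 t' w 1
        rw [one_mul] at this
        rw [← this, ← sum_center (G := G)]
        · rfl
        · intro g hg
          exact mem_center_of_apply_e_one_ne_zero φ (left_ne_zero_of_mul hg)
      have h2 : (if t = t' then ∑ z : Subgroup.center G, (χ z : k) * φ (e (z : G) 1) (1, t)
          else 0) = ∑ w : Subgroup.center G, (χ w : k) *
            (if t = t' then φ (e (w : G) 1) (1, t) else 0) := by split_ifs <;> simp
      rw [h2]
      simp only [← h1]
      conv_rhs => simp only [Finset.mul_sum]
      rw [Finset.sum_comm, Finset.sum_mul_sum]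
      refine Finset.sum_congr rfl fun z _ => ?_
      rw [← Equiv.sum_comp (Equiv.mulLeft z⁻¹)]
      refine Finset.sum_congr rfl fun w _ => ?_
      simp only [Equiv.coe_mulLeft]
      have : (χ w : k) = χ z * χ (z⁻¹ * w) := by
        rw [← Units.val_mul, ← map_mul, mul_inv_cancel_left]
      rw [this]; ring) (by
      rw [Finset.sum_comm]
      simp only [← Finset.mul_sum, φ.sum_apply_one]
      rw [Finset.sum_eq_single 1]
      · simp
      · intro b _ hb; simp [hb]
      · simp)
  have ha' := ha a
  rw [if_pos rfl] at ha'
  obtain ⟨z, -, hz⟩ := Finset.exists_ne_zero_of_sum_ne_zero (ha'.trans_ne one_ne_zero)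
  exact ⟨⟨a, mem_center_of_apply_one_ne_zero φ (right_ne_zero_of_mul hz)⟩, ha⟩

/-- The entry `a` of the matrix of a Hopf automorphism: the Hopf algebra map
`f ↦ (ε ⊗ id) φ(f × 1)` from `k^G` to `kG` factors through restriction to the centre `Z`, and takes
the character `χ ∈ k^Z` to the group element `a(χ)`. -/
noncomputable def aPart : (Subgroup.center G →* kˣ) →* Subgroup.center G where
  toFun χ := (exists_aFun φ χ).choose
  map_one' := by
    have h := (exists_aFun φ 1).choose_spec 1
    generalize (exists_aFun φ 1).choose = a at h ⊢
    simp only [MonoidHom.one_apply, Units.val_one, one_mul] at h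
    rw [sum_center (f := fun g => φ (e g 1) (1, 1))
      fun g hg => mem_center_of_apply_e_one_ne_zero φ hg, sum_apply_e, if_pos rfl] at h
    by_contra hne
    rw [if_neg] at h
    · exact one_ne_zero h
    · intro h'; exact hne (Subtype.ext h'.symm)
  map_mul' χ χ' := by
    classical
    have h1 := (exists_aFun φ χ).choose_spec
    have h2 := (exists_aFun φ χ').choose_spec
    have h3 := (exists_aFun φ (χ * χ')).choose_spec
    generalize (exists_aFun φ χ).choose = a at h1 ⊢
    generalize (exists_aFun φ χ').choose = a' at h2 ⊢
    generalize (exists_aFun φ (χ * χ')).choose = a'' at h3 ⊢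
    set w : G := ((a * a' : Subgroup.center G) : G) with hw
    have h4 : ∑ y : G, (∑ z : Subgroup.center G, (χ z : k) * φ (e (z : G) 1) (1, y)) *
        (∑ z : Subgroup.center G, (χ' z : k) * φ (e (z : G) 1) (1, y⁻¹ * w)) =
        ∑ z : Subgroup.center G, ((χ * χ') z : k) * φ (e (z : G) 1) (1, w) := by
      simp only [Finset.sum_mul_sum]
      rw [Finset.sum_comm]
      refine Finset.sum_congr rfl fun z _ => ?_
      rw [Finset.sum_comm]
      have : ∀ z' : Subgroup.center G, ∑ y : G, (χ z : k) * φ (e (z : G) 1) (1, y) *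
          ((χ' z' : k) * φ (e (z' : G) 1) (1, y⁻¹ * w)) = (χ z : k) * χ' z' *
            (if z = z' then φ (e (z : G) 1) (1, w) else 0) := by
        intro z'
        have := apply_e_mul φ z z' 1 w
        simp only [mul_one, inv_mul_cancel, Subtype.ext_iff] at this ⊢
        rw [← this, Finset.mul_sum]
        exact Finset.sum_congr rfl fun y _ => by ring
      simp [this]
    simp only [h1, h2, h3, ite_mul, one_mul, zero_mul, Finset.sum_ite_eq', Finset.mem_univ,
      if_true] at h4
    rw [if_pos (by rw [hw]; simp)] at h4
    by_contra hne
    rw [if_neg] at h4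
    · exact one_ne_zero h4
    · intro h'; exact hne (Subtype.ext h'.symm)

theorem sum_center_mul_apply (χ : Subgroup.center G →* kˣ) (t : G) :
    ∑ z : Subgroup.center G, (χ z : k) * φ (e (z : G) 1) (1, t) =
      if t = aPart φ χ then 1 else 0 := (exists_aFun φ χ).choose_spec t

/-- A Hopf automorphism is determined by its matrix. -/
theorem apply_charVec (x : G) (χ : Subgroup.center G →* kˣ) (y s t : G) :
    φ (charVec _ x χ y) (s, t) = if t = aPart φ χ * vPart φ y then
      charVec _ x χ 1 (uPart φ s, 1) * bPart φ y s else 0 := by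
  classical
  have h1 : ∀ t, φ (charVec _ x χ 1) (s, t) = if t = aPart φ χ then
      charVec _ x χ 1 (uPart φ s, 1) else 0 := by
    intro t
    have h2 : φ (charVec _ x χ 1) (s, t) = (Nat.card (Subgroup.center G) : k)⁻¹ *
        ∑ z : Subgroup.center G, (χ z : k) * φ (e ((uPart φ s)⁻¹ * x * z) 1) (1, t) := by
      rw [charVec, map_smul, map_sum, smul_apply, sum_apply]
      simp only [map_smul, smul_apply]
      congr 1
      refine Finset.sum_congr (Finset.ext fun _ => by simp) fun z _ => ?_
      rw [apply_e_eq, mul_assoc]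
    by_cases hx : x⁻¹ * uPart φ s ∈ Subgroup.center G
    · obtain ⟨w, hw⟩ : ∃ w : Subgroup.center G, (w : G) = x⁻¹ * uPart φ s := ⟨⟨_, hx⟩, rfl⟩
      have h3 : (uPart φ s)⁻¹ * x = ((w⁻¹ : Subgroup.center G) : G) := by
        rw [Subgroup.coe_inv, hw]; group
      have h4 : uPart φ s = x * w := by rw [hw]; group
      rw [h2, ← Equiv.sum_comp (Equiv.mulLeft w), h3, h4, charVec_apply_mul]
      have h5 : ∀ z : Subgroup.center G, (χ (Equiv.mulLeft w z) : k) *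
          φ (e (((w⁻¹ : Subgroup.center G) : G) * (Equiv.mulLeft w z : Subgroup.center G)) 1) (1, t)
          = χ w * ((χ z : k) * φ (e (z : G) 1) (1, t)) := by
        intro z
        simp only [Equiv.coe_mulLeft, map_mul, Units.val_mul, Subgroup.coe_inv, Subgroup.coe_mul,
          inv_mul_cancel_left]
        ring
      simp only [h5, ← Finset.mul_sum, sum_center_mul_apply]
      split_ifs <;> simp
    · rw [charVec_apply_of_notMem hx, ite_self, h2, Finset.sum_eq_zero, mul_zero]
      intro z _
      by_contra hne
      have h3 := mem_center_of_apply_e_one_ne_zero φ (right_ne_zero_of_mul hne)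
      rw [Subgroup.mul_mem_cancel_right _ z.2] at h3
      apply hx
      have := Subgroup.inv_mem _ h3
      rwa [mul_inv_rev, inv_inv] at this
  rw [← one_mul y, ← charVec_mul_grp, map_mul, apply_grp_one, mul_grp_apply, h1, one_mul]
  simp only [mul_inv_eq_iff_eq_mul, ite_mul, zero_mul]

end Entries

end Matrix

/-! ### Composition of matrices -/

section Composition

variable {k G : Type*} [Field k] [CharZero k] [Group G] [Fintype G] [DecidableEq G]

theorem charVec_one_one_ne_zero (χ : Subgroup.center G →* kˣ) :
    charVec (k := k) (Subgroup.center G) 1 χ 1 (1, 1) ≠ 0 := by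
  have := charVec_apply_mul (k := k) (Subgroup.center G) 1 χ 1 1
  simp only [OneMemClass.coe_one, mul_one, map_one, Units.val_one] at this
  rw [this]
  exact inv_ne_zero (Nat.cast_ne_zero.2 Nat.card_pos.ne')

theorem aPart_eq {φ : HopfAut k G} {χ : Subgroup.center G →* kˣ} {t : G}
    (h : φ (charVec _ 1 χ 1) (1, t) ≠ 0) : (aPart φ χ : G) = t := by
  rw [apply_charVec, map_one, mul_one] at h
  by_contra hne
  exact h (if_neg (Ne.symm hne))

/-- The action on group-like elements is the action of the matrix on column vectors `(χ, y)`. -/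
theorem glMap_apply (φ : HopfAut k G) (χ : G →* kˣ) (y : G) :
    glMap φ (χ, y) = (χ.comp (uPart φ) * bPart φ y,
      aPart φ (χ.comp (Subgroup.center G).subtype) * vPart φ y) := by
  apply glMap_eq
  rw [grp_eq_sum_charVec (Subgroup.center G), map_sum]
  ext s t
  rw [sum_apply]
  simp only [map_smul, smul_apply, apply_charVec, grp_apply, mul_ite, mul_zero]
  split_ifs
  · have h := congrFun (grp_eq_sum_charVec (Subgroup.center G) χ 1) (uPart φ s, 1)
    rw [sum_apply, grp_apply, if_pos rfl] at h
    simp only [smul_apply] at h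
    rw [MonoidHom.mul_apply, Units.val_mul, MonoidHom.comp_apply, h, Finset.sum_mul]
    exact Finset.sum_congr rfl fun x _ => (mul_assoc _ _ _).symm
  · simp

theorem vPart_mul (φ ψ : HopfAut k G) (y : G) :
    vPart (φ * ψ) y = aPart φ ((bPart ψ y).comp (Subgroup.center G).subtype) *
      vPart φ (vPart ψ y) := by
  have h := congrArg Prod.snd (glMap_mul φ ψ (1, y))
  rwa [show glMap ψ (1, y) = (bPart ψ y, vPart ψ y) from rfl, glMap_apply φ] at h

theorem vPart_one (y : G) : vPart (1 : HopfAut k G) y = y :=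
  congrArg Prod.snd (glMap_one (k := k) (1, y))

theorem aPart_mul_vPart_inv (φ : HopfAut k G) (y : G) :
    aPart φ ((bPart φ⁻¹ y).comp (Subgroup.center G).subtype) * vPart φ (vPart φ⁻¹ y) = y := by
  rw [← vPart_mul, mul_inv_cancel, vPart_one]

theorem aPart_inv_mul_vPart (φ : HopfAut k G) (y : G) :
    aPart φ⁻¹ ((bPart φ y).comp (Subgroup.center G).subtype) * vPart φ⁻¹ (vPart φ y) = y := by
  rw [← vPart_mul, inv_mul_cancel, vPart_one]

theorem vPart_eq {φ : HopfAut k G} {χ : G →* kˣ} {y t : G} (h : φ (grp 1 y) = grp χ t) :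
    vPart φ y = t := congrArg Prod.snd (glMap_eq h)

theorem bPart_eq {φ : HopfAut k G} {χ : G →* kˣ} {y t : G} (h : φ (grp 1 y) = grp χ t) :
    bPart φ y = χ := congrArg Prod.fst (glMap_eq h)

/-- If `a` is trivial then `v` is invertible. -/
theorem vPart_bijective_of_aPart {φ : HopfAut k G} (h : aPart φ = 1) :
    Function.Bijective (vPart φ) := by
  rw [← Finite.surjective_iff_bijective]
  intro g
  have := aPart_mul_vPart_inv φ g
  rw [h, MonoidHom.one_apply, OneMemClass.coe_one, one_mul] at this
  exact ⟨_, this⟩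

/-- If `b` is trivial then `v` is invertible. -/
theorem vPart_bijective_of_bPart {φ : HopfAut k G} (h : bPart φ = 1) :
    Function.Bijective (vPart φ) := by
  rw [← Finite.injective_iff_bijective]
  refine Function.LeftInverse.injective (g := vPart φ⁻¹) fun g => ?_
  have := aPart_inv_mul_vPart φ g
  rwa [h, MonoidHom.one_apply, MonoidHom.one_comp, map_one, OneMemClass.coe_one, one_mul] at this

variable [IsAlgClosed k]

/-- The entries `a` and `v` determine the composite of a Hopf automorphism with `ε ⊗ id`. -/
theorem apply_one_congr {φ ψ : HopfAut k G} (ha : aPart φ = aPart ψ) (hv : vPart φ = vPart ψ)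
    (F : DrinfeldDouble k G) (t : G) : φ F (1, t) = ψ F (1, t) := by
  have h : ∀ x χ y, φ (charVec (Subgroup.center G) x χ y) (1, t) =
      ψ (charVec (Subgroup.center G) x χ y) (1, t) := by
    intro x χ y
    simp only [apply_charVec, ha, hv, map_one]
  have h2 : ∀ x y, φ (e x y) (1, t) = ψ (e x y) (1, t) := by
    intro x y
    rw [← sum_charVec (le_refl (Subgroup.center G)), map_sum, map_sum, sum_apply, sum_apply]
    exact Finset.sum_congr rfl fun χ _ => h x χ y
  rw [eq_sum_e F, map_sum, map_sum, sum_apply, sum_apply]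
  simp only [map_smul, smul_apply, h2]

theorem aPart_mul_inv_eq_one {φ ψ : HopfAut k G} (ha : aPart φ = aPart ψ)
    (hv : vPart φ = vPart ψ) : aPart (φ * ψ⁻¹) = 1 := by
  ext χ
  rw [MonoidHom.one_apply, OneMemClass.coe_one]
  apply aPart_eq
  rw [HopfAut.mul_apply, apply_one_congr ha hv, ← HopfAut.mul_apply, mul_inv_cancel,
    HopfAut.one_apply]
  exact charVec_one_one_ne_zero χ

/-- If `a` is trivial then `φ` is monomial: it takes `f × y` to `b(y) (f ∘ u) × v(y)`. -/
theorem apply_e_of_aPart {φ : HopfAut k G} (h : aPart φ = 1) (x y s t : G) :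
    φ (e x y) (s, t) = if t = vPart φ y ∧ x = uPart φ s then (bPart φ y s : k) else 0 := by
  rw [← sum_charVec (le_refl (Subgroup.center G)), map_sum, sum_apply]
  simp only [apply_charVec, h, MonoidHom.one_apply, OneMemClass.coe_one, one_mul]
  have h1 := congrFun (sum_charVec (k := k) (le_refl (Subgroup.center G)) x 1) (uPart φ s, 1)
  rw [sum_apply] at h1
  by_cases ht : t = vPart φ y
  · simp only [if_pos ht, ← Finset.sum_mul, h1, e_apply]
    simp [ht, eq_comm]
  · simp [ht]

theorem uPart_bijective_of_aPart {φ : HopfAut k G} (h : aPart φ = 1) :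
    Function.Bijective (uPart φ) := by
  rw [← Finite.surjective_iff_bijective]
  intro x
  by_contra hx
  push Not at hx
  have h0 : φ (e x 1) = 0 := by
    ext s t
    rw [apply_e_of_aPart h, if_neg (fun h' => hx s h'.2.symm)]
    rfl
  have h1 : (e x 1 : DrinfeldDouble k G) = 0 := by
    have := congrArg (φ⁻¹ : HopfAut k G) h0
    rwa [← HopfAut.mul_apply, inv_mul_cancel, HopfAut.one_apply, map_zero] at this
  have h2 := congrFun h1 (x, 1)
  rw [e_apply, if_pos ⟨rfl, rfl⟩] at h2
  exact one_ne_zero h2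

end Composition

/-! ### The subgroups `V`, `V_c`, `B`, `E` and their products -/

section Subgroups

variable {k G : Type*} [Field k] [Group G] [Fintype G] [DecidableEq G]

/-- Homomorphisms from `G` to its characters factor through the abelianization in both
arguments. -/
noncomputable def liftB (b : G →* (G →* kˣ)) : Abelianization G →* (Abelianization G →* kˣ) :=
  Abelianization.lift (MonoidHom.mk' (fun y => Abelianization.lift (b y)) fun y y' => by
    ext x; simp)

theorem autB_liftB_e (b : G →* (G →* kˣ)) (x y : G) :
    autB (liftB b) (e x y) = (b y x : k) • e x y := by
  rw [autB_e]; simp [liftB]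

theorem one_mul_char (χ : G →* kˣ) : 1 * χ = χ := by
  ext x; rw [MonoidHom.mul_apply, MonoidHom.one_apply, one_mul]

theorem liftB_one : liftB (1 : G →* (G →* kˣ)) = 1 := by
  ext; simp [liftB]

/-- Every element of `Hom(G_ab, Ĝ_ab)` comes from a homomorphism from `G` to its characters. -/
theorem exists_eq_liftB (b : Abelianization G →* (Abelianization G →* kˣ)) :
    ∃ b', b = liftB b' :=
  ⟨MonoidHom.mk' (fun y => (b (Abelianization.of y)).comp Abelianization.of) fun y y' => by
    ext x; simp, by ext; simp [liftB]⟩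

theorem autB_liftB_grp (b : G →* (G →* kˣ)) (χ : G →* kˣ) (y : G) :
    autB (liftB b) (grp χ y) = grp (χ * b y) y := by
  simp only [grp_eq_sum, map_sum, map_smul, autB_liftB_e, smul_smul, MonoidHom.mul_apply,
    Units.val_mul]

theorem diagAut_grp (v w : MulAut G) (h) (χ : G →* kˣ) (y : G) :
    (diagAut v w h : HopfAut k G) (grp χ y) = grp (χ.comp (v⁻¹ : MulAut G).toMonoidHom) (w y) := by
  simp only [grp_eq_sum, map_sum, map_smul, diagAut_e]
  rw [← Equiv.sum_comp v.toEquiv fun x =>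
    ((χ.comp (v⁻¹ : MulAut G).toMonoidHom) x : k) • (e x (w y) : DrinfeldDouble k G)]
  refine Finset.sum_congr rfl fun x _ => ?_
  have h1 : (χ.comp (v⁻¹ : MulAut G).toMonoidHom) (v.toEquiv x) = χ x :=
    congrArg χ (v.symm_apply_apply x)
  rw [h1]; rfl

/-- The restriction of an automorphism to the centre. -/
abbrev centerAut (v : MulAut G) : Subgroup.center G ≃* Subgroup.center G :=
  Subgroup.centerCongr v

theorem diagAut_charVec (v w : MulAut G) (h) (x : G) (χ : Subgroup.center G →* kˣ) (y : G) :
    (diagAut v w h : HopfAut k G) (charVec _ x χ y) =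
      charVec _ (v x) (χ.comp (centerAut v⁻¹).toMonoidHom) (w y) := by
  simp only [charVec, map_smul, map_sum, diagAut_e]
  congr 1
  refine Finset.sum_bijective (centerAut v) (centerAut v).bijective (by simp) fun z _ => ?_
  have h1 : centerAut v⁻¹ (centerAut v z) = z := Subtype.ext (v.symm_apply_apply z)
  have h2 : ((centerAut v z : Subgroup.center G) : G) = v z := rfl
  simp [h1, h2]

theorem diagAut_mul (v w v' w' : MulAut G) (h h' h'') :
    (diagAut v w h * diagAut v' w' h' : HopfAut k G) = diagAut (v * v') (w * w') h'' :=
  HopfAut.ext_e fun x y => by simp only [HopfAut.mul_apply, diagAut_e]; rfl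

theorem diagAut_inv_apply_e (v w : MulAut G) (h) (x y : G) :
    ((diagAut v w h)⁻¹ : HopfAut k G) (e x y) = e (v⁻¹ x) (w⁻¹ y) := by
  have : e x y = (diagAut v w h : HopfAut k G) (e (v⁻¹ x) (w⁻¹ y)) := by
    rw [diagAut_e]; simp
  rw [this, ← HopfAut.mul_apply, inv_mul_cancel, HopfAut.one_apply]

theorem le_normalizer_of_conj_mem {A : Type*} [Group A] {H K : Subgroup A}
    (h : ∀ x ∈ H, ∀ y ∈ K, x * y * x⁻¹ ∈ K) : H ≤ Subgroup.normalizer (K : Set A) := by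
  intro x hx
  rw [Subgroup.mem_normalizer_iff]
  refine fun y => ⟨h x hx y, fun hy => ?_⟩
  have := h x⁻¹ (H.inv_mem hx) _ hy
  simpa [mul_assoc] using this

variable (k G) in
/-- `V_c ⋊ V` consists of the maps `e_g × h ↦ e_{v(g)} × w(h)`. -/
def diagSubgroup : Subgroup (HopfAut k G) where
  carrier := {φ | ∃ v w h, φ = diagAut v w h}
  one_mem' := ⟨1, 1, by simp, HopfAut.ext_e fun x y => by rw [diagAut_e]; rfl⟩
  mul_mem' := by
    rintro _ _ ⟨v, w, h, rfl⟩ ⟨v', w', h', rfl⟩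
    refine ⟨v * v', w * w', fun g => ?_, diagAut_mul _ _ _ _ _ _ _⟩
    have h1 : (v * v') g * ((w * w') g)⁻¹ =
        v (v' g * (w' g)⁻¹) * (v (w' g) * (w (w' g))⁻¹) := by simp [mul_assoc]
    rw [h1]
    exact Subgroup.mul_mem _ (centerAut v ⟨_, h' g⟩).2 (h _)
  inv_mem' := by
    rintro _ ⟨v, w, h, rfl⟩
    refine ⟨v⁻¹, w⁻¹, fun g => ?_, HopfAut.ext_e fun x y => by
      rw [diagAut_inv_apply_e, diagAut_e]⟩
    have h1 := Subgroup.inv_mem _ (centerAut v⁻¹ ⟨_, h (w⁻¹ g)⟩).2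
    have h2 : ((centerAut v⁻¹ ⟨_, h (w⁻¹ g)⟩ : Subgroup.center G) : G) =
        v⁻¹ (v (w⁻¹ g) * (w (w⁻¹ g))⁻¹) := rfl
    rw [h2] at h1
    have h3 : (v⁻¹ (v (w⁻¹ g) * (w (w⁻¹ g))⁻¹))⁻¹ = v⁻¹ g * (w⁻¹ g)⁻¹ := by
      simp
    rwa [h3] at h1

theorem homV_eq (v : MulAut G) : homV k G v = diagAut v v (fun g => by simp) := rfl

theorem homVc_eq (v : AutC G) :
    homVc k G v = diagAut v 1 (fun g => by simpa using mem_AutC.1 v.2 g) := rfl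

theorem homB_apply (b : Abelianization G →* (Abelianization G →* kˣ)) : homB k G b = autB b := rfl

variable [IsAlgClosed k] [CharZero k]

theorem VcV_eq_diagSubgroup : VcV k G = diagSubgroup k G := by
  refine le_antisymm (sup_le ?_ ?_) ?_
  · rintro _ ⟨v, rfl⟩; exact ⟨_, _, _, homVc_eq v⟩
  · rintro _ ⟨v, rfl⟩; exact ⟨_, _, _, homV_eq v⟩
  · rintro _ ⟨v, w, h, rfl⟩
    have hv : v * w⁻¹ ∈ AutC G := by
      rw [mem_AutC]
      intro g
      have := h (w⁻¹ g)
      simpa using this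
    have h1 : diagAut v w h = homVc k G ⟨v * w⁻¹, hv⟩ * homV k G w :=
      HopfAut.ext_e fun x y => by
        rw [HopfAut.mul_apply, homV_eq, homVc_eq, diagAut_e, diagAut_e, diagAut_e]
        simp
    rw [h1]
    exact Subgroup.mul_mem _ (Subgroup.mem_sup_left ⟨_, rfl⟩) (Subgroup.mem_sup_right ⟨_, rfl⟩)

theorem diagAut_mem_VcV (v w : MulAut G) (h) : diagAut v w h ∈ VcV k G := by
  rw [VcV_eq_diagSubgroup]; exact ⟨_, _, _, rfl⟩

theorem homE_grp (a : (Subgroup.center G →* kˣ) →* Subgroup.center G) (χ : G →* kˣ) (y : G) :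
    homE k G a (grp χ y) = grp χ (a (χ.comp (Subgroup.center G).subtype) * y) := by
  change mapE a _ = _
  rw [grp_eq_sum_charVec (Subgroup.center G), map_sum, grp_eq_sum_charVec (Subgroup.center G)]
  simp only [map_smul, mapE_charVec]

theorem homE_charVec (a : (Subgroup.center G →* kˣ) →* Subgroup.center G) (x : G)
    (χ : Subgroup.center G →* kˣ) (y : G) :
    homE k G a (charVec _ x χ y) = charVec _ x χ (a χ * y) := mapE_charVec a x χ y

theorem aPart_mul_homE (φ : HopfAut k G) (a : (Subgroup.center G →* kˣ) →* Subgroup.center G)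
    (χ : Subgroup.center G →* kˣ) :
    (aPart (φ * homE k G a) χ : G) = aPart φ χ * vPart φ (a χ) := by
  apply aPart_eq
  rw [HopfAut.mul_apply, homE_charVec, apply_charVec, mul_one, if_pos rfl, map_one, map_one]
  simpa using charVec_one_one_ne_zero χ

theorem glMap_one_mul_homE (φ : HopfAut k G) (a : (Subgroup.center G →* kˣ) →* Subgroup.center G)
    (y : G) : glMap (φ * homE k G a) (1, y) = glMap φ (1, y) := by
  rw [glMap_mul, glMap_eq (homE_grp a 1 y)]
  simp

theorem vPart_mul_homE (φ : HopfAut k G) (a : (Subgroup.center G →* kˣ) →* Subgroup.center G) :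
    vPart (φ * homE k G a) = vPart φ :=
  MonoidHom.ext fun y => congrArg Prod.snd (glMap_one_mul_homE φ a y)

theorem bPart_mul_homE (φ : HopfAut k G) (a : (Subgroup.center G →* kˣ) →* Subgroup.center G) :
    bPart (φ * homE k G a) = bPart φ :=
  MonoidHom.ext fun y => congrArg Prod.fst (glMap_one_mul_homE φ a y)

/-- If `a` is trivial then `u` and `v` are automorphisms, `u⁻¹` agrees with `v` modulo the centre by
`conj_uPart`, and `φ` is the product of the element of `B` given by `b ∘ v⁻¹` and the element
`e_x × y ↦ e_{u⁻¹(x)} × v(y)` of `V_c ⋊ V`. -/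
theorem exists_of_aPart_eq_one {φ : HopfAut k G} (h : aPart φ = 1) :
    ∃ (b : G →* (G →* kˣ)) (D : HopfAut k G), D ∈ VcV k G ∧ φ = homB k G (liftB b) * D ∧
      (bPart φ = 1 → b = 1) := by
  let v : MulAut G := MulEquiv.ofBijective _ (vPart_bijective_of_aPart h)
  let u : MulAut G := MulEquiv.ofBijective _ (uPart_bijective_of_aPart h)
  have hv : ∀ y, v y = vPart φ y := fun _ => rfl
  have hu : ∀ y, u y = uPart φ y := fun _ => rfl
  have hc : ∀ g, u⁻¹ g * (v g)⁻¹ ∈ Subgroup.center G := by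
    intro g
    rw [Subgroup.mem_center_iff]
    intro s
    apply u.injective
    have h1 : ∀ x, g * x * g⁻¹ = u (v g) * x * (u (v g))⁻¹ := by
      intro x
      have := conj_uPart φ g (u⁻¹ x)
      rw [← hu, ← hu, ← hv] at this
      simpa only [map_mul, MulAut.apply_inv_self, map_inv] using this
    have h2 : g * u (v g) = u (v g) * g := by
      have := h1 (u (v g))
      rwa [mul_inv_cancel_right, mul_inv_eq_iff_eq_mul] at this
    have h3 := h1 ((u (v g))⁻¹ * u s)
    rw [mul_inv_cancel_left, mul_inv_eq_iff_eq_mul] at h3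
    simp only [map_mul, MulAut.apply_inv_self, map_inv]
    rw [mul_assoc g, h3, mul_assoc (u s)]
    congr 1
    rw [mul_inv_eq_iff_eq_mul, mul_assoc, h2, inv_mul_cancel_left]
  refine ⟨(bPart φ).comp (v⁻¹ : MulAut G).toMonoidHom, diagAut u⁻¹ v hc, diagAut_mem_VcV _ _ _,
    ?_, ?_⟩
  · refine HopfAut.ext_e fun x y => ?_
    rw [HopfAut.mul_apply, diagAut_e]
    change _ = autB (liftB _) _
    rw [autB_liftB_e]
    ext s t
    rw [apply_e_of_aPart h, smul_apply, e_apply, hv]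
    have h1 : s = u⁻¹ x ↔ x = uPart φ s := by
      rw [← hu]
      constructor
      · rintro rfl; simp
      · rintro rfl; simp
    by_cases h2 : t = vPart φ y ∧ x = uPart φ s
    · rw [if_pos h2, if_pos ⟨h1.2 h2.2, h2.1⟩, mul_one]
      have h3 : v⁻¹ (vPart φ y) = y := v.symm_apply_apply y
      have h4 : s = u⁻¹ x := h1.2 h2.2
      simp only [MonoidHom.comp_apply, MulEquiv.coe_toMonoidHom, h3, h4]
    · rw [if_neg h2, if_neg (fun h => h2 ⟨h.2, h1.1 h.1⟩), mul_zero]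
  · intro hb
    rw [hb, MonoidHom.one_comp]

variable (k G) in
/-- The automorphisms that cover an automorphism of `G` under `ε ⊗ id : DG → kG`. -/
def upperSubgroup : Subgroup (HopfAut k G) where
  carrier := {φ | ∃ v : MulAut G, ∀ F t, φ F (1, v t) = F (1, t)}
  one_mem' := ⟨1, fun _ _ => rfl⟩
  mul_mem' := by
    rintro φ ψ ⟨v, hv⟩ ⟨w, hw⟩
    exact ⟨v * w, fun F t => by rw [HopfAut.mul_apply, MulAut.mul_apply, hv, hw]⟩
  inv_mem' := by
    rintro φ ⟨v, hv⟩
    refine ⟨v⁻¹, fun F t => ?_⟩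
    have h := hv (φ⁻¹ F) (v⁻¹ t)
    rw [MulAut.apply_inv_self, ← HopfAut.mul_apply, mul_inv_cancel, HopfAut.one_apply] at h
    exact h.symm

theorem VcVB_le_upperSubgroup : VcVB k G ≤ upperSubgroup k G := by
  refine sup_le ?_ ?_
  · rw [VcV_eq_diagSubgroup]
    rintro _ ⟨v, w, h, rfl⟩
    refine ⟨w, fun F t => ?_⟩
    rw [eq_sum_e F, map_sum, sum_apply, sum_apply]
    simp only [map_smul, diagAut_e, smul_apply, e_apply, EmbeddingLike.apply_eq_iff_eq]
    have h1 : ∀ x, 1 = v x ↔ 1 = x := fun x => by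
      rw [eq_comm, EmbeddingLike.map_eq_one_iff, eq_comm]
    simp only [h1]
  · rintro _ ⟨b, rfl⟩
    refine ⟨1, fun F t => ?_⟩
    obtain ⟨b, rfl⟩ := exists_eq_liftB b
    change autB _ _ _ = _
    rw [eq_sum_e F, map_sum, sum_apply, sum_apply]
    simp only [map_smul, autB_liftB_e, smul_apply, e_apply]
    refine Finset.sum_congr rfl fun p _ => ?_
    by_cases h : 1 = p.1
    · simp [← h]
    · simp [h]

/-- The upper triangular automorphisms are those with `a = 1`. -/
theorem mem_VcVB_iff {φ : HopfAut k G} : φ ∈ VcVB k G ↔ aPart φ = 1 := by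
  constructor
  · intro h
    obtain ⟨v, hv⟩ := VcVB_le_upperSubgroup h
    ext χ
    rw [MonoidHom.one_apply, OneMemClass.coe_one]
    apply aPart_eq
    have := hv (charVec _ 1 χ 1) 1
    rw [map_one] at this
    rw [this]
    exact charVec_one_one_ne_zero χ
  · intro h
    obtain ⟨b, D, hD, rfl, -⟩ := exists_of_aPart_eq_one h
    exact Subgroup.mul_mem _ (Subgroup.mem_sup_right ⟨_, rfl⟩) (Subgroup.mem_sup_left hD)

theorem mem_VcV_of {φ : HopfAut k G} (ha : aPart φ = 1) (hb : bPart φ = 1) : φ ∈ VcV k G := by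
  obtain ⟨b, D, hD, rfl, h⟩ := exists_of_aPart_eq_one ha
  rw [h hb, liftB_one, map_one, one_mul]
  exact hD

/-- If `v` is invertible, the entry `a` can be cleared by an element of `E` on the right. -/
theorem exists_aPart_mul_homE_eq_one {φ : HopfAut k G} (h : Function.Bijective (vPart φ)) :
    ∃ a, aPart (φ * homE k G a) = 1 := by
  let v : MulAut G := MulEquiv.ofBijective _ h
  refine ⟨MonoidHom.mk' (fun χ => (centerAut v⁻¹ (aPart φ χ))⁻¹) fun χ χ' => ?_, ?_⟩
  · rw [map_mul, map_mul, mul_inv_rev]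
    exact Subtype.ext (Subgroup.mem_center_iff.1 (Subtype.property _) _)
  · ext χ
    rw [aPart_mul_homE]
    have : vPart φ ((centerAut v⁻¹ (aPart φ χ) : Subgroup.center G) : G) = aPart φ χ :=
      v.apply_symm_apply _
    simp [this]

variable (k G) in
/-- The automorphisms that preserve the subalgebra `kG` of `DG`. -/
def lowerSubgroup : Subgroup (HopfAut k G) where
  carrier := {φ | ∃ v : MulAut G, ∀ y, φ (grp 1 y) = grp 1 (v y)}
  one_mem' := ⟨1, fun _ => rfl⟩
  mul_mem' := by
    rintro φ ψ ⟨v, hv⟩ ⟨w, hw⟩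
    exact ⟨v * w, fun t => by rw [HopfAut.mul_apply, MulAut.mul_apply, hw, hv]⟩
  inv_mem' := by
    rintro φ ⟨v, hv⟩
    refine ⟨v⁻¹, fun t => ?_⟩
    have := hv (v⁻¹ t)
    rw [MulAut.apply_inv_self] at this
    rw [← this, ← HopfAut.mul_apply, inv_mul_cancel, HopfAut.one_apply]

theorem VcVE_le_lowerSubgroup : VcVE k G ≤ lowerSubgroup k G := by
  refine sup_le ?_ ?_
  · rw [VcV_eq_diagSubgroup]
    rintro _ ⟨v, w, h, rfl⟩
    exact ⟨w, fun y => by rw [diagAut_grp, MonoidHom.one_comp]⟩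
  · rintro _ ⟨a, rfl⟩
    exact ⟨1, fun y => by rw [homE_grp]; simp⟩

/-- The lower triangular automorphisms are those with `b = 1`. -/
theorem mem_VcVE_iff {φ : HopfAut k G} : φ ∈ VcVE k G ↔ bPart φ = 1 := by
  constructor
  · intro h
    obtain ⟨v, hv⟩ := VcVE_le_lowerSubgroup h
    ext1 y
    exact bPart_eq (hv y)
  · intro h
    obtain ⟨a, ha⟩ := exists_aPart_mul_homE_eq_one (vPart_bijective_of_bPart h)
    have h1 := mem_VcV_of ha ((bPart_mul_homE φ a).trans h)
    rw [← mul_inv_cancel_right φ (homE k G a)]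
    exact Subgroup.mul_mem _ (Subgroup.mem_sup_left h1)
      (Subgroup.mem_sup_right (Subgroup.inv_mem _ ⟨_, rfl⟩))

theorem mem_VcV_iff {φ : HopfAut k G} : φ ∈ VcV k G ↔ aPart φ = 1 ∧ bPart φ = 1 :=
  ⟨fun h => ⟨mem_VcVB_iff.1 (Subgroup.mem_sup_left h), mem_VcVE_iff.1 (Subgroup.mem_sup_left h)⟩,
    fun h => mem_VcV_of h.1 h.2⟩

/-- Gauss elimination of the entry `a`. -/
theorem exists_mem_VcVB_mul_mem_E {φ : HopfAut k G} (h : Function.Bijective (vPart φ)) :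
    ∃ x ∈ VcVB k G, ∃ a ∈ E k G, φ = x * a := by
  obtain ⟨a, ha⟩ := exists_aPart_mul_homE_eq_one h
  exact ⟨_, mem_VcVB_iff.2 ha, (homE k G a)⁻¹, Subgroup.inv_mem _ ⟨_, rfl⟩,
    (mul_inv_cancel_right _ _).symm⟩

/-- Gauss elimination of the entry `b`. -/
theorem exists_mem_B_mul_mem_VcVE {φ : HopfAut k G} (h : Function.Bijective (vPart φ)) :
    ∃ b ∈ B k G, ∃ y ∈ VcVE k G, φ = b * y := by
  let v : MulAut G := MulEquiv.ofBijective _ h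
  let β := (bPart φ).comp (v⁻¹ : MulAut G).toMonoidHom
  refine ⟨homB k G (liftB β⁻¹)⁻¹, ⟨_, rfl⟩, homB k G (liftB β⁻¹) * φ, ?_, by simp⟩
  rw [mem_VcVE_iff]
  ext1 y
  have h1 : v⁻¹ (vPart φ y) = y := v.symm_apply_apply y
  refine bPart_eq (t := vPart φ y) ?_
  rw [HopfAut.mul_apply, apply_grp_one]
  refine (autB_liftB_grp _ _ _).trans ?_
  congr 1
  ext x
  simp only [β, MonoidHom.inv_apply, MonoidHom.comp_apply,
    MulEquiv.coe_toMonoidHom, h1, mul_inv_cancel, MonoidHom.one_apply]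

theorem homV_injective : Function.Injective (homV k G) := by
  intro v w h
  ext g
  have h1 : homV k G v (grp 1 g) = homV k G w (grp 1 g) := by rw [h]
  rw [homV_eq, homV_eq, diagAut_grp, diagAut_grp] at h1
  exact (grp_injective h1).2

theorem e_injective {x y x' y' : G} (h : (e x y : DrinfeldDouble k G) = e x' y') :
    x = x' ∧ y = y' := by
  have := congrFun h (x, y)
  rw [e_apply, e_apply, if_pos ⟨rfl, rfl⟩] at this
  by_contra hne
  rw [if_neg hne] at this
  exact one_ne_zero this

theorem homVc_injective : Function.Injective (homVc k G) := by
  intro v w h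
  ext g
  have h1 : homVc k G v (e g 1) = homVc k G w (e g 1) := by rw [h]
  rw [homVc_eq, homVc_eq, diagAut_e, diagAut_e] at h1
  exact (e_injective h1).1

theorem homB_injective : Function.Injective (homB k G) := by
  intro b b' h
  obtain ⟨b, rfl⟩ := exists_eq_liftB b
  obtain ⟨b', rfl⟩ := exists_eq_liftB b'
  congr 1
  ext1 y
  have h1 : homB k G (liftB b) (grp 1 y) = homB k G (liftB b') (grp 1 y) := by rw [h]
  rw [homB_apply, homB_apply, autB_liftB_grp, autB_liftB_grp, one_mul_char, one_mul_char] at h1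
  exact (grp_injective h1).1

theorem aPart_homE (a : (Subgroup.center G →* kˣ) →* Subgroup.center G) :
    aPart (homE k G a) = a := by
  ext χ
  apply aPart_eq
  rw [homE_charVec, mul_one, charVec_apply_congr _ _ _ _ 1]
  exact charVec_one_one_ne_zero χ

theorem homE_injective : Function.Injective (homE k G) :=
  Function.LeftInverse.injective aPart_homE

theorem V_le_normalizer_Vc : V k G ≤ Subgroup.normalizer (Vc k G : Set (HopfAut k G)) := by
  refine le_normalizer_of_conj_mem ?_
  rintro _ ⟨w, rfl⟩ _ ⟨⟨v, hv⟩, rfl⟩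
  rw [← map_inv]
  refine ⟨⟨w * v * w⁻¹, fun g => ?_⟩, HopfAut.ext_e fun x y => ?_⟩
  · have h1 := (centerAut w ⟨_, hv (w⁻¹ g)⟩).2
    have h2 : ((centerAut w ⟨_, hv (w⁻¹ g)⟩ : Subgroup.center G) : G) =
        w (v (w⁻¹ g) * (w⁻¹ g)⁻¹) := rfl
    rw [h2] at h1
    simpa using h1
  · simp only [HopfAut.mul_apply, homV_eq, homVc_eq, diagAut_e]
    simp

theorem disjoint_Vc_V : Disjoint (Vc k G) (V k G) := by
  rw [Subgroup.disjoint_def]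
  rintro _ ⟨v, rfl⟩ ⟨w, h⟩
  rw [homV_eq, homVc_eq] at h
  have h2 : ∀ x, (v : MulAut G) x = x := by
    intro x
    have h3 := congrArg (fun φ : HopfAut k G => φ (e x x)) h
    simp only [diagAut_e] at h3
    have := e_injective h3
    rw [← this.1, this.2]; rfl
  rw [show v = 1 from Subtype.ext (MulEquiv.ext h2), map_one]

theorem VcV_le_normalizer_B : VcV k G ≤ Subgroup.normalizer (B k G : Set (HopfAut k G)) := by
  rw [VcV_eq_diagSubgroup]
  refine le_normalizer_of_conj_mem ?_
  rintro _ ⟨v, w, h, rfl⟩ _ ⟨b, rfl⟩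
  obtain ⟨b, rfl⟩ := exists_eq_liftB b
  refine ⟨liftB (MonoidHom.mk' (fun y => (b (w⁻¹ y)).comp (v⁻¹ : MulAut G).toMonoidHom)
    fun y y' => by ext; simp), HopfAut.ext_e fun x y => ?_⟩
  rw [HopfAut.mul_apply, HopfAut.mul_apply, homB_apply, homB_apply, diagAut_inv_apply_e,
    autB_liftB_e, autB_liftB_e, map_smul, diagAut_e]
  simp

theorem disjoint_VcV_B : Disjoint (VcV k G) (B k G) := by
  rw [VcV_eq_diagSubgroup, Subgroup.disjoint_def]
  rintro _ ⟨v, w, h, rfl⟩ ⟨b, hb⟩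
  obtain ⟨b, rfl⟩ := exists_eq_liftB b
  have h1 : b = 1 := by
    ext1 y
    have h2 := congrArg (fun φ : HopfAut k G => φ (grp 1 y)) hb
    rw [diagAut_grp] at h2
    have h3 := grp_injective ((autB_liftB_grp b 1 y).symm.trans h2)
    rw [← one_mul_char (b y), h3.1]; rfl
  rw [← hb, h1, liftB_one, map_one]

theorem VcV_le_normalizer_E : VcV k G ≤ Subgroup.normalizer (E k G : Set (HopfAut k G)) := by
  rw [VcV_eq_diagSubgroup]
  refine le_normalizer_of_conj_mem ?_
  rintro _ ⟨v, w, h, rfl⟩ _ ⟨a, rfl⟩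
  let a' : (Subgroup.center G →* kˣ) →* Subgroup.center G :=
    MonoidHom.mk' (fun χ => centerAut w (a (χ.comp (centerAut v).toMonoidHom)))
      fun χ χ' => by rw [MonoidHom.mul_comp, map_mul, map_mul]
  refine ⟨a', ?_⟩
  rw [eq_mul_inv_iff_mul_eq]
  have h1 : ∀ x χ y, (homE k G a' * diagAut v w h : HopfAut k G)
      (charVec (Subgroup.center G) x χ y) =
      (diagAut v w h * homE k G a : HopfAut k G) (charVec (Subgroup.center G) x χ y) := by
    intro x χ y
    rw [HopfAut.mul_apply, HopfAut.mul_apply, diagAut_charVec, homE_charVec, homE_charVec,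
      diagAut_charVec, map_mul]
    have h2 : (χ.comp (centerAut v⁻¹).toMonoidHom).comp (centerAut v).toMonoidHom = χ := by
      ext z
      have : centerAut v⁻¹ (centerAut v z) = z := Subtype.ext (v.symm_apply_apply z)
      simp [this]
    simp only [a', MonoidHom.mk'_apply, h2]
    rfl
  refine HopfAut.ext_e fun x y => ?_
  rw [← sum_charVec (le_refl (Subgroup.center G)), map_sum, map_sum]
  exact Finset.sum_congr rfl fun χ _ => h1 x χ y

theorem disjoint_VcV_E : Disjoint (VcV k G) (E k G) := by
  rw [Subgroup.disjoint_def]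
  rintro _ h ⟨a, rfl⟩
  have := (mem_VcV_iff.1 h).1
  rw [aPart_homE] at this
  rw [this, map_one]

end Subgroups

/-! ### Cancellation of direct factors of finite groups -/

section Cancellation

theorem finite_monoidHom (X Y : Type*) [Group X] [Group Y] [Finite X] [Finite Y] :
    Finite (X →* Y) := DFunLike.finite _

open scoped Classical in
/-- A homomorphism from `X ⧸ N` to `Y` is a homomorphism from `X` to `Y` whose kernel contains
`N`. -/
theorem card_quotient_hom {X Y : Type*} [Group X] [Group Y] [Finite X] [Finite Y]
    [Fintype (Subgroup X)] (N : Subgroup X) [N.Normal] :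
    Nat.card (X ⧸ N →* Y) = Nat.card {f : X →* Y // f.ker = N} +
      ∑ K ∈ Finset.univ.filter (N < ·), Nat.card {f : X →* Y // f.ker = K} := by
  have := finite_monoidHom X Y
  have h1 : Nat.card (X ⧸ N →* Y) = Nat.card {f : X →* Y // N ≤ f.ker} := Nat.card_congr
    { toFun := fun g => ⟨g.comp (QuotientGroup.mk' N), fun x hx => by
        simp [MonoidHom.mem_ker, (QuotientGroup.eq_one_iff x).2 hx]⟩
      invFun := fun f => QuotientGroup.lift N f.1 f.2
      left_inv := fun g => by ext; rfl
      right_inv := fun f => rfl }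
  have h2 : Nat.card {f : X →* Y // N ≤ f.ker} =
      ∑ K ∈ Finset.univ.filter (N ≤ ·), Nat.card {f : X →* Y // f.ker = K} := by
    have : Fintype (X →* Y) := Fintype.ofFinite _
    simp only [Nat.card_eq_fintype_card, Fintype.card_subtype]
    rw [Finset.card_eq_sum_card_fiberwise (f := MonoidHom.ker) (t := Finset.univ.filter (N ≤ ·))
      (fun f hf => by simpa using hf)]
    refine Finset.sum_congr rfl fun K hK => congrArg Finset.card ?_
    ext f
    simp only [Finset.mem_filter, Finset.mem_univ, true_and] at hK ⊢
    exact ⟨fun h => h.2, fun h => ⟨h ▸ hK, h⟩⟩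
  have h3 : Finset.univ.filter (N ≤ ·) = insert N (Finset.univ.filter (N < ·)) := by
    ext K
    simp only [Finset.mem_filter, Finset.mem_univ, true_and, Finset.mem_insert]
    rw [le_iff_eq_or_lt, eq_comm]
  rw [h1, h2, h3, Finset.sum_insert (by simp)]

/-- The numbers of homomorphisms from the quotients of `X` to a finite group determine the number
of embeddings of `X`. -/
theorem card_embedding_eq {A B : Type*} [Group A] [Group B] [Finite A] [Finite B]
    {X : Type*} [Group X] [Finite X]
    (h : ∀ N : Subgroup X, ∀ [N.Normal], Nat.card (X ⧸ N →* A) = Nat.card (X ⧸ N →* B)) :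
    Nat.card {f : X →* A // f.ker = ⊥} = Nat.card {f : X →* B // f.ker = ⊥} := by
  classical
  have : Fintype (Subgroup X) := Fintype.ofFinite _
  have key : ∀ N : Subgroup X,
      Nat.card {f : X →* A // f.ker = N} = Nat.card {f : X →* B // f.ker = N} := by
    intro N
    induction N using WellFoundedGT.induction with
    | ind N ih =>
      by_cases hn : N.Normal
      · have h1 := h N
        rw [card_quotient_hom, card_quotient_hom] at h1
        rw [Finset.sum_congr rfl fun K hK => ih K (by simpa using hK)] at h1
        exact Nat.add_right_cancel h1
      · have hA : IsEmpty {f : X →* A // f.ker = N} := ⟨fun f => hn (f.2 ▸ f.1.normal_ker)⟩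
        have hB : IsEmpty {f : X →* B // f.ker = N} := ⟨fun f => hn (f.2 ▸ f.1.normal_ker)⟩
        rw [Nat.card_of_isEmpty, Nat.card_of_isEmpty]
  exact key ⊥

theorem nonempty_mulEquiv_of_card_hom {A B : Type*} [Group A] [Group B] [Finite A] [Finite B]
    (hc : Nat.card A = Nat.card B)
    (h : ∀ N : Subgroup A, ∀ [N.Normal], Nat.card (A ⧸ N →* A) = Nat.card (A ⧸ N →* B)) :
    Nonempty (A ≃* B) := by
  have h1 := card_embedding_eq h
  have := finite_monoidHom A A
  have h2 : 0 < Nat.card {f : A →* A // f.ker = ⊥} := by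
    have : Nonempty {f : A →* A // f.ker = ⊥} := ⟨⟨MonoidHom.id A, by ext; simp⟩⟩
    exact Nat.card_pos
  rw [h1] at h2
  obtain ⟨⟨f, hf⟩⟩ := (Nat.card_pos_iff.1 h2).1
  exact ⟨MulEquiv.ofBijective f ((Nat.bijective_iff_injective_and_card f).2
    ⟨(MonoidHom.ker_eq_bot_iff f).1 hf, hc⟩)⟩

theorem card_hom_prod (X Y Z : Type*) [Group X] [Group Y] [Group Z] :
    Nat.card (X →* Y × Z) = Nat.card (X →* Y) * Nat.card (X →* Z) := by
  rw [← Nat.card_prod]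
  exact Nat.card_congr
    { toFun := fun f => ((MonoidHom.fst _ _).comp f, (MonoidHom.snd _ _).comp f)
      invFun := fun f => f.1.prod f.2
      left_inv := fun f => by ext <;> rfl
      right_inv := fun f => by ext <;> rfl }

/-- Finite direct factors cancel (Lovász): for every finite `X` the numbers of homomorphisms from
`X` to `A` and to `B` agree. -/
theorem nonempty_mulEquiv_of_prod {A B C D : Type*} [Group A] [Group B] [Group C] [Group D]
    [Finite A] [Finite B] [Finite C] (i : A × C ≃* B × D) (j : C ≃* D) : Nonempty (A ≃* B) := by
  let i' : A × C ≃* B × C := i.trans ((MulEquiv.refl B).prodCongr j.symm)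
  refine nonempty_mulEquiv_of_card_hom ?_ fun N _ => ?_
  · have := Nat.card_congr i'.toEquiv
    rw [Nat.card_prod, Nat.card_prod] at this
    exact Nat.eq_of_mul_eq_mul_right Nat.card_pos this
  · have h1 : Nat.card (A ⧸ N →* A × C) = Nat.card (A ⧸ N →* B × C) := Nat.card_congr
      { toFun := fun f => i'.toMonoidHom.comp f
        invFun := fun f => i'.symm.toMonoidHom.comp f
        left_inv := fun f => MonoidHom.ext fun x => i'.symm_apply_apply _
        right_inv := fun f => MonoidHom.ext fun x => i'.apply_symm_apply _ }
    rw [card_hom_prod, card_hom_prod] at h1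
    have := finite_monoidHom (A ⧸ N) C
    exact Nat.eq_of_mul_eq_mul_right Nat.card_pos h1

end Cancellation

/-! ### Central idempotents and the radical decomposition of an endomorphism -/

section Radical

/-- Every element of a finite monoid has an idempotent power. -/
theorem exists_pow_mul_pow_eq {M : Type*} [Monoid M] [Finite M] (x : M) :
    ∃ n, 0 < n ∧ x ^ n * x ^ n = x ^ n := by
  obtain ⟨i, j, hij, h⟩ : ∃ i j, i < j ∧ x ^ i = x ^ j := by
    obtain ⟨i, j, hne, h⟩ := Finite.exists_ne_map_eq_of_infinite fun n : ℕ => x ^ n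
    rcases lt_or_gt_of_ne hne with h' | h'
    · exact ⟨i, j, h', h⟩
    · exact ⟨j, i, h', h.symm⟩
  obtain ⟨p, rfl⟩ := Nat.exists_eq_add_of_lt hij
  have h1 : ∀ m, x ^ (i + m) = x ^ (i + m + (p + 1)) := by
    intro m
    rw [pow_add, h, ← pow_add]; congr 1; omega
  have h2 : ∀ q m, x ^ (i + m) = x ^ (i + m + q * (p + 1)) := by
    intro q
    induction q with
    | zero => intro m; simp
    | succ q ih =>
      intro m
      rw [ih, add_assoc, h1]; congr 1; ring
  refine ⟨(i + 1) * (p + 1), by positivity, ?_⟩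
  rw [← pow_add]
  have h3 : (i + 1) * (p + 1) = i + (i * p + p + 1) := by ring
  have := h2 (i + 1) (i * p + p + 1)
  rw [← h3] at this
  exact this.symm

variable {k G : Type*} [Field k] [Group G]

/-- An endomorphism `ν` is nilpotent. -/
def IsNilpotentEnd {C : Type*} [Group C] (ν : C →* C) : Prop := ∃ n : ℕ, ∀ c : C, ν^[n] c = 1

/-- An endomorphism `ν` is radical if `Y ∘ ν` is nilpotent for every endomorphism `Y`. For finite
abelian groups this says that `ν` lies in the Jacobson radical of the endomorphism ring. -/
def IsRadicalEnd {C : Type*} [Group C] (ν : C →* C) : Prop :=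
  ∀ Y : C →* C, IsNilpotentEnd (Y.comp ν)

theorem isNilpotentEnd_one {C : Type*} [Group C] : IsNilpotentEnd (1 : C →* C) :=
  ⟨1, fun _ => rfl⟩

theorem IsNilpotentEnd.eq_one {C : Type*} [Group C] {ν : C →* C} (h : IsNilpotentEnd ν) {c : C}
    (hc : ν c = c) : c = 1 := by
  obtain ⟨n, hn⟩ := h
  rw [← hn c, Function.iterate_fixed hc]

theorem IsRadicalEnd.isNilpotentEnd {C : Type*} [Group C] {ν : C →* C} (h : IsRadicalEnd ν) :
    IsNilpotentEnd ν := h (MonoidHom.id C)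

theorem ker_le_center (e : G →* G) (hz : ∀ g, g * (e g)⁻¹ ∈ Subgroup.center G) {c : G}
    (hc : c ∈ e.ker) : c ∈ Subgroup.center G := by
  have := hz c
  rwa [MonoidHom.mem_ker.1 hc, inv_one, mul_one] at this

/-- The decomposition `G = e(G) × ker e` attached to an idempotent endomorphism `e` of `G` that is
the identity modulo the centre. -/
def ofIdem (e : G →* G) (he : ∀ g, e (e g) = e g)
    (hz : ∀ g, g * (e g)⁻¹ ∈ Subgroup.center G) (δ : e.ker ≃* (e.ker →* kˣ)) (ν : e.ker →* e.ker)
    (hν : IsNilpotentEnd ν) :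
    TwistedReflection k G where
  H := e.range
  C := e.ker
  comm := fun a ha b _ => (Subgroup.mem_center_iff.1 (ker_le_center e hz ha) b).symm
  commute := fun h _ c hc => Subgroup.mem_center_iff.1 (ker_le_center e hz hc) h
  complement := by
    rw [Subgroup.isComplement'_def, Subgroup.isComplement_iff_existsUnique]
    intro g
    have hg : (e g)⁻¹ * g ∈ e.ker := by
      rw [MonoidHom.mem_ker, map_mul, map_inv, he, inv_mul_cancel]
    refine ⟨(⟨e g, ⟨g, rfl⟩⟩, ⟨_, hg⟩), by simp, ?_⟩
    rintro ⟨⟨_, ⟨x, rfl⟩⟩, ⟨c, hc⟩⟩ h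
    have hc' : e c = 1 := hc
    have h' : e x * c = g := h
    have h1 : e g = e x := by rw [← h', map_mul, he, hc', mul_one]
    have h2 : c = (e g)⁻¹ * g := by rw [h1, ← h']; group
    ext
    · exact h1.symm
    · exact h2
  δ := δ
  ν := ν
  nilpotent := hν

theorem projH_eq (d : TwistedReflection k G) {h c g : G} (hh : h ∈ d.H) (hc : c ∈ d.C)
    (hg : g = h * c) : (d.projH g : G) = h := by
  subst hg
  exact congrArg Subtype.val (d.proj_mul ⟨h, hh⟩ ⟨c, hc⟩).1

theorem projC_eq (d : TwistedReflection k G) {h c g : G} (hh : h ∈ d.H) (hc : c ∈ d.C)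
    (hg : g = h * c) : (d.projC g : G) = c := by
  subst hg
  exact congrArg Subtype.val (d.proj_mul ⟨h, hh⟩ ⟨c, hc⟩).2

theorem projH_ofIdem (e : G →* G) (he hz) (δ : e.ker ≃* (e.ker →* kˣ)) (ν hν) (g : G) :
    ((ofIdem e he hz δ ν hν).projH g : G) = e g := by
  refine projH_eq _ (c := (e g)⁻¹ * g) ⟨g, rfl⟩ ?_ (by group)
  change _ ∈ e.ker
  rw [MonoidHom.mem_ker, map_mul, map_inv, he, inv_mul_cancel]

variable [Finite G]

/-- A finite abelian group is isomorphic to its dual. Commutativity is a hypothesis rather than an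
instance, since the groups to which this is applied are subgroups of `G`. -/
theorem exists_dual [IsAlgClosed k] [CharZero k] {C : Type*} [Group C] [Finite C]
    (hC : ∀ a b : C, a * b = b * a) : Nonempty (C ≃* (C →* kˣ)) := by
  let _ : CommGroup C := { (inferInstance : Group C) with mul_comm := hC }
  have : NeZero (Monoid.exponent C : k) :=
    ⟨Nat.cast_ne_zero.2 Monoid.exponent_ne_zero_of_finite⟩
  have : NeZero ((Monoid.exponent C : ℕ)) := ⟨Monoid.exponent_ne_zero_of_finite⟩
  exact ⟨(CommGroup.monoidHom_mulEquiv_of_hasEnoughRootsOfUnity C k).some.symm⟩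

/-- The characters of a finite abelian group separate its elements. -/
theorem eq_one_of_forall_char [IsAlgClosed k] [CharZero k] {C : Type*} [Group C] [Finite C]
    (hC : ∀ a b : C, a * b = b * a) {c : C} (hc : ∀ χ : C →* kˣ, χ c = 1) : c = 1 := by
  let _ : CommGroup C := { (inferInstance : Group C) with mul_comm := hC }
  have : NeZero (Monoid.exponent C : k) :=
    ⟨Nat.cast_ne_zero.2 Monoid.exponent_ne_zero_of_finite⟩
  have : NeZero ((Monoid.exponent C : ℕ)) := ⟨Monoid.exponent_ne_zero_of_finite⟩
  exact (CommGroup.forall_apply_eq_apply_iff C (M := k)).1 fun φ => by rw [hc, map_one]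

theorem End_mul_apply (f g : Monoid.End G) (x : G) : (f * g) x = f (g x) := rfl

theorem pow_mul_inv_mem_center {f : Monoid.End G}
    (hf : ∀ g, g * (f g)⁻¹ ∈ Subgroup.center G) (n : ℕ) (g : G) :
    g * ((f ^ n) g)⁻¹ ∈ Subgroup.center G := by
  induction n with
  | zero => simp
  | succ n ih =>
    have : g * ((f ^ (n + 1)) g)⁻¹ = (g * ((f ^ n) g)⁻¹) * ((f ^ n) g * (f ((f ^ n) g))⁻¹) := by
      rw [pow_succ', End_mul_apply]; group
    rw [this]
    exact Subgroup.mul_mem _ ih (hf _)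

/-- Fitting's lemma in the form needed here. Among the pairs of decompositions of the source and
the target of `v` that come from idempotent powers of `X ∘ v` and `v ∘ X`, the one with
the largest summand on which `v` is invertible has `v` radical on the complementary summand; by
cancellation the complementary summands of the source and of the target are isomorphic, so that
after an automorphism `w` of the target the two decompositions agree. -/
theorem exists_radical_decomposition [IsAlgClosed k] [CharZero k] (v X : G →* G)
    (h₁ : ∀ g, g * (X (v g))⁻¹ ∈ Subgroup.center G)
    (h₂ : ∀ g, g * (v (X g))⁻¹ ∈ Subgroup.center G) :
    ∃ (d : TwistedReflection k G) (w : MulAut G),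
      (∀ g, w (v g) = d.projH g * d.ν (d.projC g)) ∧ IsRadicalEnd d.ν := by
  have hfin : Finite (Monoid.End G) := finite_monoidHom G G
  let V : Monoid.End G := v
  -- idempotent powers of `X ∘ v`, for `X` inverse to `v` modulo the centre, that come with an
  -- idempotent power of `v ∘ X` of the same exponent
  let S : Set (Monoid.End G) := {e | e * e = e ∧ ∃ (X : Monoid.End G) (n : ℕ), 0 < n ∧
    (X * V) ^ n = e ∧ (V * X) ^ n * (V * X) ^ n = (V * X) ^ n ∧
    (∀ g, g * ((X * V) g)⁻¹ ∈ Subgroup.center G) ∧ ∀ g, g * ((V * X) g)⁻¹ ∈ Subgroup.center G}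
  have hS : ∀ X : Monoid.End G, (∀ g, g * ((X * V) g)⁻¹ ∈ Subgroup.center G) →
      (∀ g, g * ((V * X) g)⁻¹ ∈ Subgroup.center G) → ∃ n, (X * V) ^ n ∈ S := by
    intro X h₁ h₂
    obtain ⟨n, hn, h⟩ := exists_pow_mul_pow_eq ((X * V, V * X) : Monoid.End G × Monoid.End G)
    have h3 := congrArg Prod.fst h
    have h4 := congrArg Prod.snd h
    exact ⟨n, h3, X, n, hn, rfl, h4, h₁, h₂⟩
  obtain ⟨e₀, ⟨he₀, X, n, hn, hXe, hidem, h₁, h₂⟩, hmax⟩ := Set.exists_max_image S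
    (fun e => Nat.card (MonoidHom.range e)) (Set.toFinite S) (by
      obtain ⟨n, hn⟩ := hS X h₁ h₂; exact ⟨_, hn⟩)
  let e : G →* G := e₀
  let e' : G →* G := (V * X) ^ n
  have he : ∀ g, e (e g) = e g := fun g => DFunLike.congr_fun he₀ g
  have he' : ∀ g, e' (e' g) = e' g := fun g => DFunLike.congr_fun hidem g
  have hz : ∀ g, g * (e g)⁻¹ ∈ Subgroup.center G := by
    intro g
    have := pow_mul_inv_mem_center h₁ n g
    rwa [hXe] at this
  have hz' : ∀ g, g * (e' g)⁻¹ ∈ Subgroup.center G := pow_mul_inv_mem_center h₂ n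
  have hve : ∀ g, v (e g) = e' (v g) := by
    intro g
    have h3 : ∀ m : ℕ, V * (X * V) ^ m = (V * X) ^ m * V := by
      intro m
      induction m with
      | zero => simp
      | succ m ih => rw [pow_succ, ← mul_assoc, ih, pow_succ, mul_assoc, mul_assoc, mul_assoc]
    have h3 := h3 n
    rw [hXe] at h3
    exact DFunLike.congr_fun h3 g
  -- the idempotents factor through `v` on the right and on the left, respectively; this makes `v`
  -- bijective between their images
  obtain ⟨m, rfl⟩ : ∃ m, n = m + 1 := ⟨n - 1, by omega⟩
  have heX : ∀ g, e g = ((X * V) ^ m * X) (v g) := by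
    intro g
    have h3 : e₀ = (X * V) ^ m * X * V := by rw [← hXe, pow_succ, mul_assoc]
    exact DFunLike.congr_fun h3 g
  have heX' : ∀ g, e' g = v ((X * (V * X) ^ m) g) := by
    intro g
    have h3 : (V * X) ^ (m + 1) = V * (X * (V * X) ^ m) := by rw [pow_succ', mul_assoc]
    exact DFunLike.congr_fun h3 g
  let s : e.range →* e'.range := (v.comp e.range.subtype).codRestrict _ (by
    rintro ⟨_, g, rfl⟩
    exact ⟨v g, (hve g).symm⟩)
  have hs : Function.Bijective s := by
    constructor
    · rw [injective_iff_map_eq_one]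
      rintro ⟨_, g, rfl⟩ h
      have h3 : v (e g) = 1 := congrArg Subtype.val h
      have h4 := heX (e g)
      rw [h3, map_one, he] at h4
      exact Subtype.ext h4
    · rintro ⟨_, g, rfl⟩
      refine ⟨⟨e ((X * (V * X) ^ m) g), ⟨_, rfl⟩⟩, Subtype.ext ?_⟩
      change v (e _) = e' g
      rw [hve, ← heX', he']
  let S' := MulEquiv.ofBijective s hs
  have hker : ∀ c ∈ e.ker, v c ∈ e'.ker := by
    intro c hc
    rw [MonoidHom.mem_ker, ← hve, MonoidHom.mem_ker.1 hc, map_one]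
  have hcomm : ∀ (f : G →* G), (∀ g, g * (f g)⁻¹ ∈ Subgroup.center G) →
      ∀ a b : f.ker, a * b = b * a := fun f hz a b => Subtype.ext
    (Subgroup.mem_center_iff.1 (ker_le_center f hz b.2) a)
  obtain ⟨δ⟩ := exists_dual (k := k) (hcomm e hz)
  obtain ⟨δ'⟩ := exists_dual (k := k) (hcomm e' hz')
  let d₀ : TwistedReflection k G := ofIdem e he hz δ 1 isNilpotentEnd_one
  let d₁ : TwistedReflection k G := ofIdem e' he' hz' δ' 1 isNilpotentEnd_one
  obtain ⟨κ⟩ : Nonempty (e.ker ≃* e'.ker) := by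
    refine nonempty_mulEquiv_of_prod (C := e.range) (D := e'.range) ?_ S'
    exact MulEquiv.prodComm.trans ((d₀.prodEquiv.trans d₁.prodEquiv.symm).trans MulEquiv.prodComm)
  let vC : e.ker →* e'.ker := (v.comp e.ker.subtype).codRestrict _ fun c => hker c c.2
  let ν : e.ker →* e.ker := κ.symm.toMonoidHom.comp vC
  let w : MulAut G := d₁.prodEquiv.symm.trans ((S'.symm.prodCongr κ.symm).trans d₀.prodEquiv)
  have hw : ∀ (h : e.range) (c : e.ker), w (v (h * c)) = h * ν c := by
    intro h c
    have h3 : v (h * c) = d₁.prodEquiv (s h, vC c) := map_mul v (h : G) (c : G)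
    rw [h3]
    change d₀.prodEquiv ((S'.symm.prodCongr κ.symm) (d₁.prodEquiv.symm (d₁.prodEquiv _))) = _
    rw [MulEquiv.symm_apply_apply]
    change ((S'.symm (s h) : e.range) : G) * (κ.symm (vC c) : e.ker) = _
    rw [show s h = S' h from rfl, MulEquiv.symm_apply_apply]
    rfl
  let pH : G →* e.range := d₀.projH
  let pC : G →* e.ker := d₀.projC
  have hp : ∀ g, (pH g : G) * (pC g : G) = g := fun g => d₀.projH_mul_projC g
  -- for an endomorphism `Y` of the kernel, `id × Y` yields a further member of `S`, whose image
  -- contains that of `e`; by maximality the images agree, which makes `Y ∘ ν` nilpotent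
  have hrad : IsRadicalEnd ν := by
    intro Y
    let Y' : Monoid.End G := MonoidHom.mk'
      (fun g => (pH g : G) * (Y (pC g) : e.ker)) fun a b => by
        rw [map_mul, map_mul, map_mul, Subgroup.coe_mul, Subgroup.coe_mul]
        have := Subgroup.mem_center_iff.1 (ker_le_center e hz (Y (pC a)).2) (pH b)
        rw [mul_assoc, mul_assoc, ← mul_assoc (pH b : G), this, mul_assoc]
    have hY' : ∀ (h : e.range) (c : e.ker), Y' (h * c) = h * Y c := by
      intro h c
      have h3 : pH (h * c) = h := (d₀.proj_mul h c).1
      have h4 : pC (h * c) = c := (d₀.proj_mul h c).2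
      change (pH (h * c) : G) * (Y (pC (h * c)) : e.ker) = _
      rw [h3, h4]
    let W : Monoid.End G := (w : MulAut G).toMonoidHom
    have hXV : ∀ (h : e.range) (c : e.ker), (Y' * W * V) (h * c) = h * Y (ν c) := by
      intro h c
      change Y' (w (v (h * c))) = _
      rw [hw, hY']
    have hcen : ∀ (h : e.range) (c c' : e.ker), (h * c : G) * (h * c' : G)⁻¹ ∈
        Subgroup.center G := by
      intro h c c'
      have h3 : (c : G) * (c' : G)⁻¹ ∈ Subgroup.center G :=
        ker_le_center e hz (c * c'⁻¹).2
      have h4 : (h * c : G) * (h * c' : G)⁻¹ = h * ((c : G) * (c' : G)⁻¹) * (h : G)⁻¹ := by group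
      rw [h4, Subgroup.mem_center_iff.1 h3, mul_inv_cancel_right]
      exact h3
    obtain ⟨N, hN⟩ := hS (Y' * W) (by
      intro g
      have h3 := hcen (pH g) (pC g) (Y (ν (pC g)))
      rwa [← hXV, hp] at h3) (by
      intro g
      have h4 : w (g * ((V * (Y' * W)) g)⁻¹) ∈ Subgroup.center G := by
        rw [map_mul, map_inv]
        change w g * (w (v (Y' (w g))))⁻¹ ∈ _
        have h3 := hcen (pH (w g)) (pC (w g)) (ν (Y (pC (w g))))
        rwa [← hw, ← hY', hp] at h3
      have h5 := (centerAut w⁻¹ ⟨_, h4⟩).2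
      have h6 : ((centerAut w⁻¹ ⟨_, h4⟩ : Subgroup.center G) : G) =
        g * ((V * (Y' * W)) g)⁻¹ := w.symm_apply_apply _
      rwa [h6] at h5)
    have hpow : ∀ (N : ℕ) (h : e.range) (c : e.ker), ((Y' * W * V) ^ N) (h * c) =
        h * ((Y.comp ν)^[N] c : e.ker) := by
      intro N h
      induction N with
      | zero => intro c; rfl
      | succ N ih =>
        intro c
        rw [pow_succ, End_mul_apply, hXV, ih, Function.iterate_succ_apply]
        rfl
    have hle : e.range ≤ MonoidHom.range ((Y' * W * V) ^ N) := by
      rintro _ ⟨g, rfl⟩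
      refine ⟨e g, ?_⟩
      have h3 := hpow N ⟨e g, ⟨g, rfl⟩⟩ 1
      have h4 : (Y.comp ν)^[N] 1 = 1 := Function.iterate_fixed (map_one _) N
      rwa [h4, OneMemClass.coe_one, mul_one] at h3
    have heq : e.range = MonoidHom.range ((Y' * W * V) ^ N) :=
      Subgroup.eq_of_le_of_card_ge hle (hmax _ hN)
    refine ⟨N, fun c => ?_⟩
    have h3 := hpow N 1 c
    rw [OneMemClass.coe_one, one_mul, one_mul] at h3
    have h4 : (((Y.comp ν)^[N] c : e.ker) : G) ∈ e.range := by
      rw [heq, ← h3]; exact ⟨_, rfl⟩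
    obtain ⟨g, hg⟩ := h4
    have h5 : e (((Y.comp ν)^[N] c : e.ker) : G) = 1 := ((Y.comp ν)^[N] c).2
    rw [← hg, he, hg] at h5
    exact Subtype.ext h5
  refine ⟨ofIdem e he hz δ ν hrad.isNilpotentEnd, w, fun g => ?_, hrad⟩
  set d : TwistedReflection k G := ofIdem e he hz δ ν hrad.isNilpotentEnd
  conv_lhs => rw [← d.projH_mul_projC g]
  exact hw (d.projH g) (d.projC g)

/-- The endomorphism ring of a finite abelian group has stable range one. The radical
decomposition is applied to `α`: on `C` the equation `x α + β = 1` makes the component of `β`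
invertible, and `t` inverts it there. The field `ℂ` in the proof plays no role, as only the
underlying decomposition is used. -/
theorem exists_bijective_of_left {A : Type*} [Group A] [Finite A] (hA : ∀ a b : A, a * b = b * a)
    (α β x : A →* A) (h : ∀ c, x (α c) * β c = c) :
    ∃ t : A →* A, Function.Bijective fun c => α c * t (β c) := by
  have hc : ∀ a : A, a ∈ Subgroup.center A := fun a => Subgroup.mem_center_iff.2 fun b => hA b a
  obtain ⟨d, w, hw, hν⟩ := exists_radical_decomposition (k := ℂ) α α (fun _ => hc _) fun _ => hc _
  let X : d.C →* d.C := d.projC.comp (x.comp ((w⁻¹ : MulAut A).toMonoidHom.comp d.C.subtype))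
  let D : d.C →* d.C := d.projC.comp (β.comp d.C.subtype)
  have hD : ∀ c, X (d.ν c) * D c = c := by
    intro c
    have h1 := congrArg d.projC (h c)
    rw [map_mul, TwistedReflection.projC_coe_C] at h1
    have h2 : w⁻¹ (d.ν c : A) = α c := by
      have := hw c
      rw [TwistedReflection.projH_coe_C, TwistedReflection.projC_coe_C, OneMemClass.coe_one,
        one_mul] at this
      rw [← this]; exact w.symm_apply_apply _
    change d.projC (x (w⁻¹ (d.ν c : A))) * _ = _
    rw [h2]; exact h1
  have hDb : Function.Bijective D := by
    rw [← Finite.injective_iff_bijective, injective_iff_map_eq_one]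
    intro c h1
    have := hD c
    rw [h1, mul_one] at this
    exact (hν X).eq_one this
  let D' := MulEquiv.ofBijective D hDb
  let t : A →* A := (w⁻¹ : MulAut A).toMonoidHom.comp
    (d.C.subtype.comp (D'.symm.toMonoidHom.comp d.projC))
  have ht : ∀ a, w (t a) = D'.symm (d.projC a) := fun a => w.apply_symm_apply _
  let f : A →* A := MonoidHom.mk' (fun c => α c * t (β c)) fun a b => by
    rw [map_mul, map_mul, map_mul, mul_assoc, mul_assoc, ← mul_assoc (α b), hA (α b), mul_assoc]
  refine ⟨t, Finite.injective_iff_bijective.1 (?_ : Function.Injective f)⟩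
  rw [injective_iff_map_eq_one]
  intro a ha
  have h1 : w (α a * t (β a)) = 1 := (congrArg w ha).trans (map_one w)
  rw [map_mul, hw, ht, mul_assoc, ← Subgroup.coe_mul] at h1
  have h2 := congrArg d.projH h1
  rw [(d.proj_mul _ _).1, map_one] at h2
  have h3 := congrArg d.projC h1
  rw [(d.proj_mul _ _).2, map_one] at h3
  have h4 : (d.projC a : A) = a := by
    conv_rhs => rw [← d.projH_mul_projC a, h2, OneMemClass.coe_one, one_mul]
  have h5 : D'.symm (d.projC (β a)) = d.projC a := by
    rw [MulEquiv.symm_apply_eq]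
    change _ = d.projC (β (d.projC a))
    rw [h4]
  rw [h5] at h3
  let Y : d.C →* d.C := MonoidHom.mk' (fun c => c⁻¹) fun a b => by
    rw [mul_inv_rev]; exact Subtype.ext (hA _ _)
  rw [← h4, (hν Y).eq_one (inv_eq_of_mul_eq_one_right h3), OneMemClass.coe_one]

/-- The endomorphism ring of a finite abelian group has stable range one, on the other side. -/
theorem exists_bijective_of_right {A : Type*} [Group A] [Finite A] (hA : ∀ a b : A, a * b = b * a)
    (α β x : A →* A) (h : ∀ c, α (x c) * β c = c) :
    ∃ t : A →* A, Function.Bijective fun c => α c * β (t c) := by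
  have hc : ∀ a : A, a ∈ Subgroup.center A := fun a => Subgroup.mem_center_iff.2 fun b => hA b a
  obtain ⟨d, w, hw, hν⟩ := exists_radical_decomposition (k := ℂ) α α (fun _ => hc _) fun _ => hc _
  let X : d.C →* d.C := d.projC.comp (x.comp ((w⁻¹ : MulAut A).toMonoidHom.comp d.C.subtype))
  let D : d.C →* d.C := d.projC.comp ((w : MulAut A).toMonoidHom.comp
    (β.comp ((w⁻¹ : MulAut A).toMonoidHom.comp d.C.subtype)))
  have hD : ∀ c, d.ν (X c) * D c = c := by
    intro c
    have h1 := congrArg w (h (w⁻¹ (c : A)))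
    rw [map_mul, MulAut.apply_inv_self, hw] at h1
    have h2 := congrArg d.projC h1
    rw [map_mul, TwistedReflection.projC_coe_C, (d.proj_mul _ _).2] at h2
    exact h2
  have hDb : Function.Bijective D := by
    rw [← Finite.injective_iff_bijective, injective_iff_map_eq_one]
    intro c h1
    have h2 := hD c
    rw [h1, mul_one] at h2
    have h3 : X c = 1 := (hν X).eq_one (congrArg X h2)
    rw [← h2, h3, map_one]
  let D' := MulEquiv.ofBijective D hDb
  let t : A →* A := (w⁻¹ : MulAut A).toMonoidHom.comp
    (d.C.subtype.comp (D'.symm.toMonoidHom.comp d.projC))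
  let f : A →* A := MonoidHom.mk' (fun c => α c * β (t c)) fun a b => by
    rw [map_mul, map_mul, map_mul, mul_assoc, mul_assoc, ← mul_assoc (α b), hA (α b), mul_assoc]
  refine ⟨t, Finite.injective_iff_bijective.1 (?_ : Function.Injective f)⟩
  rw [injective_iff_map_eq_one]
  intro a ha
  have h1 : w (α a * β (t a)) = 1 := (congrArg w ha).trans (map_one w)
  rw [map_mul, hw] at h1
  have h2 := congrArg d.projC h1
  have h3 : d.projC (w (β (t a))) = d.projC a := D'.apply_symm_apply _
  rw [map_mul, (d.proj_mul _ _).2, h3, map_one] at h2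
  let Y : d.C →* d.C := MonoidHom.mk' (fun c => c⁻¹) fun a b => by
    rw [mul_inv_rev]; exact Subtype.ext (hA _ _)
  have h4 : d.projC a = 1 := (hν Y).eq_one (inv_eq_of_mul_eq_one_right h2)
  have h5 : t a = 1 := by
    change w⁻¹ ((D'.symm (d.projC a) : d.C) : A) = 1
    rw [h4, map_one, OneMemClass.coe_one, map_one]
  rw [h4, h5, map_one, map_one, map_one, OneMemClass.coe_one, mul_one, mul_one] at h1
  rw [← d.projH_mul_projC a, h1, h4, OneMemClass.coe_one, mul_one]

end Radical

/-! ### Duality of finite abelian groups -/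

section Duality

variable {k : Type*} [Field k] [IsAlgClosed k] [CharZero k]

/-- Every character of the dual of a finite abelian group is an evaluation. -/
theorem exists_eq_eval {Z : Type*} [Group Z] [Finite Z] (hZ : ∀ a b : Z, a * b = b * a)
    (F : (Z →* kˣ) →* kˣ) : ∃ z : Z, ∀ χ, F χ = χ z := by
  obtain ⟨i⟩ := exists_dual (k := k) hZ
  have hfin : Finite (Z →* kˣ) := Finite.of_equiv _ i.toEquiv
  obtain ⟨j⟩ := exists_dual (k := k) (C := Z →* kˣ) fun a b => mul_comm a b
  have hfin' : Finite ((Z →* kˣ) →* kˣ) := Finite.of_equiv _ j.toEquiv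
  let ev : Z →* ((Z →* kˣ) →* kˣ) :=
    { toFun := fun z =>
        { toFun := fun χ => χ z
          map_one' := rfl
          map_mul' := fun _ _ => rfl }
      map_one' := by ext χ; simp
      map_mul' := fun a b => by ext χ; simp }
  have hinj : Function.Injective ev := by
    rw [injective_iff_map_eq_one]
    intro z hz
    exact eq_one_of_forall_char (k := k) hZ fun χ => DFunLike.congr_fun hz χ
  obtain ⟨z, hz⟩ := ((Nat.bijective_iff_injective_and_card ev).2
    ⟨hinj, Nat.card_congr (i.toEquiv.trans j.toEquiv)⟩).2 F
  exact ⟨z, fun χ => by rw [← hz]; rfl⟩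

/-- The transpose of a homomorphism defined on the dual of a finite abelian group. -/
theorem exists_transpose {Z C : Type*} [Group Z] [Finite Z] (hZ : ∀ a b : Z, a * b = b * a)
    [Group C] (F : (Z →* kˣ) →* C) :
    ∃ j : (C →* kˣ) →* Z, ∀ (χ : Z →* kˣ) (ψ : C →* kˣ), ψ (F χ) = χ (j ψ) := by
  choose j hj using fun ψ : C →* kˣ => exists_eq_eval hZ (ψ.comp F)
  refine ⟨MonoidHom.mk' j fun ψ ψ' => ?_, fun χ ψ => hj ψ χ⟩
  refine mul_inv_eq_one.1 (eq_one_of_forall_char (k := k) hZ fun χ => ?_)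
  have h1 := hj (ψ * ψ') χ
  rw [map_mul, map_inv, map_mul, ← h1, ← hj ψ, ← hj ψ']
  exact mul_inv_cancel _

/-- The transpose of an isomorphism of a finite abelian group with its dual. -/
theorem exists_transpose_equiv {C D : Type*} [Group C] [Finite C] (hC : ∀ a b : C, a * b = b * a)
    [Group D] (θ : D ≃* (C →* kˣ)) : ∃ δ : C ≃* (D →* kˣ), ∀ c x, δ c x = θ x c := by
  obtain ⟨i⟩ := exists_dual (k := k) hC
  let t : C →* (D →* kˣ) :=
    { toFun := fun c =>
        { toFun := fun x => θ x c
          map_one' := by rw [map_one]; rfl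
          map_mul' := fun x y => by rw [map_mul]; rfl }
      map_one' := by ext x; simp
      map_mul' := fun a b => by ext x; simp }
  have e : C ≃* D := i.trans θ.symm
  have hD : ∀ a b : D, a * b = b * a := fun a b => by
    apply e.symm.injective; rw [map_mul, map_mul, hC]
  have : Finite D := Finite.of_equiv _ e.toEquiv
  obtain ⟨j⟩ := exists_dual (k := k) hD
  have : Finite (D →* kˣ) := Finite.of_equiv _ j.toEquiv
  have hinj : Function.Injective t := by
    rw [injective_iff_map_eq_one]
    intro c hc
    refine eq_one_of_forall_char (k := k) hC fun χ => ?_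
    have := DFunLike.congr_fun hc (θ.symm χ)
    rwa [show t c (θ.symm χ) = θ (θ.symm χ) c from rfl, MulEquiv.apply_symm_apply] at this
  exact ⟨MulEquiv.ofBijective t ((Nat.bijective_iff_injective_and_card t).2
    ⟨hinj, Nat.card_congr (e.toEquiv.trans j.toEquiv)⟩), fun _ _ => rfl⟩

/-- If `f` has no nontrivial fixed point then `c ↦ c f(c)⁻¹` is an automorphism. -/
theorem exists_mulEquiv_mul_inv {C : Type*} [Group C] [Finite C] (hC : ∀ a b : C, a * b = b * a)
    (f : C →* C) (hf : ∀ c, f c = c → c = 1) : ∃ g : C ≃* C, ∀ c, g c = c * (f c)⁻¹ := by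
  let g : C →* C := MonoidHom.mk' (fun c => c * (f c)⁻¹) fun a b => by
    rw [map_mul, mul_inv_rev, hC (f b)⁻¹, mul_assoc, mul_assoc, ← mul_assoc b, hC b, mul_assoc]
  have hinj : Function.Injective g := by
    rw [injective_iff_map_eq_one]
    intro c hc
    exact hf c (mul_inv_eq_one.1 hc).symm
  exact ⟨MulEquiv.ofBijective g (Finite.injective_iff_bijective.1 hinj), fun _ => rfl⟩

end Duality

/-! ### The action of a twisted reflection -/

section Action

variable {k G : Type*} [Field k] [Group G] [Fintype G] [DecidableEq G]

open scoped Classical in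
/-- The vectors attached to characters of `B` are combinations of those attached to the restrictions
to a subgroup `A` of `B`. -/
theorem charVec_eq_sum_charVec [CharZero k] {A B : Subgroup G} (h : A ≤ B) (x : G) (χ : B →* kˣ)
    (y : G) : charVec B x χ y = ∑ b : B, ((Nat.card B : k)⁻¹ * χ b) •
      charVec A (x * b) (χ.comp (Subgroup.inclusion h)) y := by
  have h0 : (Nat.card A : k) ≠ 0 := Nat.cast_ne_zero.2 Nat.card_pos.ne'
  simp only [charVec, Finset.smul_sum, smul_smul]
  rw [Finset.sum_comm]
  have h1 : ∀ a : A, ∑ b : B, ((Nat.card B : k)⁻¹ * χ b * ((Nat.card A : k)⁻¹ *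
      (χ.comp (Subgroup.inclusion h) a : kˣ))) • (e (x * b * a) y : DrinfeldDouble k G) =
      (Nat.card A : k)⁻¹ • ∑ b : B, ((Nat.card B : k)⁻¹ * χ b) • e (x * b) y := by
    intro a
    rw [Finset.smul_sum]
    conv_rhs => rw [← Equiv.sum_comp (Equiv.mulRight (Subgroup.inclusion h a))]
    refine Finset.sum_congr rfl fun b _ => ?_
    rw [smul_smul]
    congr 1
    · simp; ring
    · simp [mul_assoc]
  simp only [h1]
  rw [Finset.sum_const, Finset.card_univ, ← Nat.card_eq_fintype_card, ← Nat.cast_smul_eq_nsmul k,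
    smul_smul, mul_inv_cancel₀ h0, one_smul]

variable [IsAlgClosed k] [CharZero k]

namespace TwistedReflection

variable (d : TwistedReflection k G)

theorem toAut_charVec (x : G) (ψ : d.C →* kˣ) (y : G) :
    d.toAut (charVec d.C x ψ y) = ((ψ (d.projC x))⁻¹ : kˣ) • charVec d.C (d.projH x : G)
      (d.δ (d.projC y)) ((d.projH y : G) * (d.δ.symm ψ * d.ν (d.projC y) : d.C)) := by
  conv_lhs => rw [← d.projH_mul_projC x, ← d.projH_mul_projC y]
  rw [charVec_mul_mem, Units.smul_def, map_smul, toAut_apply, toLinearMap_charVec, Units.smul_def]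

theorem toAut_grp (χ : G →* kˣ) (y : G) : d.toAut (grp χ y) =
    grp (χ.comp (d.H.subtype.comp d.projH) * (d.δ (d.projC y)).comp d.projC)
      ((d.projH y : G) * (d.δ.symm (χ.comp d.C.subtype) * d.ν (d.projC y) : d.C)) := by
  rw [grp_eq_sum_charVec d.C χ, grp_eq_sum_charVec d.C, map_sum]
  refine Finset.sum_congr rfl fun x _ => ?_
  have h1 : (χ.comp (d.H.subtype.comp d.projH) * (d.δ (d.projC y)).comp d.projC).comp d.C.subtype =
      d.δ (d.projC y) := by
    ext c; simp
  rw [h1, map_smul, toAut_charVec]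
  conv_rhs => rw [← d.projH_mul_projC x, charVec_mul_mem]
  rw [Units.smul_def, Units.smul_def, smul_smul, smul_smul, ← Units.val_mul, ← Units.val_mul]
  congr 2
  rw [d.projH_mul_projC x]
  have h2 : χ x = χ (d.projH x) * χ (d.projC x) := by rw [← map_mul, d.projH_mul_projC]
  rw [h2]
  simp

theorem vPart_toAut (y : G) : vPart d.toAut y = d.projH y * d.ν (d.projC y) := by
  rw [vPart_eq (d.toAut_grp 1 y)]
  have : (1 : G →* kˣ).comp d.C.subtype = 1 := rfl
  rw [this, map_one, one_mul]

theorem bPart_toAut (y : G) : bPart d.toAut y = (d.δ (d.projC y)).comp d.projC := by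
  rw [bPart_eq (d.toAut_grp 1 y)]
  ext; simp

theorem aPart_toAut (χ : Subgroup.center G →* kˣ) :
    (aPart d.toAut χ : G) = d.δ.symm (χ.comp (Subgroup.inclusion d.C_le_center)) := by
  by_contra hne
  have h1 := apply_charVec d.toAut 1 χ 1 1 (aPart d.toAut χ)
  rw [map_one, mul_one, if_pos rfl, map_one, map_one, Units.val_one,
    mul_one] at h1
  refine charVec_one_one_ne_zero χ (h1.symm.trans ?_)
  rw [charVec_eq_sum_charVec d.C_le_center, map_sum, sum_apply, Finset.sum_eq_zero]
  intro z _
  rw [map_smul, toAut_charVec, smul_apply, Units.smul_def, smul_apply, charVec_apply_of_ne,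
    mul_zero, mul_zero]
  simpa using hne

/-- Reflections are involutions. -/
theorem toAut_mul_self (h : d.ν = 1) : d.toAut * d.toAut = 1 := by
  refine HopfAut.ext_e fun x y => ?_
  rw [← sum_charVec d.C_le_center x y, map_sum, map_sum]
  refine Finset.sum_congr rfl fun ψ _ => ?_
  rw [HopfAut.mul_apply, toAut_charVec, Units.smul_def, map_smul, toAut_charVec, HopfAut.one_apply,
    ← Units.smul_def]
  conv_rhs => rw [← d.projH_mul_projC x, charVec_mul_mem]
  rw [(d.proj_mul _ _).1, (d.proj_mul _ _).2, h]
  simp [d.projH_mul_projC]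

end TwistedReflection

end Action

/-! ### Factorizations through a reflection -/

section Factorization

variable {k G : Type*} [Field k] [IsAlgClosed k] [CharZero k] [Group G] [Fintype G] [DecidableEq G]

namespace TwistedReflection

variable (d : TwistedReflection k G)

theorem mul_comm_C (a b : d.C) : a * b = b * a := Subtype.ext (d.comm a a.2 b b.2)

theorem projH_mem_center {z : G} (hz : z ∈ Subgroup.center G) :
    (d.projH z : G) ∈ Subgroup.center G := by
  have h1 : (d.projH z : G) = z * (d.projC z : G)⁻¹ := by
    rw [eq_mul_inv_iff_mul_eq, d.projH_mul_projC]
  rw [h1]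
  exact Subgroup.mul_mem _ hz (Subgroup.inv_mem _ (d.C_le_center (d.projC z).2))

/-- Given a homomorphism `j` from the dual of `C` to `G` with a left inverse `ρ`, the complement
`H` can be changed, by means of `τ`, into a complement of the image of `j`. -/
theorem exists_bijective_projC_mul (j : (d.C →* kˣ) →* G) (ρ : G →* (d.C →* kˣ))
    (h : ∀ ψ, ρ (j ψ) = ψ) :
    ∃ τ : G →* d.C, Function.Bijective fun ψ => d.projC (j ψ) * τ (d.projH (j ψ)) := by
  have hfin : Finite (d.C →* kˣ) := Finite.of_equiv _ d.δ.toEquiv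
  let α : (d.C →* kˣ) →* (d.C →* kˣ) := d.δ.toMonoidHom.comp (d.projC.comp j)
  let β : (d.C →* kˣ) →* (d.C →* kˣ) := ρ.comp (d.H.subtype.comp (d.projH.comp j))
  let x : (d.C →* kˣ) →* (d.C →* kˣ) := ρ.comp (d.C.subtype.comp d.δ.symm.toMonoidHom)
  obtain ⟨t, ht⟩ := exists_bijective_of_left (fun a b => mul_comm a b) α β x (by
    intro ψ
    change ρ (d.δ.symm (d.δ (d.projC (j ψ))) : d.C) * ρ (d.projH (j ψ)) = ψ
    rw [d.δ.symm_apply_apply, ← map_mul, ← d.commute _ (d.projH _).2 _ (d.projC _).2,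
      d.projH_mul_projC, h])
  refine ⟨d.δ.symm.toMonoidHom.comp (t.comp ρ), ?_⟩
  convert d.δ.symm.bijective.comp ht using 1
  funext ψ
  change _ = d.δ.symm (d.δ (d.projC (j ψ)) * t (ρ (d.projH (j ψ))))
  rw [map_mul, d.δ.symm_apply_apply]
  rfl

/-- Given a homomorphism `j` from the dual of `C` to `G` with a left inverse `ρ`, the subgroup
`C` can be changed, by means of `t`, into a complement of the kernel of `ρ`. -/
theorem exists_bijective_mul_projH (j : (d.C →* kˣ) →* G) (ρ : G →* (d.C →* kˣ))
    (h : ∀ ψ, ρ (j ψ) = ψ) :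
    ∃ t : d.C →* (d.C →* kˣ), Function.Bijective fun c : d.C => ρ c * ρ (d.projH (j (t c))) := by
  have hfin : Finite (d.C →* kˣ) := Finite.of_equiv _ d.δ.toEquiv
  let x : (d.C →* kˣ) →* (d.C →* kˣ) := d.δ.toMonoidHom.comp (d.projC.comp j)
  let β : (d.C →* kˣ) →* (d.C →* kˣ) := ρ.comp (d.H.subtype.comp (d.projH.comp j))
  let α : (d.C →* kˣ) →* (d.C →* kˣ) := ρ.comp (d.C.subtype.comp d.δ.symm.toMonoidHom)
  obtain ⟨t, ht⟩ := exists_bijective_of_right (fun a b => mul_comm a b) α β x (by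
    intro ψ
    change ρ (d.δ.symm (d.δ (d.projC (j ψ))) : d.C) * ρ (d.projH (j ψ)) = ψ
    rw [d.δ.symm_apply_apply, ← map_mul, ← d.commute _ (d.projH _).2 _ (d.projC _).2,
      d.projH_mul_projC, h])
  refine ⟨t.comp d.δ.toMonoidHom, ?_⟩
  convert ht.comp d.δ.bijective using 1
  funext c
  change _ = ρ (d.δ.symm (d.δ c) : d.C) * ρ (d.projH (j (t (d.δ c))))
  rw [d.δ.symm_apply_apply]
  rfl

end TwistedReflection

/-- The radical decomposition of the entry `v` of the matrix of `φ`; modulo the centre, `v` is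
inverted by the entry `v` of the matrix of `φ⁻¹`. -/
theorem exists_radical_decomposition_vPart (φ : HopfAut k G) :
    ∃ (d : TwistedReflection k G) (w : MulAut G),
      (∀ g, w (vPart φ g) = d.projH g * d.ν (d.projC g)) ∧ IsRadicalEnd d.ν :=
  exists_radical_decomposition (vPart φ) (vPart φ⁻¹)
    (fun g => by
      rw [mul_inv_eq_of_eq_mul (aPart_inv_mul_vPart φ g).symm]
      exact (aPart φ⁻¹ _).2)
    (fun g => by
      rw [mul_inv_eq_of_eq_mul (aPart_mul_vPart_inv φ g).symm]
      exact (aPart φ _).2)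

theorem IsRadicalEnd.eq_one_of_comp {C : Type*} [Group C] {ν : C →* C} (h : IsRadicalEnd ν)
    (N : C →* C) {c : C} (hc : ν (N c) = c) : c = 1 := by
  have h1 : N c = 1 := (h N).eq_one (congrArg N hc)
  rw [← hc, h1, map_one]

theorem center_comm (a b : Subgroup.center G) : a * b = b * a :=
  Subtype.ext (Subgroup.mem_center_iff.1 b.2 a)

section Decomposed

variable {φ : HopfAut k G} {d : TwistedReflection k G} {w : MulAut G}

/-- On the radical part of `v` the entry `a` of the matrix of `φ` is split: its transpose `j` has a
left inverse `ρ`, obtained from the entry `b` of the matrix of `φ⁻¹`. -/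
theorem exists_split_aPart (hw : ∀ g, w (vPart φ g) = d.projH g * d.ν (d.projC g))
    (hν : IsRadicalEnd d.ν) :
    ∃ (j : (d.C →* kˣ) →* Subgroup.center G) (ρ : G →* (d.C →* kˣ)), (∀ ψ, ρ (j ψ) = ψ) ∧
      ∀ (χ : Subgroup.center G →* kˣ) (ψ : d.C →* kˣ),
        ψ (d.projC (w (aPart φ χ))) = χ (j ψ) := by
  obtain ⟨j, hj⟩ := exists_transpose (k := k) center_comm
    (d.projC.comp ((w : MulAut G).toMonoidHom.comp
      ((Subgroup.center G).subtype.comp (aPart φ))))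
  let N : d.C →* d.C := d.projC.comp ((vPart φ⁻¹).comp
    ((w⁻¹ : MulAut G).toMonoidHom.comp d.C.subtype))
  obtain ⟨g, hg⟩ := exists_mulEquiv_mul_inv d.mul_comm_C (d.ν.comp N)
    fun c hc => hν.eq_one_of_comp N hc
  have key : ∀ (c : d.C) ψ, bPart φ⁻¹ (w⁻¹ (c : G)) (j ψ) = ψ (g c) := by
    intro c ψ
    have h1 := congrArg w (aPart_mul_vPart_inv φ (w⁻¹ (c : G)))
    rw [map_mul, hw, MulAut.apply_inv_self] at h1
    have h2 := congrArg ψ (congrArg d.projC h1)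
    rw [map_mul, map_mul, (d.proj_mul _ _).2, TwistedReflection.projC_coe_C] at h2
    have h3 : ψ (d.projC (w (aPart φ ((bPart φ⁻¹ (w⁻¹ (c : G))).comp
      (Subgroup.center G).subtype)))) = bPart φ⁻¹ (w⁻¹ (c : G)) (j ψ) := hj _ ψ
    rw [h3] at h2
    rw [hg, map_mul, map_inv, ← h2]
    exact (mul_inv_cancel_right _ _).symm
  refine ⟨j, MonoidHom.flip ((bPart φ⁻¹).comp ((w⁻¹ : MulAut G).toMonoidHom.comp
    (d.C.subtype.comp g.symm.toMonoidHom))), fun ψ => ?_, hj⟩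
  ext c
  change ((bPart φ⁻¹ (w⁻¹ (g.symm c : d.C)) (j ψ) : kˣ) : k) = _
  rw [key, g.apply_symm_apply]

/-- On the radical part of `v` the entry `b` of the matrix of `φ` is split: up to an automorphism
`g` of `C` its transpose `ρ` has a right inverse `j`, obtained from the entry `a` of the matrix
of `φ⁻¹`. -/
theorem exists_split_bPart (hw : ∀ g, w (vPart φ g) = d.projH g * d.ν (d.projC g))
    (hν : IsRadicalEnd d.ν) :
    ∃ (j : (d.C →* kˣ) →* Subgroup.center G) (ρ : G →* (d.C →* kˣ)) (g : d.C ≃* d.C),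
      (∀ ψ, ρ (w (j ψ)) = ψ) ∧ ∀ (c : d.C) (x : G), ρ (w x) (g c) = bPart φ c x := by
  obtain ⟨j, hj⟩ := exists_transpose (k := k) center_comm
    (d.projC.comp ((Subgroup.center G).subtype.comp (aPart φ⁻¹)))
  let N : d.C →* d.C := d.projC.comp ((vPart φ⁻¹).comp
    ((w⁻¹ : MulAut G).toMonoidHom.comp d.C.subtype))
  obtain ⟨g, hg⟩ := exists_mulEquiv_mul_inv d.mul_comm_C (N.comp d.ν)
    fun c hc => (hν N).eq_one hc
  have key : ∀ (c : d.C) ψ, bPart φ c (j ψ) = ψ (g c) := by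
    intro c ψ
    have h1 := aPart_inv_mul_vPart φ (c : G)
    have h4 : vPart φ c = w⁻¹ (d.ν c : G) := by
      have := hw c
      rw [TwistedReflection.projH_coe_C, TwistedReflection.projC_coe_C, OneMemClass.coe_one,
        one_mul] at this
      rw [← this, MulAut.inv_apply_self]
    rw [h4] at h1
    have h2 := congrArg ψ (congrArg d.projC h1)
    rw [map_mul, map_mul, TwistedReflection.projC_coe_C] at h2
    have h3 : ψ (d.projC (aPart φ⁻¹ ((bPart φ (c : G)).comp
      (Subgroup.center G).subtype))) = bPart φ (c : G) (j ψ) := hj _ ψ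
    rw [h3] at h2
    rw [hg, map_mul, map_inv, ← h2]
    exact (mul_inv_cancel_right _ _).symm
  refine ⟨j, MonoidHom.flip ((bPart φ).comp (d.C.subtype.comp g.symm.toMonoidHom)) |>.comp
    (w⁻¹ : MulAut G).toMonoidHom, g, fun ψ => ?_, fun c x => ?_⟩
  · ext c
    change ((bPart φ (g.symm c : d.C) (w⁻¹ (w (j ψ))) : kˣ) : k) = _
    rw [MulAut.inv_apply_self, key, g.apply_symm_apply]
  · change bPart φ (g.symm (g c) : d.C) (w⁻¹ (w x)) = _
    rw [MulAut.inv_apply_self, g.symm_apply_apply]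

end Decomposed

/-- The reflections attached to a central idempotent endomorphism. -/
theorem exists_reflection (e : G →* G) (he : ∀ g, e (e g) = e g)
    (hz : ∀ g, g * (e g)⁻¹ ∈ Subgroup.center G) : ∃ r : TwistedReflection k G,
      r.ν = 1 ∧ r.C = e.ker ∧ ∀ g, (r.projH g : G) = e g := by
  obtain ⟨δ⟩ := exists_dual (k := k) (C := e.ker) fun a b =>
    Subtype.ext (Subgroup.mem_center_iff.1 (ker_le_center e hz b.2) a)
  exact ⟨ofIdem e he hz δ 1 isNilpotentEnd_one, rfl, rfl, projH_ofIdem e he hz δ 1 _⟩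

/-- A reflection turns `φ` from the left into an automorphism whose entry `v` is bijective. -/
theorem exists_reflection_mul (φ : HopfAut k G) : ∃ r : TwistedReflection k G, r.ν = 1 ∧
    Function.Bijective (vPart (r.toAut * φ)) := by
  obtain ⟨d, w, hw, hν⟩ := exists_radical_decomposition_vPart φ
  obtain ⟨j, ρ, g₀, hρ, hb⟩ := exists_split_bPart hw hν
  obtain ⟨t, ht⟩ := d.exists_bijective_mul_projH
    ((w : MulAut G).toMonoidHom.comp ((Subgroup.center G).subtype.comp j)) ρ hρ
  let s : d.C →* d.H := d.projH.comp (((w : MulAut G).toMonoidHom.comp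
    ((Subgroup.center G).subtype.comp j)).comp t)
  have hs : ∀ c, (s c : G) ∈ Subgroup.center G := fun c =>
    d.projH_mem_center (centerAut w (j (t c))).2
  -- `C` is replaced by the preimage under `w` of the graph of `s`
  let e : G →* G := MonoidHom.mk' (fun x => w⁻¹ (d.projH (w x) * (s (d.projC (w x)))⁻¹ : d.H))
    fun x y => by
      have h1 := Subgroup.mem_center_iff.1 (Subgroup.inv_mem _ (hs (d.projC (w x))))
        (d.projH (w y))
      have h1' : d.projH (w y) * (s (d.projC (w x)))⁻¹ = (s (d.projC (w x)))⁻¹ * d.projH (w y) :=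
        Subtype.ext h1
      have h2 : (s (d.projC (w x)) * s (d.projC (w y)))⁻¹ =
          (s (d.projC (w x)))⁻¹ * (s (d.projC (w y)))⁻¹ := by
        rw [← map_mul, d.mul_comm_C, map_mul, mul_inv_rev]
      rw [← map_mul, map_mul w, map_mul d.projH, map_mul d.projC, map_mul s, h2,
        ← Subgroup.coe_mul]
      congr 2
      rw [mul_assoc, mul_assoc, ← mul_assoc (d.projH (w y)), h1', mul_assoc]
  have hwe : ∀ x, w (e x) = (d.projH (w x) * (s (d.projC (w x)))⁻¹ : d.H) :=
    fun x => MulAut.apply_inv_self G w _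
  have he : ∀ x, e (e x) = e x := by
    intro x
    apply w.injective
    rw [hwe, hwe x, TwistedReflection.projH_coe_H, TwistedReflection.projC_coe_H, map_one, inv_one,
      mul_one]
  have hz : ∀ x, x * (e x)⁻¹ ∈ Subgroup.center G := by
    intro x
    have h1 : w (x * (e x)⁻¹) ∈ Subgroup.center G := by
      rw [map_mul, map_inv, hwe]
      have h2 := Subgroup.mul_mem _ (d.C_le_center (d.projC (w x)).2) (hs (d.projC (w x)))
      have h3 := Subgroup.mem_center_iff.1 h2 (d.projH (w x))
      have h4 : w x * ((d.projH (w x) * (s (d.projC (w x)))⁻¹ : d.H) : G)⁻¹ =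
          d.projH (w x) * (d.projC (w x) * s (d.projC (w x))) * (d.projH (w x) : G)⁻¹ := by
        conv_lhs => enter [1]; rw [← d.projH_mul_projC (w x)]
        simp [mul_assoc]
      rw [h4, h3, mul_inv_cancel_right]
      exact h2
    have h2 := (centerAut w⁻¹ ⟨_, h1⟩).2
    rwa [show ((centerAut w⁻¹ ⟨_, h1⟩ : Subgroup.center G) : G) = x * (e x)⁻¹ from
      w.symm_apply_apply _] at h2
  obtain ⟨r, hr, hC, hrH⟩ := exists_reflection (k := k) e he hz
  refine ⟨r, hr, Finite.injective_iff_bijective.1 ((injective_iff_map_eq_one _).2 fun x hx => ?_)⟩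
  rw [vPart_mul, r.aPart_toAut, r.vPart_toAut, hr, MonoidHom.one_apply, OneMemClass.coe_one,
    mul_one] at hx
  have hx1 : e (vPart φ x) = 1 := by
    have h1 := congrArg (fun y => (r.projH y : G)) hx
    simp only [map_mul, TwistedReflection.projH_coe_C, TwistedReflection.projH_coe_H, map_one,
      OneMemClass.coe_one, one_mul] at h1
    rwa [hrH] at h1
  have hx2 : ∀ y ∈ e.ker, bPart φ x y = 1 := by
    rw [hrH, hx1, mul_one, OneMemClass.coe_eq_one, map_eq_one_iff _ r.δ.symm.injective] at hx
    intro y hy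
    rw [← hC] at hy
    exact DFunLike.congr_fun hx ⟨y, hy⟩
  let c := d.projC x
  have hxH : d.projH x = s (d.ν c) := by
    have h1 := congrArg w hx1
    rw [hwe, map_one, hw, (d.proj_mul _ _).1, (d.proj_mul _ _).2, OneMemClass.coe_eq_one,
      mul_inv_eq_one] at h1
    exact h1
  let graph : d.C →* G := (w⁻¹ : MulAut G).toMonoidHom.comp (MonoidHom.mk'
    (fun c => (c * s c : G)) fun a b => by
      have h1 := Subgroup.mem_center_iff.1 (d.C_le_center b.2) (s a)
      rw [map_mul, Subgroup.coe_mul, Subgroup.coe_mul, mul_assoc, mul_assoc, ← mul_assoc (b : G),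
        ← h1, mul_assoc])
  have hwg : ∀ c, w (graph c) = (c * s c : G) := fun c => MulAut.apply_inv_self G w _
  have hgraph : ∀ c, graph c ∈ e.ker := by
    intro c
    rw [MonoidHom.mem_ker]
    apply w.injective
    have h1 : (c * s c : G) = s c * c := (d.commute _ (s c).2 _ c.2).symm
    rw [hwe, hwg, h1, (d.proj_mul _ _).1, (d.proj_mul _ _).2, mul_inv_cancel, map_one,
      OneMemClass.coe_one]
  let Θ : d.C ≃* (d.C →* kˣ) := MulEquiv.ofBijective
    (MonoidHom.mk' (fun c : d.C => ρ c * ρ (s c)) fun a b => by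
      rw [map_mul, Subgroup.coe_mul, Subgroup.coe_mul, map_mul, map_mul]
      ext c
      exact congrArg Units.val (mul_mul_mul_comm _ _ _ _)) ht
  obtain ⟨Θ', hΘ⟩ := exists_transpose_equiv (k := k) d.mul_comm_C Θ
  let P : d.C →* (d.C →* kˣ) := MonoidHom.flip
    ((MonoidHom.flip ((bPart φ).comp (d.H.subtype.comp s))).comp graph)
  -- the kernel conditions become an equation between `c` and `ν(c)` whose coefficient at `c` is
  -- invertible by the choice of `t`; as `ν` is radical, `c` is trivial
  have h1 : ∀ c₁, P (d.ν c) c₁ * Θ' (g₀ c) c₁ = 1 := by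
    intro c₁
    have h2 := hx2 _ (hgraph c₁)
    rw [← d.projH_mul_projC x, map_mul, MonoidHom.mul_apply, hxH, ← hb, hwg] at h2
    have h3 : Θ' (g₀ c) c₁ = ρ (c₁ * s c₁) (g₀ c) := by rw [hΘ, map_mul]; rfl
    rw [h3]
    exact h2
  let Y : d.C →* d.C := g₀.symm.toMonoidHom.comp (Θ'.symm.toMonoidHom.comp P⁻¹)
  have h2 : c = 1 := (hν Y).eq_one (by
    change g₀.symm (Θ'.symm (P (d.ν c))⁻¹) = c
    rw [MulEquiv.symm_apply_eq, MulEquiv.symm_apply_eq]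
    exact MonoidHom.ext fun c₁ => inv_eq_of_mul_eq_one_right (h1 c₁))
  rw [h2, map_one, map_one] at hxH
  rw [← d.projH_mul_projC x, hxH, show d.projC x = 1 from h2]
  simp

/-- The endomorphism `h c ↦ h τ(h)⁻¹` with kernel `C`. -/
noncomputable def TwistedReflection.shearHom (d : TwistedReflection k G) (τ : G →* d.C) : G →* G :=
  MonoidHom.mk' (fun x => (d.projH x : G) * ((τ (d.projH x : G))⁻¹ : d.C)) fun x y => by
    have h1 := d.commute _ (d.projH y).2 _ ((τ (d.projH x : G))⁻¹ : d.C).2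
    rw [map_mul, Subgroup.coe_mul, map_mul, mul_inv_rev, d.mul_comm_C, Subgroup.coe_mul,
      mul_assoc, mul_assoc, ← mul_assoc (((τ (d.projH x : G))⁻¹ : d.C) : G), ← h1, mul_assoc]

theorem TwistedReflection.shearHom_apply (d : TwistedReflection k G) (τ : G →* d.C) (x : G) :
    d.shearHom τ x = (d.projH x : G) * ((τ (d.projH x : G))⁻¹ : d.C) := rfl

/-- The reflection on the same factor `C` for the complement `{h τ(h)⁻¹ | h ∈ H}`. -/
noncomputable abbrev TwistedReflection.shear (d : TwistedReflection k G) (τ : G →* d.C) :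
    TwistedReflection k G where
  H := (d.shearHom τ).range
  C := d.C
  comm := d.comm
  commute := by
    rintro _ ⟨x, rfl⟩ c hc
    exact (Subgroup.mem_center_iff.1 (d.C_le_center hc) _)
  complement := by
    rw [Subgroup.isComplement'_def, Subgroup.isComplement_iff_existsUnique]
    intro g
    refine ⟨(⟨d.shearHom τ g, ⟨g, rfl⟩⟩, τ (d.projH g : G) * d.projC g), ?_, ?_⟩
    · simp [d.shearHom_apply, mul_assoc, d.projH_mul_projC]
    · rintro ⟨⟨_, ⟨x, rfl⟩⟩, c⟩ h
      have h' : d.shearHom τ x * c = g := h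
      have h1 : d.projH x = d.projH g := by
        rw [← h', map_mul, d.shearHom_apply, (d.proj_mul _ _).1, d.projH_coe_C, mul_one]
      have h2 : d.shearHom τ x = d.shearHom τ g := by
        rw [d.shearHom_apply, d.shearHom_apply, h1]
      have h3 : d.projC g = (τ (d.projH x : G))⁻¹ * c := by
        rw [← h', map_mul, d.shearHom_apply, (d.proj_mul _ _).2, d.projC_coe_C]
      ext
      · exact h2
      · rw [h3, h1, mul_inv_cancel_left]
  δ := d.δ
  ν := 1
  nilpotent := isNilpotentEnd_one

theorem TwistedReflection.projH_shear (d : TwistedReflection k G) (τ : G →* d.C) (x : G) :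
    ((d.shear τ).projH x : G) = d.shearHom τ x := by
  refine projH_eq (d.shear τ) (c := (τ (d.projH x : G) * d.projC x : d.C)) ⟨x, rfl⟩
    (Subtype.prop _) ?_
  simp [d.shearHom_apply, mul_assoc, d.projH_mul_projC]

theorem TwistedReflection.projC_shear (d : TwistedReflection k G) (τ : G →* d.C) (x : G) :
    (d.shear τ).projC x = d.projC x * τ (d.projH x : G) := by
  refine Subtype.ext (projC_eq (d.shear τ) (h := d.shearHom τ x) ⟨x, rfl⟩ (Subtype.prop _) ?_)
  rw [d.mul_comm_C]
  simp [d.shearHom_apply, mul_assoc, d.projH_mul_projC]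

/-- A reflection turns `φ` from the right into an automorphism whose entry `v` is bijective. -/
theorem exists_mul_reflection (φ : HopfAut k G) : ∃ r : TwistedReflection k G, r.ν = 1 ∧
    Function.Bijective (vPart (φ * r.toAut)) := by
  obtain ⟨d, w, hw, hν⟩ := exists_radical_decomposition_vPart φ
  obtain ⟨j, ρ, hρ, ha⟩ := exists_split_aPart hw hν
  obtain ⟨τ, hτ⟩ := d.exists_bijective_projC_mul ((Subgroup.center G).subtype.comp j) ρ hρ
  let r := d.shear τ
  refine ⟨r, rfl, Finite.injective_iff_bijective.1 ((injective_iff_map_eq_one _).2 fun x hx => ?_)⟩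
  let T : (d.C →* kˣ) ≃* d.C := MulEquiv.ofBijective
    (r.projC.comp ((Subgroup.center G).subtype.comp j)) (by
      convert hτ using 1
      funext ψ
      exact d.projC_shear τ _)
  obtain ⟨S, hS⟩ := exists_transpose_equiv (k := k) d.mul_comm_C T.symm
  let A : d.C →* G := (w : MulAut G).toMonoidHom.comp ((Subgroup.center G).subtype.comp
    ((aPart φ).comp ((MonoidHom.compHom' (r.projC.comp (Subgroup.center G).subtype)).comp
      d.δ.toMonoidHom)))
  -- the contribution of `a` to the `C`-component is invertible by the choice of `τ`; so on the
  -- kernel everything is expressed through `ν`, and radicality applies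
  have hA : ∀ c, S (d.projC (A c)) = d.δ c := by
    intro c
    ext y
    rw [hS]
    have h1 : T.symm y (d.projC (A c)) = d.δ c (T (T.symm y)) := ha _ _
    rw [h1, T.apply_symm_apply]
  have h1 := congrArg w hx
  rw [vPart_mul, r.bPart_toAut, r.vPart_toAut, MonoidHom.one_apply, OneMemClass.coe_one, mul_one,
    d.projH_shear, map_mul, hw, d.shearHom_apply, (d.proj_mul _ _).1, (d.proj_mul _ _).2,
    map_one] at h1
  change A (r.projC x) * _ = 1 at h1
  have hC := congrArg d.projC h1
  rw [map_mul, (d.proj_mul _ _).2, map_one, map_inv, mul_inv_eq_one] at hC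
  have hH := congrArg d.projH h1
  rw [map_mul, (d.proj_mul _ _).1, map_one] at hH
  have hc : r.projC x = d.δ.symm (S (d.ν (τ (d.projH x : G)))) := by
    rw [← hC, hA, d.δ.symm_apply_apply]
  let f : d.C →* d.C := τ.comp (d.H.subtype.comp (d.projH.comp (A.comp
    (S.trans d.δ.symm).toMonoidHom)))
  have hf : f (d.ν (τ (d.projH x : G))) = (τ (d.projH x : G))⁻¹ := by
    change τ (d.projH (A (d.δ.symm (S (d.ν (τ (d.projH x : G)))))) : G) = _
    rw [← hc, eq_inv_iff_mul_eq_one, ← map_mul, ← Subgroup.coe_mul, hH, OneMemClass.coe_one,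
      map_one]
  have hτ1 : τ (d.projH x : G) = 1 := (hν (f.comp (d.ν.comp f))).eq_one (by
    change f (d.ν (f (d.ν _))) = _
    rw [hf, map_inv, map_inv, hf, inv_inv])
  rw [hτ1, map_one, map_one, map_one] at hc
  rw [hc, map_one, map_one, one_mul] at hH
  rw [← r.projH_mul_projC x, hc, d.projH_shear, d.shearHom_apply, hτ1, hH]
  simp

end Factorization

/-! ### Double cosets of twisted reflections -/

section Cells

variable {k G : Type*} [Field k] [IsAlgClosed k] [CharZero k] [Group G] [Fintype G] [DecidableEq G]

theorem diagAut_apply (v w : MulAut G) (h) (F : DrinfeldDouble k G) (s t : G) :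
    (diagAut v w h : HopfAut k G) F (v s, w t) = F (s, t) := by
  conv_lhs => rw [eq_sum_e F]
  conv_rhs => rw [eq_sum_e F]
  rw [map_sum, sum_apply, sum_apply]
  refine Finset.sum_congr rfl fun p _ => ?_
  rw [map_smul, smul_apply, smul_apply, diagAut_e, e_apply, e_apply]
  simp only [v.injective.eq_iff, w.injective.eq_iff]

theorem apply_charVec_aPart_ne_zero (φ : HopfAut k G) (χ : Subgroup.center G →* kˣ) :
    φ (charVec _ 1 χ 1) (1, aPart φ χ) ≠ 0 := by
  rw [apply_charVec, if_pos (by rw [map_one, mul_one]), map_one, map_one, Units.val_one, mul_one]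
  exact charVec_one_one_ne_zero χ

theorem aPart_diagAut_mul (v w : MulAut G) (h) (φ : HopfAut k G) (χ : Subgroup.center G →* kˣ) :
    (aPart (diagAut v w h * φ) χ : G) = w (aPart φ χ) := by
  apply aPart_eq
  have h1 := diagAut_apply v w h (φ (charVec _ 1 χ 1)) 1 (aPart φ χ)
  rw [map_one] at h1
  rw [HopfAut.mul_apply, h1]
  exact apply_charVec_aPart_ne_zero φ χ

theorem aPart_mul_diagAut (v w : MulAut G) (h) (φ : HopfAut k G) (χ : Subgroup.center G →* kˣ) :
    aPart (φ * diagAut v w h) χ = aPart φ (χ.comp (centerAut v⁻¹).toMonoidHom) := by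
  refine Subtype.ext (aPart_eq ?_)
  rw [HopfAut.mul_apply, diagAut_charVec, map_one, map_one]
  exact apply_charVec_aPart_ne_zero φ _

theorem vPart_diagAut_mul (v w : MulAut G) (h) (φ : HopfAut k G) (y : G) :
    vPart (diagAut v w h * φ) y = w (vPart φ y) :=
  vPart_eq (by rw [HopfAut.mul_apply, apply_grp_one, diagAut_grp])

theorem vPart_mul_diagAut (v w : MulAut G) (h) (φ : HopfAut k G) (y : G) :
    vPart (φ * diagAut v w h) y = vPart φ (w y) := by
  have h1 : (1 : G →* kˣ).comp (v⁻¹ : MulAut G).toMonoidHom = 1 := rfl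
  exact vPart_eq (by rw [HopfAut.mul_apply, diagAut_grp, h1, apply_grp_one])

theorem diagAut_mem_VcVB (v w : MulAut G) (h) : (diagAut v w h : HopfAut k G) ∈ VcVB k G :=
  (le_sup_left : VcV k G ≤ VcVB k G) (diagAut_mem_VcV v w h)

theorem diagAut_mem_VcVE (v w : MulAut G) (h) : (diagAut v w h : HopfAut k G) ∈ VcVE k G :=
  (le_sup_left : VcV k G ≤ VcVE k G) (diagAut_mem_VcV v w h)

/-- The entries `a` and `v` determine the double coset, as they determine the left coset of the
upper triangular subgroup. -/
theorem mem_cell_of_eq {φ x y : HopfAut k G} {d : TwistedReflection k G} (hx : x ∈ VcVB k G)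
    (hy : y ∈ VcVE k G) (ha : aPart (x * φ * y) = aPart d.toAut)
    (hv : vPart (x * φ * y) = vPart d.toAut) : φ ∈ d.cell := by
  have h1 := mem_VcVB_iff.2 (aPart_mul_inv_eq_one ha hv)
  rw [TwistedReflection.cell, DoubleCoset.mem_doubleCoset]
  exact ⟨_, Subgroup.mul_mem _ (Subgroup.inv_mem _ hx) h1, _, Subgroup.inv_mem _ hy, by group⟩

/-- Every Hopf automorphism lies in the double coset of a twisted reflection whose twist is
radical. -/
theorem exists_mem_cell (φ : HopfAut k G) :
    ∃ d : TwistedReflection k G, IsRadicalEnd d.ν ∧ φ ∈ d.cell := by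
  obtain ⟨d, w, hw, hν⟩ := exists_radical_decomposition_vPart φ
  obtain ⟨j, ρ, hρ, ha⟩ := exists_split_aPart hw hν
  obtain ⟨τ, hτ⟩ := d.exists_bijective_projC_mul ((Subgroup.center G).subtype.comp j) ρ hρ
  -- right multiplication by an element of `E` moves the values of `a` to `C`
  let pZ : Subgroup.center G →* Subgroup.center G :=
    ((d.H.subtype.comp d.projH).comp (Subgroup.center G).subtype).codRestrict _
      fun z => d.projH_mem_center z.2
  let a₂ : (Subgroup.center G →* kˣ) →* Subgroup.center G := MonoidHom.mk'
    (fun χ => (pZ (centerAut w (aPart φ χ)))⁻¹) fun χ χ' => by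
      rw [map_mul, map_mul, map_mul, mul_inv_rev, center_comm]
  -- right multiplication by an element of `V_c` changes `a` into an isomorphism on `C`
  let m : G →* G := MonoidHom.mk' (fun x => d.shearHom τ x * (j (d.δ (d.projC x)) : G))
    fun x y => by
      have h1 := Subgroup.mem_center_iff.1 (j (d.δ (d.projC x))).2 (d.shearHom τ y)
      rw [map_mul, map_mul, map_mul, map_mul, Subgroup.coe_mul, mul_assoc, mul_assoc,
        ← mul_assoc (d.shearHom τ y), h1, mul_assoc]
  have hmC : ∀ c : d.C, m c = j (d.δ c) := by
    intro c
    change d.shearHom τ c * _ = _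
    rw [d.projC_coe_C, d.shearHom_apply, d.projH_coe_C]
    simp
  have hm : Function.Bijective m := by
    refine Finite.injective_iff_bijective.1 ((injective_iff_map_eq_one _).2 fun x hx => ?_)
    have h0 : (d.projH x : G) * ((τ (d.projH x : G))⁻¹ : d.C) * (j (d.δ (d.projC x)) : G) = 1 := hx
    have h1 := congrArg d.projH h0
    rw [map_mul, (d.proj_mul _ _).1, map_one] at h1
    have h2 := congrArg d.projC h0
    rw [map_mul, (d.proj_mul _ _).2, map_one] at h2
    have h3 : d.projC (j (d.δ (d.projC x)) : G) *
        τ (d.projH (j (d.δ (d.projC x)) : G) : G) = 1 := by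
      rw [eq_inv_of_mul_eq_one_right h1, Subgroup.coe_inv, map_inv, d.mul_comm_C, h2]
    have h4 : d.δ (d.projC x) = 1 := hτ.1 (h3.trans (by simp))
    rw [(map_eq_one_iff _ d.δ.injective)] at h4
    rw [h4, map_one, map_one, OneMemClass.coe_one, map_one, mul_one] at h1
    rw [← d.projH_mul_projC x, h1, h4]
    simp
  let w₁ : MulAut G := MulEquiv.ofBijective m hm
  have hw₁ : ∀ x, w₁ x * ((1 : MulAut G) x)⁻¹ ∈ Subgroup.center G := by
    intro x
    have h1 : w₁ x * ((1 : MulAut G) x)⁻¹ = d.projH x *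
        (((τ (d.projH x : G))⁻¹ : d.C) * j (d.δ (d.projC x)) * (d.projC x : G)⁻¹) *
          (d.projH x : G)⁻¹ := by
      change (d.projH x : G) * ((τ (d.projH x : G))⁻¹ : d.C) * (j (d.δ (d.projC x)) : G) * x⁻¹ = _
      conv_lhs => enter [2]; rw [← d.projH_mul_projC x]
      simp only [mul_inv_rev, mul_assoc]
    have h2 : (((τ (d.projH x : G))⁻¹ : d.C) * j (d.δ (d.projC x)) * (d.projC x : G)⁻¹ : G) ∈
        Subgroup.center G := Subgroup.mul_mem _ (Subgroup.mul_mem _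
          (d.C_le_center (Subtype.prop _)) (Subtype.prop _))
          (Subgroup.inv_mem _ (d.C_le_center (Subtype.prop _)))
    rw [h1, Subgroup.mem_center_iff.1 h2, mul_inv_cancel_right]
    exact h2
  have hw₁j : ∀ ψ, w₁⁻¹ (j ψ : G) = d.δ.symm ψ := by
    intro ψ
    apply w₁.injective
    rw [MulAut.apply_inv_self]
    change _ = m (d.δ.symm ψ : d.C)
    rw [hmC, d.δ.apply_symm_apply]
  obtain ⟨δ, hδ⟩ := exists_transpose_equiv (k := k) d.mul_comm_C d.δ
  have hδ' : ∀ (κ ψ : d.C →* kˣ), ψ (δ.symm κ) = κ (d.δ.symm ψ) := by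
    intro κ ψ
    rw [← d.δ.apply_symm_apply ψ, ← hδ, δ.apply_symm_apply, d.δ.apply_symm_apply]
  let r : TwistedReflection k G := { d with δ := δ }
  refine ⟨r, hν, mem_cell_of_eq (x := diagAut w w (by simp)) (y := homE k G a₂ * diagAut w₁ 1 hw₁)
    (diagAut_mem_VcVB _ _ _) (Subgroup.mul_mem _ ?_ (diagAut_mem_VcVE _ _ _)) ?_ ?_⟩
  · exact (le_sup_right : E k G ≤ VcVE k G) ⟨a₂, rfl⟩
  · ext χ
    rw [← mul_assoc, aPart_mul_diagAut, aPart_mul_homE, aPart_diagAut_mul, vPart_diagAut_mul, hw,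
      r.aPart_toAut]
    set χ' := χ.comp (centerAut w₁⁻¹).toMonoidHom with hχ'
    set W : G := w (aPart φ χ') with hW
    have h1 : (a₂ χ' : G) = ((d.projH W)⁻¹ : d.H) := rfl
    have h2 : W * ((d.projH (a₂ χ' : G) : G) * (d.ν (d.projC (a₂ χ' : G)) : d.C)) = d.projC W := by
      rw [h1, d.projH_coe_H, d.projC_coe_H, map_one, OneMemClass.coe_one, mul_one, Subgroup.coe_inv,
        mul_inv_eq_iff_eq_mul, ← d.commute _ (d.projH W).2 _ (d.projC W).2, d.projH_mul_projC]
    rw [h2]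
    congr 1
    refine mul_inv_eq_one.1 (eq_one_of_forall_char (k := k) d.mul_comm_C fun ψ => ?_)
    rw [map_mul, map_inv, mul_inv_eq_one]
    change _ = ψ (δ.symm _)
    rw [hδ', ha]
    change χ _ = χ _
    congr 1
    exact Subtype.ext (hw₁j ψ)
  · ext y
    rw [← mul_assoc, vPart_mul_diagAut, vPart_mul_homE, vPart_diagAut_mul, hw, r.vPart_toAut]
    rfl

theorem TwistedReflection.ker_projH (d : TwistedReflection k G) (g : G) :
    d.projH g = 1 ↔ g ∈ d.C := by
  constructor
  · intro h
    rw [← d.projH_mul_projC g, h, OneMemClass.coe_one, one_mul]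
    exact (d.projC g).2
  · intro h
    exact d.projH_coe_C ⟨g, h⟩

/-- The entry `v` of a reflection is the projection to `H`, with kernel `C`, and the entry `v` of an
element of its double coset is obtained from it by composition with automorphisms of `G`. -/
theorem nonempty_mulEquiv_of_cell_eq {d d' : TwistedReflection k G} (hd : d.ν = 1)
    (hd' : d'.ν = 1) (h : d.cell = d'.cell) : Nonempty (d.C ≃* d'.C) := by
  have h1 : d.toAut ∈ d'.cell := by
    rw [← h]; exact DoubleCoset.mem_doubleCoset_self _ _ _
  obtain ⟨x, hx, y, hy, hxy⟩ := DoubleCoset.mem_doubleCoset.1 h1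
  have hax := mem_VcVB_iff.1 hx
  have hby := mem_VcVE_iff.1 hy
  have hvx := vPart_bijective_of_aPart hax
  have hvy := vPart_bijective_of_bPart hby
  have h2 : ∀ g, (d.projH g : G) = vPart x (d'.projH (vPart y g)) := by
    intro g
    have h3 := d.vPart_toAut g
    rw [hd, MonoidHom.one_apply, OneMemClass.coe_one, mul_one, hxy, mul_assoc, vPart_mul, hax,
      vPart_mul, hby, d'.vPart_toAut, hd'] at h3
    rw [← h3]
    have h4 : ((1 : G →* (G →* kˣ)) g).comp (Subgroup.center G).subtype = 1 := rfl
    rw [h4, map_one]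
    simp
  let v := MulEquiv.ofBijective (vPart y) hvy
  have h3 : d.C.map v.toMonoidHom = d'.C := by
    ext g
    rw [Subgroup.mem_map_equiv, ← d.ker_projH, ← d'.ker_projH, ← OneMemClass.coe_eq_one, h2,
      map_eq_one_iff _ hvx.1, OneMemClass.coe_eq_one]
    exact Eq.congr (congrArg d'.projH (v.apply_symm_apply g)) rfl
  exact ⟨(v.subgroupMap d.C).trans (MulEquiv.subgroupCongr h3)⟩

/-- By cancellation `H ≅ H'`. An element of `V` on the left and of `V_c ⋊ V` on the right take one
reflection to the other in the entries `a` and `v`; the isomorphism `μ` from which the right factor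
is built is the transpose of `i⁻¹` with respect to `δ` and `δ'`. -/
theorem cell_eq_of_mulEquiv {d d' : TwistedReflection k G} (hd : d.ν = 1) (hd' : d'.ν = 1)
    (i : d.C ≃* d'.C) : d.cell = d'.cell := by
  obtain ⟨l⟩ := nonempty_mulEquiv_of_prod (d.prodEquiv.trans d'.prodEquiv.symm) i
  obtain ⟨t, ht⟩ := exists_transpose_equiv (k := k) d.mul_comm_C (i.symm.trans d.δ)
  obtain ⟨s, hs⟩ := exists_transpose_equiv (k := k) d'.mul_comm_C d'.δ
  let μ : d.C ≃* d'.C := t.trans s.symm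
  have hμ : ∀ (κ : d'.C →* kˣ) c, κ (μ c) = d.δ (i.symm (d'.δ.symm κ)) c := by
    intro κ c
    have h1 := hs (μ c) (d'.δ.symm κ)
    rw [d'.δ.apply_symm_apply] at h1
    rw [← h1, show s (μ c) = t c from s.apply_symm_apply _, ht]
    rfl
  let f : (d.C ≃* d'.C) → MulAut G := fun i =>
    d.prodEquiv.symm.trans ((l.prodCongr i).trans d'.prodEquiv)
  have hf : ∀ (i : d.C ≃* d'.C) h c, f i ((h : d.H) * (c : d.C) : G) = l h * i c := by
    intro i h c
    change d'.prodEquiv ((l.prodCongr i) (d.prodEquiv.symm (d.prodEquiv (h, c)))) = _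
    rw [MulEquiv.symm_apply_apply]
    rfl
  have hfs : ∀ (i : d.C ≃* d'.C) g, (f i)⁻¹ g = l.symm (d'.projH g) * i.symm (d'.projC g) := by
    intro i g
    apply (f i).injective
    rw [MulAut.apply_inv_self, hf, l.apply_symm_apply, i.apply_symm_apply, d'.projH_mul_projC]
  have hcond : ∀ g, (f μ)⁻¹ g * ((f i)⁻¹ g)⁻¹ ∈ Subgroup.center G := by
    intro g
    have h1 : ((μ.symm (d'.projC g) : d.C) * (i.symm (d'.projC g) : G)⁻¹ : G) ∈
        Subgroup.center G := Subgroup.mul_mem _ (d.C_le_center (Subtype.prop _))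
          (Subgroup.inv_mem _ (d.C_le_center (Subtype.prop _)))
    have h2 : (f μ)⁻¹ g * ((f i)⁻¹ g)⁻¹ = l.symm (d'.projH g) *
        ((μ.symm (d'.projC g) : d.C) * (i.symm (d'.projC g) : G)⁻¹) *
          (l.symm (d'.projH g) : G)⁻¹ := by
      rw [hfs, hfs]; simp only [mul_inv_rev, mul_assoc]
    rw [h2, Subgroup.mem_center_iff.1 h1, mul_inv_cancel_right]
    exact h1
  refine DoubleCoset.doubleCoset_eq_of_mem (mem_cell_of_eq
    (x := diagAut (f i) (f i) (by simp)) (y := diagAut (f μ)⁻¹ (f i)⁻¹ hcond)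
    (diagAut_mem_VcVB _ _ _) (diagAut_mem_VcVE _ _ _) ?_ ?_)
  · ext χ
    rw [aPart_mul_diagAut, aPart_diagAut_mul, d.aPart_toAut, d'.aPart_toAut]
    have h1 := hf i 1 (d.δ.symm ((χ.comp (centerAut ((f μ)⁻¹)⁻¹).toMonoidHom).comp
      (Subgroup.inclusion d.C_le_center)))
    rw [map_one, OneMemClass.coe_one, OneMemClass.coe_one, one_mul, one_mul] at h1
    rw [h1]
    congr 1
    rw [← MulEquiv.eq_symm_apply, MulEquiv.symm_apply_eq]
    ext c
    rw [← hμ]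
    congr 1
    change χ _ = χ _
    congr 1
    refine Subtype.ext ?_
    change ((f μ)⁻¹)⁻¹ (c : G) = μ c
    have h2 := hf μ 1 c
    rw [map_one, OneMemClass.coe_one, OneMemClass.coe_one, one_mul, one_mul] at h2
    rw [inv_inv, h2]
  · ext y
    rw [vPart_mul_diagAut, vPart_diagAut_mul, d.vPart_toAut, d'.vPart_toAut, hd, hd']
    have h1 : d.projH ((f i)⁻¹ y) = l.symm (d'.projH y) := by
      rw [hfs, (d.proj_mul _ _).1]
    have h2 := hf i (l.symm (d'.projH y)) 1
    rw [map_one, OneMemClass.coe_one, OneMemClass.coe_one, mul_one, mul_one,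
      l.apply_symm_apply] at h2
    rw [h1, MonoidHom.one_apply, MonoidHom.one_apply, OneMemClass.coe_one, OneMemClass.coe_one,
      mul_one, mul_one, h2]

theorem cell_eq_iff {d d' : TwistedReflection k G} (hd : d.ν = 1) (hd' : d'.ν = 1) :
    d.cell = d'.cell ↔ Nonempty (d.C ≃* d'.C) :=
  ⟨nonempty_mulEquiv_of_cell_eq hd hd', fun ⟨i⟩ => cell_eq_of_mulEquiv hd hd' i⟩

theorem exists_eq_reflection_mul (φ : HopfAut k G) : ∃ d : TwistedReflection k G, d.ν = 1 ∧
    ∃ b ∈ B k G, ∃ y ∈ VcVE k G, φ = d.toAut * (b * y) := by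
  obtain ⟨d, hd, hv⟩ := exists_reflection_mul φ
  obtain ⟨b, hb, y, hy, h⟩ := exists_mem_B_mul_mem_VcVE hv
  exact ⟨d, hd, b, hb, y, hy, by rw [← h, ← mul_assoc, d.toAut_mul_self hd, one_mul]⟩

theorem exists_eq_mul_reflection (φ : HopfAut k G) : ∃ d : TwistedReflection k G, d.ν = 1 ∧
    ∃ x ∈ VcVB k G, ∃ a ∈ E k G, φ = (x * a) * d.toAut := by
  obtain ⟨d, hd, hv⟩ := exists_mul_reflection φ
  obtain ⟨x, hx, a, ha, h⟩ := exists_mem_VcVB_mul_mem_E hv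
  exact ⟨d, hd, x, hx, a, ha, by rw [← h, mul_assoc, d.toAut_mul_self hd, mul_one]⟩

theorem closure_eq_top : Subgroup.closure ((V k G : Set (HopfAut k G)) ∪
    Vc k G ∪ B k G ∪ E k G ∪ reflections k G) = ⊤ := by
  rw [eq_top_iff]
  rintro φ -
  obtain ⟨d, hd, b, hb, y, hy, rfl⟩ := exists_eq_reflection_mul φ
  set K := Subgroup.closure ((V k G : Set (HopfAut k G)) ∪
    Vc k G ∪ B k G ∪ E k G ∪ reflections k G)
  have hle : VcVE k G ≤ K := by
    refine sup_le (sup_le ?_ ?_) ?_ <;> intro z hz <;> refine Subgroup.subset_closure ?_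
    · exact Or.inl (Or.inl (Or.inl (Or.inr hz)))
    · exact Or.inl (Or.inl (Or.inl (Or.inl hz)))
    · exact Or.inl (Or.inr hz)
  exact Subgroup.mul_mem _ (Subgroup.subset_closure (Or.inr ⟨d, hd, rfl⟩))
    (Subgroup.mul_mem _ (Subgroup.subset_closure (Or.inl (Or.inl (Or.inr hb)))) (hle hy))

end Cells

/-! ### Commutative groups: all elements of the double are combinations of group-likes -/

section Commutative

variable {k G : Type*} [Field k] [IsAlgClosed k] [CharZero k] [Group G] [Fintype G] [DecidableEq G]

theorem span_grp (hG : ∀ a b : G, a * b = b * a) :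
    Submodule.span k (Set.range fun p : (G →* kˣ) × G => (grp p.1 p.2 : DrinfeldDouble k G)) =
      ⊤ := by
  have hZ : (⊤ : Subgroup G) ≤ Subgroup.center G := fun a _ =>
    Subgroup.mem_center_iff.2 fun b => hG b a
  rw [eq_top_iff, ← span_charVec hZ, Submodule.span_le]
  rintro _ ⟨x, χ, y, rfl⟩
  have h1 : charVec (⊤ : Subgroup G) x χ y = ((χ ⟨x, trivial⟩)⁻¹ : kˣ) •
      charVec (⊤ : Subgroup G) 1 χ y := by
    rw [← charVec_mul_mem, one_mul]
  have h2 : charVec (⊤ : Subgroup G) 1 χ y = (Nat.card (⊤ : Subgroup G) : k)⁻¹ •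
      grp (χ.comp Subgroup.topEquiv.symm.toMonoidHom) y := by
    classical
    rw [charVec, grp_eq_sum, ← Equiv.sum_comp (Subgroup.topEquiv : (⊤ : Subgroup G) ≃* G).toEquiv]
    congr 1
    refine Finset.sum_congr rfl fun a _ => ?_
    rw [one_mul]
    rfl
  rw [h1, h2, Units.smul_def]
  exact Submodule.smul_mem _ _ (Submodule.smul_mem _ _ (Submodule.subset_span
    ⟨(χ.comp Subgroup.topEquiv.symm.toMonoidHom, y), rfl⟩))

/-- For commutative `G` the group-like elements form a basis of `DG`. -/
theorem exists_basis_grp (hG : ∀ a b : G, a * b = b * a) :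
    ∃ β : Module.Basis ((G →* kˣ) × G) k (DrinfeldDouble k G), ∀ p, β p = grp p.1 p.2 := by
  obtain ⟨i⟩ := exists_dual (k := k) hG
  have hfin : Finite (G →* kˣ) := Finite.of_equiv _ i.toEquiv
  let _ : Fintype (G →* kˣ) := Fintype.ofFinite _
  have hcard : Fintype.card ((G →* kˣ) × G) = Module.finrank k (DrinfeldDouble k G) := by
    rw [Module.finrank_eq_card_basis (stdBasis k G), Fintype.card_prod, Fintype.card_prod,
      ← Fintype.card_congr i.toEquiv]
  refine ⟨basisOfTopLeSpanOfCardEqFinrank (fun p : (G →* kˣ) × G =>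
    (grp p.1 p.2 : DrinfeldDouble k G)) (span_grp hG).ge hcard, fun p => ?_⟩
  rw [coe_basisOfTopLeSpanOfCardEqFinrank]

/-- The action of `Aut_Hopf(DG)` on the group-like elements. -/
noncomputable def glAut (k G : Type*) [Field k] [IsAlgClosed k] [CharZero k] [Group G] [Fintype G]
    [DecidableEq G] : HopfAut k G →* MulAut ((G →* kˣ) × G) where
  toFun φ := MulEquiv.mk' ⟨glMap φ, glMap φ⁻¹,
    fun p => by rw [← glMap_mul, inv_mul_cancel, glMap_one],
    fun p => by rw [← glMap_mul, mul_inv_cancel, glMap_one]⟩ (map_mul (glMap φ))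
  map_one' := MulEquiv.ext glMap_one
  map_mul' φ ψ := MulEquiv.ext (glMap_mul φ ψ)

theorem glAut_apply (φ : HopfAut k G) (p : (G →* kˣ) × G) : glAut k G φ p = glMap φ p := rfl

theorem glAut_injective (hG : ∀ a b : G, a * b = b * a) : Function.Injective (glAut k G) := by
  intro φ ψ h
  obtain ⟨β, hβ⟩ := exists_basis_grp (k := k) hG
  have h1 : (φ : DrinfeldDouble k G →ₐc[k] DrinfeldDouble k G).toCoalgHom.toLinearMap =
      (ψ : DrinfeldDouble k G →ₐc[k] DrinfeldDouble k G).toCoalgHom.toLinearMap := by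
    refine β.ext fun p => ?_
    rw [hβ]
    change φ (grp p.1 p.2) = ψ (grp p.1 p.2)
    have h2 : glMap φ p = glMap ψ p := DFunLike.congr_fun h p
    rw [apply_grp, apply_grp, h2]
  exact BialgEquiv.ext fun F => LinearMap.congr_fun h1 F

theorem glAut_surjective (hG : ∀ a b : G, a * b = b * a) : Function.Surjective (glAut k G) := by
  intro f
  obtain ⟨β, hβ⟩ := exists_basis_grp (k := k) hG
  let L : MulAut ((G →* kˣ) × G) → DrinfeldDouble k G →ₗ[k] DrinfeldDouble k G := fun f =>
    β.constr k fun p => grp (f p).1 (f p).2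
  have hL : ∀ f χ y, L f (grp χ y) = grp (f (χ, y)).1 (f (χ, y)).2 := by
    intro f χ y
    have h1 := β.constr_basis k (fun p => (grp (f p).1 (f p).2 : DrinfeldDouble k G)) (χ, y)
    rwa [hβ] at h1
  let φ : HopfAut k G := mkAut _ (span_grp hG) (L f) (L f⁻¹)
    (by
      rintro _ ⟨p, rfl⟩
      rw [hL, hL, Prod.mk.eta, MulAut.apply_inv_self])
    (by
      rintro _ ⟨p, rfl⟩
      rw [hL, hL, Prod.mk.eta, MulAut.inv_apply_self])
    (by
      rintro _ ⟨p, rfl⟩ _ ⟨q, rfl⟩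
      rw [grp_mul_grp, hL, hL, hL, grp_mul_grp]
      have h1 : ((p.1 * q.1, p.2 * q.2) : (G →* kˣ) × G) = (p.1, p.2) * (q.1, q.2) := rfl
      rw [h1, map_mul]
      rfl)
    (by
      rintro _ ⟨p, rfl⟩
      rw [hL, (isGroupLikeElem_grp _ _).counit_eq_one, (isGroupLikeElem_grp _ _).counit_eq_one])
    (by
      rintro _ ⟨p, rfl⟩
      rw [(isGroupLikeElem_grp _ _).comul_eq_tmul_self, TensorProduct.map_tmul, hL,
        (isGroupLikeElem_grp _ _).comul_eq_tmul_self])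
  refine ⟨φ, MulEquiv.ext fun p => ?_⟩
  exact glMap_eq (hL f p.1 p.2)

end Commutative

/-! ### Elementary abelian groups -/

section Elementary

theorem nonempty_linearEquiv_of_card {p : ℕ} [Fact p.Prime] {C D : Type*} [AddCommGroup C]
    [AddCommGroup D] [Finite C] [Finite D] [Module (ZMod p) C] [Module (ZMod p) D]
    (h : Nat.card C = Nat.card D) : Nonempty (C ≃ₗ[ZMod p] D) := by
  refine FiniteDimensional.nonempty_linearEquiv_of_finrank_eq
    (Nat.pow_right_injective (Fact.out : p.Prime).two_le ?_)
  change p ^ _ = p ^ _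
  rw [FiniteField.pow_finrank_eq_natCard p C, FiniteField.pow_finrank_eq_natCard p D, h]

theorem nonempty_mulEquiv_of_card {p : ℕ} [Fact p.Prime] {C D : Type*} [Group C] [Group D]
    [Finite C] [Finite D] (hC : ∀ a b : C, a * b = b * a) (hD : ∀ a b : D, a * b = b * a)
    (hpC : ∀ a : C, a ^ p = 1) (hpD : ∀ a : D, a ^ p = 1) (h : Nat.card C = Nat.card D) :
    Nonempty (C ≃* D) := by
  let _ : CommGroup C := { (inferInstance : Group C) with mul_comm := hC }
  let _ : CommGroup D := { (inferInstance : Group D) with mul_comm := hD }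
  let _ : Module (ZMod p) (Additive C) := AddCommGroup.zmodModule hpC
  let _ : Module (ZMod p) (Additive D) := AddCommGroup.zmodModule hpD
  obtain ⟨i⟩ := nonempty_linearEquiv_of_card (C := Additive C) (D := Additive D) (p := p) h
  exact ⟨MulEquiv.toAdditive.symm i.toAddEquiv⟩

/-- A radical endomorphism of an elementary abelian group is trivial. -/
theorem IsRadicalEnd.eq_one_of_coord {C : Type*} [Group C] {ν : C →* C} (hν : IsRadicalEnd ν)
    {p n : ℕ} [Fact p.Prime] (Y : C →* Multiplicative (Fin n → ZMod p))
    (hY : Function.Injective Y) : ν = 1 := by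
  have hpC : ∀ a : C, a ^ p = 1 := by
    intro a
    apply hY
    rw [map_pow, map_one]
    change p • Multiplicative.toAdd (Y a) = 0
    ext i
    simp
  ext x
  by_contra hne
  obtain ⟨i, hi⟩ : ∃ i, Multiplicative.toAdd (Y (ν x)) i ≠ 0 := by
    by_contra hc
    push Not at hc
    exact hne (hY ((congrArg Multiplicative.ofAdd (funext hc)).trans (map_one Y).symm))
  set a := Multiplicative.toAdd (Y (ν x)) i with ha
  let f : C →* C := MonoidHom.mk' (fun c => x ^ (a⁻¹ * Multiplicative.toAdd (Y c) i).val)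
    fun c c' => by
      rw [map_mul, toAdd_mul, Pi.add_apply, mul_add, ZMod.val_add, ← pow_eq_pow_mod _ (hpC x),
        pow_add]
  have hf : f (ν x) = x := by
    change x ^ (a⁻¹ * a).val = x
    rw [inv_mul_cancel₀ hi, ZMod.val_one, pow_one]
  have hx : x = 1 := (hν f).eq_one hf
  exact hne (by rw [hx, map_one, map_one])

/-- Coordinates on `G ≅ F_pⁿ` and on its dual in which the evaluation pairing is the standard
bilinear form followed by an additive character `ζ` of `F_p`. -/
structure Coordinates (k G : Type*) [Field k] [Group G] (p n : ℕ) where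
  /-- the coordinates on `G` -/
  coord : G ≃* Multiplicative (Fin n → ZMod p)
  /-- the coordinates on the dual of `G` -/
  dual : (G →* kˣ) ≃* Multiplicative (Fin n → ZMod p)
  /-- the additive character -/
  ζ : AddChar (ZMod p) kˣ
  /-- the additive character is faithful -/
  eq_zero : ∀ a, ζ a = 1 → a = 0
  /-- the evaluation pairing in coordinates -/
  apply_eq : ∀ χ g, χ g = ζ (Multiplicative.toAdd (dual χ) ⬝ᵥ Multiplicative.toAdd (coord g))

theorem nonempty_coordinates (k : Type*) {G : Type*} [Field k] [IsAlgClosed k] [CharZero k]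
    [Group G] {p n : ℕ} [Fact p.Prime] (Y : G ≃* Multiplicative (Fin n → ZMod p)) :
    Nonempty (Coordinates k G p n) := by
  have hfin : Finite G := Finite.of_equiv _ Y.symm.toEquiv
  have hG : ∀ a b : G, a * b = b * a := fun a b => by
    apply Y.injective; rw [map_mul, map_mul, mul_comm]
  have hp : NeZero (p : k) := ⟨Nat.cast_ne_zero.2 (Fact.out : p.Prime).ne_zero⟩
  obtain ⟨z, hz⟩ := HasEnoughRootsOfUnity.exists_primitiveRoot k p
  obtain ⟨u, rfl⟩ := hz.isUnit (Fact.out : p.Prime).ne_zero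
  have hu : IsPrimitiveRoot u p := IsPrimitiveRoot.coe_units_iff.1 hz
  let ζ : AddChar (ZMod p) kˣ := AddChar.zmodChar p hu.pow_eq_one
  have hζ : ∀ a, ζ a = 1 → a = 0 := by
    intro a ha
    rw [AddChar.zmodChar_apply, ← pow_zero u] at ha
    exact (ZMod.val_eq_zero a).1 (hu.pow_inj (ZMod.val_lt a) (NeZero.pos _) ha)
  let D : Multiplicative (Fin n → ZMod p) →* (G →* kˣ) :=
    { toFun := fun x => MonoidHom.mk' (fun g => ζ (x.toAdd ⬝ᵥ (Y g).toAdd)) fun g h => by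
        rw [map_mul, toAdd_mul, dotProduct_add, AddChar.map_add_eq_mul]
      map_one' := by
        ext g
        simp [AddChar.map_zero_eq_one]
      map_mul' := fun x y => by
        ext g
        simp [add_dotProduct, AddChar.map_add_eq_mul] }
  have hD : Function.Injective D := by
    rw [injective_iff_map_eq_one]
    intro x hx
    refine Multiplicative.toAdd.injective (funext fun i => hζ _ ?_)
    have h1 : ζ (x.toAdd ⬝ᵥ (Y (Y.symm (Multiplicative.ofAdd (Pi.single i 1)))).toAdd) = 1 :=
      DFunLike.congr_fun hx _
    rwa [Y.apply_symm_apply, toAdd_ofAdd, dotProduct_single, mul_one] at h1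
  obtain ⟨j⟩ := exists_dual (k := k) hG
  have : Finite (G →* kˣ) := Finite.of_equiv _ j.toEquiv
  let D' := MulEquiv.ofBijective D ((Nat.bijective_iff_injective_and_card D).2
    ⟨hD, Nat.card_congr (Y.symm.toEquiv.trans j.toEquiv)⟩)
  refine ⟨⟨Y, D'.symm, ζ, hζ, fun χ g => ?_⟩⟩
  conv_lhs => rw [← D'.apply_symm_apply χ]
  rfl

end Elementary

/-! ### Matrices of Hopf automorphisms for elementary abelian groups -/

namespace Coordinates

section General

variable {k G : Type*} [Field k] [Group G] {p n : ℕ} (K : Coordinates k G p n)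

/-- The coordinate vector of a character of `G`. -/
def x (χ : G →* kˣ) : Fin n → ZMod p := Multiplicative.toAdd (K.dual χ)

/-- The coordinate vector of an element of `G`. -/
def y (g : G) : Fin n → ZMod p := Multiplicative.toAdd (K.coord g)

theorem x_mul (χ ψ : G →* kˣ) : K.x (χ * ψ) = K.x χ + K.x ψ := congrArg _ (map_mul K.dual χ ψ)
theorem y_mul (g h : G) : K.y (g * h) = K.y g + K.y h := congrArg _ (map_mul K.coord g h)
theorem x_one : K.x 1 = 0 := congrArg _ (map_one K.dual)
theorem y_one : K.y 1 = 0 := congrArg _ (map_one K.coord)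

theorem x_injective : Function.Injective K.x := K.dual.injective
theorem y_injective : Function.Injective K.y := K.coord.injective
theorem x_surjective : Function.Surjective K.x := K.dual.surjective
theorem y_surjective : Function.Surjective K.y := K.coord.surjective

/-- A map into `G` that is additive in coordinates. -/
noncomputable def liftY {A : Type*} [Group A] (f : A → Fin n → ZMod p)
    (hf : ∀ a b, f (a * b) = f a + f b) : A →* G :=
  MonoidHom.mk' (fun a => K.coord.symm (Multiplicative.ofAdd (f a))) fun a b => by
    rw [hf, ofAdd_add, map_mul]

theorem y_liftY {A : Type*} [Group A] (f : A → Fin n → ZMod p)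
    (hf : ∀ a b, f (a * b) = f a + f b) (a : A) : K.y (K.liftY f hf a) = f a :=
  congrArg Multiplicative.toAdd (K.coord.apply_symm_apply _)

/-- A map into the dual of `G` that is additive in coordinates. -/
noncomputable def liftX {A : Type*} [Group A] (f : A → Fin n → ZMod p)
    (hf : ∀ a b, f (a * b) = f a + f b) : A →* (G →* kˣ) :=
  MonoidHom.mk' (fun a => K.dual.symm (Multiplicative.ofAdd (f a))) fun a b => by
    rw [hf, ofAdd_add, map_mul]

theorem x_liftX {A : Type*} [Group A] (f : A → Fin n → ZMod p)
    (hf : ∀ a b, f (a * b) = f a + f b) (a : A) : K.x (K.liftX f hf a) = f a :=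
  congrArg Multiplicative.toAdd (K.dual.apply_symm_apply _)

theorem char_eq (χ : G →* kˣ) (g : G) : χ g = K.ζ (K.x χ ⬝ᵥ K.y g) := K.apply_eq χ g

theorem eq_of_forall_char {u v : Fin n → ZMod p}
    (h : ∀ g, K.ζ (u ⬝ᵥ K.y g) = K.ζ (v ⬝ᵥ K.y g)) : u = v := by
  obtain ⟨χ, rfl⟩ := K.x_surjective u
  obtain ⟨ψ, rfl⟩ := K.x_surjective v
  exact congrArg K.x (MonoidHom.ext fun g => by rw [K.char_eq, K.char_eq, h])

/-- The coordinate vector of an element of `Ĝ × G`. -/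
def vec (q : (G →* kˣ) × G) : Fin n ⊕ Fin n → ZMod p := Sum.elim (K.x q.1) (K.y q.2)

theorem vec_mul (q r : (G →* kˣ) × G) : K.vec (q * r) = K.vec q + K.vec r := by
  rw [vec, Prod.fst_mul, Prod.snd_mul, K.x_mul, K.y_mul]
  ext (i | i) <;> rfl

theorem vec_injective : Function.Injective K.vec := fun _ _ h =>
  Prod.ext (K.x_injective (funext fun i => congrFun h (Sum.inl i)))
    (K.y_injective (funext fun i => congrFun h (Sum.inr i)))

theorem vec_surjective : Function.Surjective K.vec := fun v => by
  obtain ⟨χ, hχ⟩ := K.x_surjective (v ∘ Sum.inl)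
  obtain ⟨g, hg⟩ := K.y_surjective (v ∘ Sum.inr)
  exact ⟨(χ, g), by rw [vec, hχ, hg, Sum.elim_comp_inl_inr]⟩

/-- `vec` as a bijection. -/
noncomputable def vecEquiv : ((G →* kˣ) × G) ≃ (Fin n ⊕ Fin n → ZMod p) :=
  Equiv.ofBijective K.vec ⟨K.vec_injective, K.vec_surjective⟩

theorem vec_vecEquiv_symm (v : Fin n ⊕ Fin n → ZMod p) : K.vec (K.vecEquiv.symm v) = v :=
  K.vecEquiv.apply_symm_apply v

theorem matrix_ext {A B : Matrix (Fin n ⊕ Fin n) (Fin n ⊕ Fin n) (ZMod p)}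
    (h : ∀ q, A.mulVec (K.vec q) = B.mulVec (K.vec q)) : A = B := by
  refine Matrix.ext_of_mulVec_single fun i => ?_
  obtain ⟨q, hq⟩ := K.vec_surjective (Pi.single i 1)
  rw [← hq, h]

theorem matrix_ext_x {A B : Matrix (Fin n) (Fin n) (ZMod p)}
    (h : ∀ χ, A.mulVec (K.x χ) = B.mulVec (K.x χ)) : A = B := by
  refine Matrix.ext_of_mulVec_single fun i => ?_
  obtain ⟨q, hq⟩ := K.x_surjective (Pi.single i 1)
  rw [← hq, h]

theorem matrix_ext_y {A B : Matrix (Fin n) (Fin n) (ZMod p)}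
    (h : ∀ g, A.mulVec (K.y g) = B.mulVec (K.y g)) : A = B := by
  refine Matrix.ext_of_mulVec_single fun i => ?_
  obtain ⟨q, hq⟩ := K.y_surjective (Pi.single i 1)
  rw [← hq, h]

/-- The automorphism of `Ĝ × G` with a given matrix. -/
noncomputable def mulAutOfMatrix : GL (Fin n ⊕ Fin n) (ZMod p) →* MulAut ((G →* kˣ) × G) where
  toFun g := MulEquiv.mk' ⟨fun q => K.vecEquiv.symm (g.val.mulVec (K.vec q)),
      fun q => K.vecEquiv.symm ((g⁻¹).val.mulVec (K.vec q)),
      fun q => K.vec_injective (by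
        rw [vec_vecEquiv_symm, vec_vecEquiv_symm, Matrix.mulVec_mulVec, ← Units.val_mul,
          inv_mul_cancel, Units.val_one, Matrix.one_mulVec]),
      fun q => K.vec_injective (by
        rw [vec_vecEquiv_symm, vec_vecEquiv_symm, Matrix.mulVec_mulVec, ← Units.val_mul,
          mul_inv_cancel, Units.val_one, Matrix.one_mulVec])⟩
    fun q r => K.vec_injective (by
      simp only [Equiv.coe_fn_mk, vec_vecEquiv_symm, vec_mul, Matrix.mulVec_add])
  map_one' := MulEquiv.ext fun q => K.vec_injective (by
    exact (K.vec_vecEquiv_symm _).trans (Matrix.one_mulVec _))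
  map_mul' g h := MulEquiv.ext fun q => K.vec_injective (by
    refine (K.vec_vecEquiv_symm _).trans (Eq.trans ?_ (K.vec_vecEquiv_symm _).symm)
    refine (Matrix.mulVec_mulVec _ _ _).symm.trans (congrArg _ ?_)
    exact (K.vec_vecEquiv_symm _).symm)

theorem vec_mulAutOfMatrix (g : GL (Fin n ⊕ Fin n) (ZMod p)) (q : (G →* kˣ) × G) :
    K.vec (K.mulAutOfMatrix g q) = g.val.mulVec (K.vec q) := K.vec_vecEquiv_symm _

theorem mulAutOfMatrix_bijective : Function.Bijective K.mulAutOfMatrix := by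
  constructor
  · intro g h hgh
    refine Units.ext (K.matrix_ext fun q => ?_)
    rw [← vec_mulAutOfMatrix, hgh, vec_mulAutOfMatrix]
  · intro f
    have hM : ∀ f : MulAut ((G →* kˣ) × G), ∃ M : Matrix (Fin n ⊕ Fin n) (Fin n ⊕ Fin n) (ZMod p),
        ∀ q, M.mulVec (K.vec q) = K.vec (f q) := by
      intro f
      let F : (Fin n ⊕ Fin n → ZMod p) →+ (Fin n ⊕ Fin n → ZMod p) :=
        AddMonoidHom.mk' (fun v => K.vec (f (K.vecEquiv.symm v))) fun u v => by
          rw [← vec_mul, ← map_mul]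
          congr 2
          apply K.vec_injective
          rw [vec_mul, vec_vecEquiv_symm, vec_vecEquiv_symm, vec_vecEquiv_symm]
      refine ⟨LinearMap.toMatrix' (F.toZModLinearMap p), fun q => ?_⟩
      rw [LinearMap.toMatrix'_mulVec]
      change K.vec (f (K.vecEquiv.symm (K.vecEquiv q))) = _
      rw [Equiv.symm_apply_apply]
    obtain ⟨M, hM₁⟩ := hM f
    obtain ⟨N, hN₁⟩ := hM f⁻¹
    refine ⟨⟨M, N, K.matrix_ext fun q => ?_, K.matrix_ext fun q => ?_⟩, MulEquiv.ext fun q =>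
      K.vec_injective ?_⟩
    · rw [← Matrix.mulVec_mulVec, hN₁, hM₁, MulAut.apply_inv_self, Matrix.one_mulVec]
    · rw [← Matrix.mulVec_mulVec, hM₁, hN₁, MulAut.inv_apply_self, Matrix.one_mulVec]
    · rw [vec_mulAutOfMatrix, hM₁]

theorem group_mul_comm (K : Coordinates k G p n) (a b : G) : a * b = b * a :=
  K.y_injective (by rw [y_mul, y_mul, add_comm])

theorem group_pow_eq_one (K : Coordinates k G p n) (a : G) : a ^ p = 1 := by
  refine K.coord.injective ?_
  rw [map_pow, map_one]
  change p • Multiplicative.toAdd (K.coord a) = 0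
  ext i
  simp

end General

section Matrix

variable {k G : Type*} [Field k] [IsAlgClosed k] [CharZero k] [Group G] [Fintype G] [DecidableEq G]
variable {p n : ℕ} (K : Coordinates k G p n)

/-- The matrix of the action of a Hopf automorphism on the group-like elements. -/
noncomputable def toGL : HopfAut k G ≃* GL (Fin n ⊕ Fin n) (ZMod p) :=
  (MulEquiv.ofBijective (glAut k G)
    ⟨glAut_injective K.group_mul_comm, glAut_surjective K.group_mul_comm⟩).trans
    (MulEquiv.ofBijective K.mulAutOfMatrix K.mulAutOfMatrix_bijective).symm

theorem toGL_mulVec (φ : HopfAut k G) (q : (G →* kˣ) × G) :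
    (K.toGL φ).val.mulVec (K.vec q) = K.vec (glMap φ q) := by
  rw [← vec_mulAutOfMatrix]
  exact congrArg K.vec (DFunLike.congr_fun ((MulEquiv.ofBijective K.mulAutOfMatrix
    K.mulAutOfMatrix_bijective).apply_symm_apply (glAut k G φ)) q)

theorem toGL_eq {φ : HopfAut k G} {M : Matrix (Fin n ⊕ Fin n) (Fin n ⊕ Fin n) (ZMod p)}
    (h : ∀ q, M.mulVec (K.vec q) = K.vec (glMap φ q)) : (K.toGL φ).val = M :=
  K.matrix_ext fun q => by rw [toGL_mulVec, h]

variable (φ : HopfAut k G)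

theorem toGL_mulVec_blocks (χ : G →* kˣ) (g : G) :
    Sum.elim ((K.toGL φ).val.toBlocks₁₁.mulVec (K.x χ) + (K.toGL φ).val.toBlocks₁₂.mulVec (K.y g))
      ((K.toGL φ).val.toBlocks₂₁.mulVec (K.x χ) + (K.toGL φ).val.toBlocks₂₂.mulVec (K.y g)) =
      Sum.elim (K.x (glMap φ (χ, g)).1) (K.y (glMap φ (χ, g)).2) := by
  have h1 := K.toGL_mulVec φ (χ, g)
  rw [← Matrix.fromBlocks_toBlocks (K.toGL φ).val, Matrix.fromBlocks_mulVec] at h1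
  exact h1

theorem toBlocks₁₁_mulVec (χ : G →* kˣ) :
    (K.toGL φ).val.toBlocks₁₁.mulVec (K.x χ) = K.x (glMap φ (χ, 1)).1 := by
  have h1 := congrArg (· ∘ Sum.inl) (K.toGL_mulVec_blocks φ χ 1)
  simpa [K.y_one] using h1

theorem toBlocks₂₁_mulVec (χ : G →* kˣ) :
    (K.toGL φ).val.toBlocks₂₁.mulVec (K.x χ) = K.y (glMap φ (χ, 1)).2 := by
  have h1 := congrArg (· ∘ Sum.inr) (K.toGL_mulVec_blocks φ χ 1)
  simpa [K.y_one] using h1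

theorem toBlocks₁₂_mulVec (g : G) :
    (K.toGL φ).val.toBlocks₁₂.mulVec (K.y g) = K.x (glMap φ (1, g)).1 := by
  have h1 := congrArg (· ∘ Sum.inl) (K.toGL_mulVec_blocks φ 1 g)
  simpa [K.x_one] using h1

theorem toBlocks₂₂_mulVec (g : G) :
    (K.toGL φ).val.toBlocks₂₂.mulVec (K.y g) = K.y (glMap φ (1, g)).2 := by
  have h1 := congrArg (· ∘ Sum.inr) (K.toGL_mulVec_blocks φ 1 g)
  simpa [K.x_one] using h1

/-- `G` is its own centre. -/
def toCenter (K : Coordinates k G p n) : G →* Subgroup.center G :=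
  MonoidHom.mk' (fun g => ⟨g, Subgroup.mem_center_iff.2 fun h => K.group_mul_comm h g⟩)
    fun _ _ => rfl

/-- The lower left block of the matrix is the entry `a`. -/
theorem aPart_eq_one_iff : aPart φ = 1 ↔ (K.toGL φ).val.toBlocks₂₁ = 0 := by
  have h1 : ∀ χ : G →* kˣ, (K.toGL φ).val.toBlocks₂₁.mulVec (K.x χ) =
      K.y (aPart φ (χ.comp (Subgroup.center G).subtype)) := by
    intro χ
    rw [toBlocks₂₁_mulVec, glMap_apply]
    dsimp only
    rw [map_one (vPart φ), mul_one]
  constructor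
  · intro h
    refine K.matrix_ext_x fun χ => ?_
    rw [h1, h, Matrix.zero_mulVec]
    exact K.y_one
  · intro h
    ext χ
    have h2 := h1 (χ.comp K.toCenter)
    rw [h, Matrix.zero_mulVec, ← K.y_one] at h2
    exact (K.y_injective h2).symm

/-- The upper right block of the matrix is the entry `b`. -/
theorem bPart_eq_one_iff : bPart φ = 1 ↔ (K.toGL φ).val.toBlocks₁₂ = 0 := by
  constructor
  · intro h
    refine K.matrix_ext_y fun g => ?_
    rw [toBlocks₁₂_mulVec, Matrix.zero_mulVec]
    exact (congrArg K.x (DFunLike.congr_fun h g)).trans K.x_one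
  · intro h
    refine MonoidHom.ext fun g => K.x_injective ?_
    have h1 := K.toBlocks₁₂_mulVec φ g
    rw [h, Matrix.zero_mulVec] at h1
    exact h1.symm.trans K.x_one.symm

theorem mem_B_iff : φ ∈ B k G ↔ ∃ X : Matrix (Fin n) (Fin n) (ZMod p),
    (K.toGL φ).val = Matrix.fromBlocks 1 X 0 1 := by
  constructor
  · rintro ⟨b, rfl⟩
    obtain ⟨b, rfl⟩ := exists_eq_liftB b
    have h1 : ∀ χ g, glMap (homB k G (liftB b)) (χ, g) = (χ * b g, g) := fun χ g =>
      glMap_eq (autB_liftB_grp b χ g)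
    refine ⟨(K.toGL (homB k G (liftB b))).val.toBlocks₁₂, ?_⟩
    conv_lhs => rw [← Matrix.fromBlocks_toBlocks (K.toGL (homB k G (liftB b))).val]
    congr 1
    · refine K.matrix_ext_x fun χ => ?_
      rw [toBlocks₁₁_mulVec, h1, Matrix.one_mulVec, map_one, K.x_mul, K.x_one, add_zero]
    · refine K.matrix_ext_x fun χ => ?_
      rw [toBlocks₂₁_mulVec, h1, Matrix.zero_mulVec, K.y_one]
    · refine K.matrix_ext_y fun χ => ?_
      rw [toBlocks₂₂_mulVec, h1, Matrix.one_mulVec]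
  · rintro ⟨X, hX⟩
    let b : G →* (G →* kˣ) := K.liftX (fun g => X.mulVec (K.y g)) fun g h => by
      rw [K.y_mul, Matrix.mulVec_add]
    refine ⟨liftB b, glAut_injective K.group_mul_comm (MulEquiv.ext fun q => K.vec_injective ?_)⟩
    have h1 : glMap (homB k G (liftB b)) q = (q.1 * b q.2, q.2) :=
      glMap_eq (autB_liftB_grp b q.1 q.2)
    rw [glAut_apply, glAut_apply, ← K.toGL_mulVec φ, hX, h1, vec, Matrix.fromBlocks_mulVec, vec,
      K.x_mul, K.x_liftX]
    simp

theorem mem_E_iff : φ ∈ E k G ↔ ∃ X : Matrix (Fin n) (Fin n) (ZMod p),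
    (K.toGL φ).val = Matrix.fromBlocks 1 0 X 1 := by
  constructor
  · rintro ⟨a, rfl⟩
    have h1 : ∀ χ g, glMap (homE k G a) (χ, g) =
        (χ, a (χ.comp (Subgroup.center G).subtype) * g) := fun χ g => glMap_eq (homE_grp a χ g)
    have h2 : (1 : G →* kˣ).comp (Subgroup.center G).subtype = 1 := rfl
    refine ⟨(K.toGL (homE k G a)).val.toBlocks₂₁, ?_⟩
    conv_lhs => rw [← Matrix.fromBlocks_toBlocks (K.toGL (homE k G a)).val]
    congr 1
    · refine K.matrix_ext_x fun χ => ?_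
      rw [toBlocks₁₁_mulVec, h1, Matrix.one_mulVec]
    · refine K.matrix_ext_y fun χ => ?_
      rw [toBlocks₁₂_mulVec, h1, Matrix.zero_mulVec, K.x_one]
    · refine K.matrix_ext_y fun χ => ?_
      rw [toBlocks₂₂_mulVec, h1, Matrix.one_mulVec, h2, map_one, OneMemClass.coe_one, one_mul]
  · rintro ⟨X, hX⟩
    have hf : ∀ χ ψ : Subgroup.center G →* kˣ, X.mulVec (K.x ((χ * ψ).comp K.toCenter)) =
        X.mulVec (K.x (χ.comp K.toCenter)) + X.mulVec (K.x (ψ.comp K.toCenter)) := fun χ ψ => by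
      rw [MonoidHom.mul_comp, K.x_mul, Matrix.mulVec_add]
    obtain ⟨l, hl⟩ : ∃ l : (Subgroup.center G →* kˣ) →* G,
        ∀ χ, K.y (l χ) = X.mulVec (K.x (χ.comp K.toCenter)) := ⟨_, K.y_liftY _ hf⟩
    let a : (Subgroup.center G →* kˣ) →* Subgroup.center G := K.toCenter.comp l
    refine ⟨a, glAut_injective K.group_mul_comm (MulEquiv.ext fun q => K.vec_injective ?_)⟩
    have h1 : glMap (homE k G a) q = (q.1, a (q.1.comp (Subgroup.center G).subtype) * q.2) :=
      glMap_eq (homE_grp a q.1 q.2)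
    have h2 : K.y (a (q.1.comp (Subgroup.center G).subtype)) = X.mulVec (K.x q.1) :=
      hl _
    rw [glAut_apply, glAut_apply, ← K.toGL_mulVec φ, hX, h1, vec, Matrix.fromBlocks_mulVec, vec,
      K.y_mul, h2]
    simp

theorem mem_VcVB_iff : φ ∈ VcVB k G ↔ (K.toGL φ).val.toBlocks₂₁ = 0 :=
  DrinfeldDouble.mem_VcVB_iff.trans (K.aPart_eq_one_iff φ)

theorem mem_VcVE_iff : φ ∈ VcVE k G ↔ (K.toGL φ).val.toBlocks₁₂ = 0 :=
  DrinfeldDouble.mem_VcVE_iff.trans (K.bPart_eq_one_iff φ)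

theorem mem_VcV_iff : φ ∈ VcV k G ↔
    (K.toGL φ).val.toBlocks₁₂ = 0 ∧ (K.toGL φ).val.toBlocks₂₁ = 0 :=
  DrinfeldDouble.mem_VcV_iff.trans
    ((and_congr (K.aPart_eq_one_iff φ) (K.bPart_eq_one_iff φ)).trans and_comm)

end Matrix

end Coordinates

/-! ### The Bruhat-type decomposition of the general linear group -/

namespace Coordinates

section Reflections

variable {k G : Type*} [Field k] [IsAlgClosed k] [CharZero k] [Group G] [Fintype G] [DecidableEq G]
variable {p n : ℕ} [Fact p.Prime]

/-- The reflection of the subgroup of elements supported on the first `m` coordinates, identified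
with its dual by the standard bilinear form. -/
theorem exists_coord_reflection (K : Coordinates k G p n) {m : ℕ} (hm : m ≤ n) :
    ∃ d : TwistedReflection k G, d.ν = 1 ∧ Nat.card d.C = p ^ m ∧
      (K.toGL d.toAut).val = swapMatrix (ZMod p) n m := by
  obtain ⟨f, hf⟩ : ∃ f : G →* G, ∀ g, K.y (f g) =
      fun i : Fin n => if (i : ℕ) < m then 0 else K.y g i :=
    ⟨_, K.y_liftY (fun g (i : Fin n) => if (i : ℕ) < m then 0 else K.y g i) fun g h => by
      ext i
      by_cases hi : (i : ℕ) < m <;> simp [hi, K.y_mul]⟩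
  have hker : ∀ g, g ∈ f.ker ↔ ∀ i : Fin n, ¬ (i : ℕ) < m → K.y g i = 0 := by
    intro g
    rw [MonoidHom.mem_ker]
    constructor
    · intro h i hi
      have h1 := congrFun (hf g) i
      rw [h, K.y_one, if_neg hi] at h1
      exact h1.symm
    · intro h
      apply K.y_injective
      rw [hf, K.y_one]
      ext i
      by_cases hi : (i : ℕ) < m
      · simp [hi]
      · simpa [hi] using h i hi
  have hff : ∀ g, f (f g) = f g := by
    intro g
    apply K.y_injective
    rw [hf, hf]
    ext i
    by_cases hi : (i : ℕ) < m <;> simp [hi]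
  have hz : ∀ g, g * (f g)⁻¹ ∈ Subgroup.center G := fun g => (K.toCenter _).2
  let t : f.ker →* (f.ker →* kˣ) :=
    { toFun := fun c => MonoidHom.mk' (fun c' => K.ζ (K.y c ⬝ᵥ K.y c')) fun a b => by
        rw [Subgroup.coe_mul, K.y_mul, dotProduct_add, AddChar.map_add_eq_mul]
      map_one' := by
        ext c
        simp [K.y_one]
      map_mul' := fun a b => by
        ext c
        simp [K.y_mul, add_dotProduct, AddChar.map_add_eq_mul] }
  have ht : Function.Injective t := by
    rw [injective_iff_map_eq_one]
    intro c hc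
    refine Subtype.ext (K.y_injective (funext fun i => ?_))
    rw [OneMemClass.coe_one, K.y_one]
    by_cases hi : (i : ℕ) < m
    · obtain ⟨u, hu⟩ := K.y_surjective (Pi.single i 1)
      have hu' : u ∈ f.ker := by
        rw [hker]
        intro j hj
        rw [hu, Pi.single_eq_of_ne]
        rintro rfl
        exact hj hi
      have h1 : K.ζ (K.y c ⬝ᵥ K.y u) = 1 := DFunLike.congr_fun hc ⟨u, hu'⟩
      rw [hu, dotProduct_single, mul_one] at h1
      exact K.eq_zero _ h1
    · exact (hker _).1 c.2 i hi
  have hcomm : ∀ a b : f.ker, a * b = b * a := fun a b => Subtype.ext (K.group_mul_comm _ _)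
  obtain ⟨δ₀⟩ := exists_dual (k := k) hcomm
  have hfin : Finite (f.ker →* kˣ) := Finite.of_equiv _ δ₀.toEquiv
  let δ : f.ker ≃* (f.ker →* kˣ) := MulEquiv.ofBijective t
    ((Nat.bijective_iff_injective_and_card t).2 ⟨ht, Nat.card_congr δ₀.toEquiv⟩)
  let d : TwistedReflection k G := ofIdem f hff hz δ 1 isNilpotentEnd_one
  have hH : ∀ g i, K.y (d.projH g) i = if (i : ℕ) < m then 0 else K.y g i := by
    intro g i
    rw [show (d.projH g : G) = f g from projH_ofIdem f hff hz δ 1 _ g, hf]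
  have hC : ∀ g i, K.y (d.projC g) i = if (i : ℕ) < m then K.y g i else 0 := by
    intro g i
    have h1 := congrFun (congrArg K.y (d.projH_mul_projC g)) i
    rw [K.y_mul, Pi.add_apply, hH] at h1
    by_cases hi : (i : ℕ) < m
    · simpa [hi] using h1
    · simpa [hi] using h1
  refine ⟨d, rfl, ?_, K.toGL_eq fun q => ?_⟩
  · let F : f.ker → (Fin m → ZMod p) := fun c i => K.y c (Fin.castLE hm i)
    have hF : Function.Bijective F := by
      constructor
      · intro c c' h
        refine Subtype.ext (K.y_injective (funext fun i => ?_))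
        by_cases hi : (i : ℕ) < m
        · exact congrFun h ⟨i, hi⟩
        · rw [(hker _).1 c.2 i hi, (hker _).1 c'.2 i hi]
      · intro v
        obtain ⟨g, hg⟩ := K.y_surjective fun i : Fin n => if hi : (i : ℕ) < m then v ⟨i, hi⟩ else 0
        refine ⟨⟨g, (hker g).2 fun i hi => by rw [hg]; exact dif_neg hi⟩, funext fun i => ?_⟩
        change K.y g _ = _
        rw [hg]
        simp
    have h1 := Nat.card_congr (Equiv.ofBijective F hF)
    rw [Nat.card_fun, Nat.card_zmod, Nat.card_fin] at h1
    exact h1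
  · obtain ⟨χ, g⟩ := q
    rw [glMap_eq (d.toAut_grp χ g), swapMatrix, vec, Matrix.fromBlocks_mulVec, vec]
    congr 1
    · symm
      refine K.eq_of_forall_char fun g' => ?_
      rw [← K.char_eq, MonoidHom.mul_apply]
      change χ (d.projH g') * K.ζ (K.y (d.projC g) ⬝ᵥ K.y (d.projC g')) = _
      rw [K.char_eq, ← AddChar.map_add_eq_mul]
      congr 1
      simp only [dotProduct, ← Finset.sum_add_distrib]
      refine Finset.sum_congr rfl fun i _ => ?_
      rw [hH, hC, hC]
      by_cases hi : (i : ℕ) < m <;> simp [hi, Matrix.mulVec_diagonal]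
    · symm
      obtain ⟨c₀, hc₀⟩ := K.y_surjective fun i : Fin n => if (i : ℕ) < m then K.x χ i else 0
      have hc₀' : c₀ ∈ f.ker := (hker _).2 fun i hi => by rw [hc₀]; exact if_neg hi
      have h1 : d.δ.symm (χ.comp d.C.subtype) = ⟨c₀, hc₀'⟩ := by
        rw [MulEquiv.symm_apply_eq]
        ext c
        refine congrArg Units.val (?_ : χ (c : G) = K.ζ (K.y c₀ ⬝ᵥ K.y (c : G)))
        rw [K.char_eq, hc₀]
        congr 1
        refine Finset.sum_congr rfl fun i _ => ?_
        by_cases hi : (i : ℕ) < m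
        · simp only [if_pos hi]
        · rw [(hker _).1 c.2 i hi, mul_zero, mul_zero]
      change K.y ((d.projH g : G) * ((d.δ.symm (χ.comp d.C.subtype) * (1 : d.C) : d.C) : G)) = _
      rw [mul_one, h1, K.y_mul]
      change K.y (d.projH g) + K.y c₀ = _
      ext i
      rw [Pi.add_apply, hH, hc₀]
      by_cases hi : (i : ℕ) < m <;> simp [hi, Matrix.mulVec_diagonal]

/-- For elementary abelian `G` the double cosets are represented by the reflections of any family
of factors of all possible orders. -/
theorem existsUnique_mem_cell (K : Coordinates k G p n) {d : Fin (n + 1) → TwistedReflection k G}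
    (hd : ∀ m, (d m).ν = 1) (hcard : ∀ m, Nat.card (d m).C = p ^ (m : ℕ)) (φ : HopfAut k G) :
    ∃! m, φ ∈ (d m).cell := by
  have hp : p.Prime := Fact.out
  obtain ⟨r, hrad, hr⟩ := exists_mem_cell φ
  have hν : r.ν = 1 := hrad.eq_one_of_coord (K.coord.toMonoidHom.comp r.C.subtype)
    (K.coord.injective.comp r.C.subtype_injective)
  have hG : Nat.card G = p ^ n := by
    rw [Nat.card_congr (K.coord.toEquiv.trans Multiplicative.toAdd), Nat.card_fun, Nat.card_zmod,
      Nat.card_fin]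
  obtain ⟨m, hm, hrm⟩ := (Nat.dvd_prime_pow hp).1 (hG ▸ Subgroup.card_subgroup_dvd_card r.C)
  have hpow : ∀ (C : Subgroup G) (a : C), a ^ p = 1 := fun C a =>
    Subtype.ext (K.group_pow_eq_one a)
  have hmem : φ ∈ (d ⟨m, Nat.lt_succ_of_le hm⟩).cell := by
    rw [cell_eq_of_mulEquiv (hd _) hν (nonempty_mulEquiv_of_card (p := p)
      (TwistedReflection.mul_comm_C _) r.mul_comm_C (hpow _) (hpow _) (by rw [hcard, hrm])).some]
    exact hr
  refine ⟨_, hmem, fun m' hm' => ?_⟩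
  obtain ⟨i⟩ := nonempty_mulEquiv_of_cell_eq (hd m') (hd ⟨m, Nat.lt_succ_of_le hm⟩)
    ((DoubleCoset.doubleCoset_eq_of_mem hm').symm.trans (DoubleCoset.doubleCoset_eq_of_mem hmem))
  have h1 := Nat.card_congr i.toEquiv
  rw [hcard, hcard] at h1
  exact Fin.ext (Nat.pow_right_injective hp.two_le h1)

theorem exists_bruhat (K : Coordinates k G p n) :
    ∃ (Ψ : HopfAut k G ≃* GL (Fin n ⊕ Fin n) (ZMod p))
        (d : Fin (n + 1) → TwistedReflection k G),
        (∀ φ, φ ∈ VcV k G ↔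
          ((Ψ φ).val.toBlocks₁₂ = 0 ∧ (Ψ φ).val.toBlocks₂₁ = 0)) ∧
        (∀ φ, φ ∈ B k G ↔
          ∃ X : Matrix (Fin n) (Fin n) (ZMod p), (Ψ φ).val = Matrix.fromBlocks 1 X 0 1) ∧
        (∀ φ, φ ∈ E k G ↔
          ∃ X : Matrix (Fin n) (Fin n) (ZMod p), (Ψ φ).val = Matrix.fromBlocks 1 0 X 1) ∧
        (∀ φ, φ ∈ VcVB k G ↔ (Ψ φ).val.toBlocks₂₁ = 0) ∧
        (∀ φ, φ ∈ VcVE k G ↔ (Ψ φ).val.toBlocks₁₂ = 0) ∧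
        (∀ m, (d m).ν = 1 ∧ Nat.card (d m).C = p ^ (m : ℕ) ∧
          (Ψ (d m).toAut).val = swapMatrix (ZMod p) n m) ∧
        (∀ g : GL (Fin n ⊕ Fin n) (ZMod p), ∃! m : Fin (n + 1),
          ∃ x y : GL (Fin n ⊕ Fin n) (ZMod p), x.val.toBlocks₂₁ = 0 ∧ y.val.toBlocks₁₂ = 0 ∧
            g.val = x.val * swapMatrix (ZMod p) n m * y.val) := by
  choose d hd hcard hswap using fun m : Fin (n + 1) =>
    K.exists_coord_reflection (Nat.le_of_lt_succ m.2)
  refine ⟨K.toGL, d, K.mem_VcV_iff, K.mem_B_iff, K.mem_E_iff, K.mem_VcVB_iff, K.mem_VcVE_iff,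
    fun m => ⟨hd m, hcard m, hswap m⟩, fun g => ?_⟩
  have key : ∀ m : Fin (n + 1), (∃ x y : GL (Fin n ⊕ Fin n) (ZMod p), x.val.toBlocks₂₁ = 0 ∧
      y.val.toBlocks₁₂ = 0 ∧ g.val = x.val * swapMatrix (ZMod p) n m * y.val) ↔
      K.toGL.symm g ∈ (d m).cell := by
    intro m
    rw [TwistedReflection.cell, DoubleCoset.mem_doubleCoset, ← hswap m]
    constructor
    · rintro ⟨x, y, hx, hy, h⟩
      refine ⟨K.toGL.symm x, ?_, K.toGL.symm y, ?_, ?_⟩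
      · rw [SetLike.mem_coe, K.mem_VcVB_iff, MulEquiv.apply_symm_apply, hx]
      · rw [SetLike.mem_coe, K.mem_VcVE_iff, MulEquiv.apply_symm_apply, hy]
      · rw [MulEquiv.symm_apply_eq, map_mul, map_mul, MulEquiv.apply_symm_apply,
          MulEquiv.apply_symm_apply]
        exact Units.ext h
    · rintro ⟨x, hx, y, hy, h⟩
      refine ⟨K.toGL x, K.toGL y, (K.mem_VcVB_iff x).1 hx, (K.mem_VcVE_iff y).1 hy, ?_⟩
      rw [MulEquiv.symm_apply_eq, map_mul, map_mul] at h
      rw [h]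
      rfl
  simp only [key]
  exact K.existsUnique_mem_cell hd hcard _

end Reflections

end Coordinates

end DrinfeldDouble

theorem theorem4p9 {k : Type*} [Field k] [IsAlgClosed k] [CharZero k]
    {G : Type*} [Group G] [Fintype G] [DecidableEq G] :
    -- `V ≅ Aut(G)`, `V_c ≅ Aut_c(G)`, `B ≅ Hom(G_ab, Ĝ_ab)`, `E ≅ Hom(Ẑ(G), Z(G))`
    (Function.Injective (DrinfeldDouble.homV k G) ∧
      Function.Injective (DrinfeldDouble.homVc k G) ∧
      Function.Injective (DrinfeldDouble.homB k G) ∧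
      Function.Injective (DrinfeldDouble.homE k G)) ∧
    -- the semidirect products `V_c ⋊ V`, `(V_c ⋊ V) ⋉ B` and `(V_c ⋊ V) ⋉ E`
    ((DrinfeldDouble.V k G ≤
        Subgroup.normalizer (DrinfeldDouble.Vc k G : Set (DrinfeldDouble.HopfAut k G)) ∧
        Disjoint (DrinfeldDouble.Vc k G) (DrinfeldDouble.V k G)) ∧
      (DrinfeldDouble.VcV k G ≤
        Subgroup.normalizer (DrinfeldDouble.B k G : Set (DrinfeldDouble.HopfAut k G)) ∧
        Disjoint (DrinfeldDouble.VcV k G) (DrinfeldDouble.B k G)) ∧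
      (DrinfeldDouble.VcV k G ≤
        Subgroup.normalizer (DrinfeldDouble.E k G : Set (DrinfeldDouble.HopfAut k G)) ∧
        Disjoint (DrinfeldDouble.VcV k G) (DrinfeldDouble.E k G))) ∧
    -- generation
    Subgroup.closure ((DrinfeldDouble.V k G : Set (DrinfeldDouble.HopfAut k G)) ∪
      DrinfeldDouble.Vc k G ∪ DrinfeldDouble.B k G ∪ DrinfeldDouble.E k G ∪
      DrinfeldDouble.reflections k G) = ⊤ ∧
    -- every automorphism lies in the double coset of a twisted reflection
    (∀ φ : DrinfeldDouble.HopfAut k G, ∃ d : DrinfeldDouble.TwistedReflection k G, φ ∈ d.cell) ∧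
    -- double cosets of reflections
    (∀ d d' : DrinfeldDouble.TwistedReflection k G, d.ν = 1 → d'.ν = 1 →
      (d.cell = d'.cell ↔ Nonempty (d.C ≃* d'.C))) ∧
    -- `φ ∈ r · [B ((V_c ⋊ V) ⋉ E)]` for a reflection `r`
    (∀ φ : DrinfeldDouble.HopfAut k G, ∃ d : DrinfeldDouble.TwistedReflection k G, d.ν = 1 ∧
      ∃ b ∈ DrinfeldDouble.B k G, ∃ y ∈ DrinfeldDouble.VcVE k G, φ = d.toAut * (b * y)) ∧
    -- `φ ∈ [((V_c ⋊ V) ⋉ B) E] · r` for a reflection `r`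
    (∀ φ : DrinfeldDouble.HopfAut k G, ∃ d : DrinfeldDouble.TwistedReflection k G, d.ν = 1 ∧
      ∃ x ∈ DrinfeldDouble.VcVB k G, ∃ a ∈ DrinfeldDouble.E k G, φ = (x * a) * d.toAut) ∧
    -- for `G = F_p^n` this is a Bruhat-type decomposition of `GL_{2n}(F_p)`
    (∀ (p n : ℕ) [Fact p.Prime], Nonempty (G ≃* Multiplicative (Fin n → ZMod p)) →
      ∃ (Ψ : DrinfeldDouble.HopfAut k G ≃* GL (Fin n ⊕ Fin n) (ZMod p))
        (d : Fin (n + 1) → DrinfeldDouble.TwistedReflection k G),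
        (∀ φ, φ ∈ DrinfeldDouble.VcV k G ↔
          ((Ψ φ).val.toBlocks₁₂ = 0 ∧ (Ψ φ).val.toBlocks₂₁ = 0)) ∧
        (∀ φ, φ ∈ DrinfeldDouble.B k G ↔
          ∃ X : Matrix (Fin n) (Fin n) (ZMod p), (Ψ φ).val = Matrix.fromBlocks 1 X 0 1) ∧
        (∀ φ, φ ∈ DrinfeldDouble.E k G ↔
          ∃ X : Matrix (Fin n) (Fin n) (ZMod p), (Ψ φ).val = Matrix.fromBlocks 1 0 X 1) ∧
        (∀ φ, φ ∈ DrinfeldDouble.VcVB k G ↔ (Ψ φ).val.toBlocks₂₁ = 0) ∧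
        (∀ φ, φ ∈ DrinfeldDouble.VcVE k G ↔ (Ψ φ).val.toBlocks₁₂ = 0) ∧
        (∀ m, (d m).ν = 1 ∧ Nat.card (d m).C = p ^ (m : ℕ) ∧
          (Ψ (d m).toAut).val = DrinfeldDouble.swapMatrix (ZMod p) n m) ∧
        (∀ g : GL (Fin n ⊕ Fin n) (ZMod p), ∃! m : Fin (n + 1),
          ∃ x y : GL (Fin n ⊕ Fin n) (ZMod p), x.val.toBlocks₂₁ = 0 ∧ y.val.toBlocks₁₂ = 0 ∧
            g.val = x.val * DrinfeldDouble.swapMatrix (ZMod p) n m * y.val)) := by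
  open DrinfeldDouble in
  exact ⟨⟨homV_injective, homVc_injective, homB_injective, homE_injective⟩,
    ⟨⟨V_le_normalizer_Vc, disjoint_Vc_V⟩, ⟨VcV_le_normalizer_B, disjoint_VcV_B⟩,
      ⟨VcV_le_normalizer_E, disjoint_VcV_E⟩⟩,
    closure_eq_top, fun φ => (exists_mem_cell φ).imp fun _ h => h.2,
    fun d d' hd hd' => cell_eq_iff hd hd', exists_eq_reflection_mul, exists_eq_mul_reflection,
    fun p n _ ⟨Y⟩ => (nonempty_coordinates k Y).some.exists_bruhat⟩
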